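/- Let $M$ be a smooth (Hausdorff, second countable) manifold of dimension $2n$ with symplectic form $J_{ab}$, let $E$ be a smooth real vector bundle of finite rank on $M$, and let $\nabla$ be a smooth connection on $E$ that is symplectically flat, i.e. there are endomorphisms $\Theta_x$ of the fibres $E_x$ with $$(\nabla_a\nabla_b-\nabla_b\nabla_a)\Sigma=2J_{ab}\Theta\Sigma\qquad\text{for all smooth sections }\Sigma\text{ of }E;$$ that is, the curvature is $R(X,Y)\Sigma=2J(X,Y)\,\Theta\Sigma$. If $n=1$ (where such a $\Theta$ always exists), assume in addition that $\nabla(\Theta\Sigma)=\Theta\nabla\Sigma$ for all smooth local sections $\Sigma$. Write $\Lambda^k$ for the bundle of $k$-forms and use the unit-weight convention for antisymmetrisation: the coupled exterior derivative $\nabla:\Lambda^k\otimes E\to\Lambda^{k+1}\otimes E$ is $\nabla_{[a}\phi_{b\cdots c]}$, i.e. $(\nabla\phi)(X_0,\dots,X_k)=\frac1{k+1}\sum_i(-1)^i\nabla_{X_i}\big(\phi(X_0,\dots,\widehat{X_i},\dots,X_k)\big)$ for vector fields whose mutual brackets vanish at the point in question, and $(J\wedge\psi)_{abc\cdots d}=J_{[ab}\psi_{c\cdots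 d]}$. Then: 1. $\Theta$ is a smooth bundle endomorphism, it is parallel ($\nabla\Theta=0$), and its rank is locally constant (so it is constant on connected components). 2. $\ker\Theta$ and $\operatorname{coker}\Theta=E/\Theta E$ are smooth vector bundles, and $\nabla$ induces flat connections on them (so that $\ker\Theta\to E$ and $E\to\operatorname{coker}\Theta$ commute with the connections). Their parallel sections form locally constant sheaves $\underline{\ker\Theta}$ and $\underline{\operatorname{coker}\Theta}$, with stalks $\ker\Theta_x$ and $\operatorname{coker}\Theta_x$. 3. Put $C^0=E$ and $C^k=(\Lambda^k\otimes E)\oplus(\Lambda^{k-1}\otimes E)$ for $k\ge1$, with the operators $D_0\Sigma=(\nabla\Sigma,\Theta\Sigma)$ and $$D_k(\phi,\eta)=\big(\nabla\phi+(-1)^kJ\wedge\eta,\ \nabla\eta+(-1)^k\Theta\phi\big)\qquad(k\ge1).$$ Then $D_0,D_1,D_2,\dots$ are first-order linear differential operators with $D_{k+1}D_k=0$, and the complex $0\to C^0\to C^1\to C^2\to\cdots$ is elliptic: for every non-zero covector $\xi$ the sequence of principal symbols is exact. 4. The complex is locally exact in every degree $k\ge2$. In degree $0$, the sheaf of solutions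 of $D_0\Sigma=0$ is $\underline{\ker\Theta}$. In degree $1$, the map $(\phi,\eta)\mapsto\eta\bmod\Theta E$ induces an isomorphism of the cohomology sheaf (local solutions of $D_1(\phi,\eta)=0$ modulo those that are locally of the form $D_0\Sigma$) with $\underline{\operatorname{coker}\Theta}$. -/

import Mathlib

open Bundle Set Topology
open scoped Manifold ContDiff

noncomputable section

namespace SymplecticallyFlat

universe u v w

/-! ### Antisymmetrised products with a two-form -/

section Algebra

variable {T W : Type*} [AddCommGroup T] [Module ℝ T] [TopologicalSpace T]
  [AddCommGroup W] [Module ℝ W] [TopologicalSpace W]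

/-- The bilinear map `(a, b) ↦ J(a, b)` of a two-form `J`. -/
def bilin (J : T [⋀^Fin 2]→L[ℝ] ℝ) : T →ₗ[ℝ] T →ₗ[ℝ] ℝ :=
  LinearMap.mk₂ ℝ (fun a b => J ![a, b])
    (fun a a' b => by simpa using J.toAlternatingMap.map_vecCons_add ![b] a a')
    (fun c a b => by simpa using J.toAlternatingMap.map_vecCons_smul ![b] c a)
    (fun a b b' => by
      have e : ∀ z : T, ![a, z] = Function.update ![a, 0] 1 z := fun z => by
        funext i
        fin_cases i <;> rfl
      rw [e, e b, e b', J.map_update_add])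
    (fun c a b => by
      have e : ∀ z : T, ![a, z] = Function.update ![a, 0] 1 z := fun z => by
        funext i
        fin_cases i <;> rfl
      rw [e, e b, J.map_update_smul])

/-- For a two-form `J`, a `k`-form `ψ` and a vector `a`, the `(k+1)`-form
`(v_0, …, v_k) ↦ ∑ j, (-1)^j J(a, v_j) ψ(v_0, …, v̂_j, …, v_k)`. -/
def wedgeAux (J : T [⋀^Fin 2]→L[ℝ] ℝ) {k : ℕ} (ψ : T [⋀^Fin k]→L[ℝ] W) :
    T →ₗ[ℝ] T [⋀^Fin (k + 1)]→ₗ[ℝ] W where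
  toFun a := AlternatingMap.alternatizeUncurryFin ((bilin J a).smulRight ψ.toAlternatingMap)
  map_add' a b := by
    ext v
    simp [AlternatingMap.alternatizeUncurryFin_apply, add_smul, Finset.sum_add_distrib]
  map_smul' c a := by
    ext v
    simp [AlternatingMap.alternatizeUncurryFin_apply, mul_smul, Finset.smul_sum, smul_comm c]

theorem wedgeAux_apply (J : T [⋀^Fin 2]→L[ℝ] ℝ) {k : ℕ} (ψ : T [⋀^Fin k]→L[ℝ] W)
    (v : Fin (k + 2) → T) :
    ((((k : ℝ) + 2) * ((k : ℝ) + 1))⁻¹ • AlternatingMap.alternatizeUncurryFin (wedgeAux J ψ)) v =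
      (((k : ℝ) + 2) * ((k : ℝ) + 1))⁻¹ • ∑ i : Fin (k + 2), (-1 : ℤ) ^ (i : ℕ) •
        ∑ j : Fin (k + 1), (-1 : ℤ) ^ (j : ℕ) •
          (J ![v i, i.removeNth v j] • ψ (j.removeNth (i.removeNth v))) := by
  simp [wedgeAux, bilin, AlternatingMap.alternatizeUncurryFin_apply]

variable [IsTopologicalAddGroup W] [ContinuousSMul ℝ W]

/-- The product `J ∧ ψ` of a two-form `J` and a vector-valued `k`-form `ψ`, normalised as the
antisymmetrisation (mean over all permutations, with signs) of `J ⊗ ψ`; in index notation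
`(J ∧ ψ)_{abc…d} = J_{[ab} ψ_{c…d]}`. Written out, it is `wedge_apply`. -/
def wedge (J : T [⋀^Fin 2]→L[ℝ] ℝ) {k : ℕ} (ψ : T [⋀^Fin k]→L[ℝ] W) :
    T [⋀^Fin (k + 2)]→L[ℝ] W :=
  { (((k : ℝ) + 2) * ((k : ℝ) + 1))⁻¹ • AlternatingMap.alternatizeUncurryFin (wedgeAux J ψ) with
    cont := by
      refine Continuous.congr ?_ (fun v => (wedgeAux_apply J ψ v).symm)
      refine Continuous.const_smul (continuous_finsetSum _ fun i _ =>
        Continuous.zsmul (continuous_finsetSum _ fun j _ =>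
          Continuous.zsmul (Continuous.smul (J.cont.comp ?_) (ψ.cont.comp ?_)) _) _) _
      · refine continuous_pi fun l => ?_
        fin_cases l
        · exact continuous_apply i
        · exact continuous_apply _
      · exact continuous_pi fun l => continuous_apply _ }

theorem wedge_apply (J : T [⋀^Fin 2]→L[ℝ] ℝ) {k : ℕ} (ψ : T [⋀^Fin k]→L[ℝ] W)
    (v : Fin (k + 2) → T) :
    wedge J ψ v = (((k : ℝ) + 2) * ((k : ℝ) + 1))⁻¹ • ∑ i : Fin (k + 2), (-1 : ℤ) ^ (i : ℕ) •
      ∑ j : Fin (k + 1), (-1 : ℤ) ^ (j : ℕ) •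
        (J ![v i, i.removeNth v j] • ψ (j.removeNth (i.removeNth v))) :=
  wedgeAux_apply J ψ v

end Algebra

/-! ### Symplectic forms -/

section Symplectic

variable {d : ℕ} {M : Type u} [TopologicalSpace M] [ChartedSpace (EuclideanSpace ℝ (Fin d)) M]
  [IsManifold (𝓡 d) ∞ M]

/-- The vector field `X` is smooth on `U`. -/
def SmoothField (U : Set M) (X : ∀ x : M, TangentSpace (𝓡 d) x) : Prop :=
  ContMDiffOn (𝓡 d) ((𝓡 d).prod 𝓘(ℝ, EuclideanSpace ℝ (Fin d))) ∞
    (fun x => TotalSpace.mk' (EuclideanSpace ℝ (Fin d)) x (X x)) U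

variable (d M) in

/-- A symplectic form on a `d`-dimensional smooth manifold: a smooth, closed, non-degenerate
two-form. -/
structure SymplecticForm where
  /-- The two-form. -/
  form : ∀ x : M, TangentSpace (𝓡 d) x [⋀^Fin 2]→L[ℝ] (Bundle.Trivial M ℝ x)
  contMDiff : ContMDiff (𝓡 d)
    ((𝓡 d).prod 𝓘(ℝ, EuclideanSpace ℝ (Fin d) [⋀^Fin 2]→L[ℝ] ℝ)) ∞
    (fun x => TotalSpace.mk' (EuclideanSpace ℝ (Fin d) [⋀^Fin 2]→L[ℝ] ℝ)
      (E := fun x : M => TangentSpace (𝓡 d) x [⋀^Fin 2]→L[ℝ] (Bundle.Trivial M ℝ x))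
      x (form x))
  nondegenerate : ∀ (x : M) (a : TangentSpace (𝓡 d) x),
    (∀ b : TangentSpace (𝓡 d) x, form x ![a, b] = 0) → a = 0
  closed : ∀ X Y Z : (∀ x : M, TangentSpace (𝓡 d) x),
    SmoothField univ X → SmoothField univ Y → SmoothField univ Z → ∀ x : M,
      mvfderiv (𝓡 d) (fun y => (form y ![Y y, Z y] : ℝ)) x (X x)
        - mvfderiv (𝓡 d) (fun y => (form y ![X y, Z y] : ℝ)) x (Y x)
        + mvfderiv (𝓡 d) (fun y => (form y ![X y, Y y] : ℝ)) x (Z x)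
        - form x ![VectorField.mlieBracket (𝓡 d) X Y x, Z x]
        + form x ![VectorField.mlieBracket (𝓡 d) X Z x, Y x]
        - form x ![VectorField.mlieBracket (𝓡 d) Y Z x, X x] = 0

/-- The two-form at a point, as a real-valued alternating form. -/
def SymplecticForm.at (J : SymplecticForm d M) (x : M) : TangentSpace (𝓡 d) x [⋀^Fin 2]→L[ℝ] ℝ :=
  J.form x

end Symplectic

/-! ### Smooth families of vector spaces and locally constant sheaves

A bundle that is not given with a topology on its total space (a kernel or a cokernel) is described
by its fibres `W x` and by its smooth local sections: `S U s` says that the family `s` restricts to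
a smooth section over the open set `U`. -/

section Families

variable {d : ℕ} {M : Type u} [TopologicalSpace M] [ChartedSpace (EuclideanSpace ℝ (Fin d)) M]
  [IsManifold (𝓡 d) ∞ M]
variable {W : M → Type v} [∀ x, AddCommGroup (W x)] [∀ x, Module ℝ (W x)]

/-- Near each point there are finitely many elements `e_1, …, e_m` that form a basis of every
fibre, such that `∑ c_i e_i` is in the sheaf `S` exactly when all coefficient functions `c_i` are in
the sheaf of functions `R`. -/
def LocallyFree (R : Set M → (M → ℝ) → Prop) (S : Set M → (∀ x, W x) → Prop) : Prop :=
  ∀ x : M, ∃ U : Set M, IsOpen U ∧ x ∈ U ∧ ∃ (m : ℕ) (e : Fin m → ∀ y, W y),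
    (∀ y ∈ U, LinearIndependent ℝ (fun i => e i y) ∧
      Submodule.span ℝ (range fun i => e i y) = ⊤) ∧
    ∀ U' : Set M, IsOpen U' → U' ⊆ U → ∀ c : Fin m → M → ℝ,
      S U' (fun y => ∑ i, c i y • e i y) ↔ ∀ i, R U' (c i)

variable (d) in
/-- The fibres `W x` with the smooth sections `S` form a smooth vector bundle. -/
def IsSmoothBundle (S : Set M → (∀ x, W x) → Prop) : Prop :=
  LocallyFree (fun U c => ContMDiffOn (𝓡 d) 𝓘(ℝ, ℝ) ∞ c U) S

/-- The sheaf `P` is locally constant, with stalk `W x` at each point `x`. -/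
def IsLocallyConstantSheaf (P : Set M → (∀ x, W x) → Prop) : Prop :=
  LocallyFree (fun U c => ∀ y ∈ U, ∀ᶠ z in 𝓝 y, c z = c y) P

/-- `D` restricts to a flat connection on the bundle with fibres `W x` and smooth sections `S`;
`D s x a` is the derivative of the section `s` at `x` in the direction `a`. -/
structure IsFlatConnection (S : Set M → (∀ x, W x) → Prop)
    (D : (∀ x, W x) → ∀ x, TangentSpace (𝓡 d) x →ₗ[ℝ] W x) : Prop where
  congr : ∀ (U : Set M) (s t : ∀ x, W x), IsOpen U → S U s → S U t → (∀ x ∈ U, s x = t x) →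
    ∀ x ∈ U, D s x = D t x
  add : ∀ (U : Set M) (s t : ∀ x, W x), IsOpen U → S U s → S U t →
    ∀ x ∈ U, D (s + t) x = D s x + D t x
  leibniz : ∀ (U : Set M) (f : M → ℝ) (s : ∀ x, W x), IsOpen U → ContMDiffOn (𝓡 d) 𝓘(ℝ, ℝ) ∞ f U → S U s →
    ∀ x ∈ U, ∀ a : TangentSpace (𝓡 d) x,
      D (fun y => f y • s y) x a = f x • D s x a + mvfderiv (𝓡 d) f x a • s x
  smooth : ∀ (U : Set M) (X : ∀ x : M, TangentSpace (𝓡 d) x) (s : ∀ x, W x),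
    IsOpen U → SmoothField U X → S U s → S U (fun x => D s x (X x))
  flat : ∀ (U : Set M) (X Y : ∀ x : M, TangentSpace (𝓡 d) x) (s : ∀ x, W x),
    IsOpen U → SmoothField U X → SmoothField U Y → S U s → ∀ x ∈ U,
      D (fun y => D s y (Y y)) x (X x) - D (fun y => D s y (X y)) x (Y x)
        - D s x (VectorField.mlieBracket (𝓡 d) X Y x) = 0

/-- The sheaf of parallel sections. -/
def Parallel (S : Set M → (∀ x, W x) → Prop)
    (D : (∀ x, W x) → ∀ x, TangentSpace (𝓡 d) x →ₗ[ℝ] W x) (U : Set M) (s : ∀ x, W x) : Prop :=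
  S U s ∧ ∀ x ∈ U, D s x = 0

end Families

/-! ### Complexes of first-order differential operators -/

section Complexes

variable {d : ℕ} {M : Type u} [TopologicalSpace M] [ChartedSpace (EuclideanSpace ℝ (Fin d)) M]

variable (d) in
/-- `D` is a linear differential operator of order at most one from the bundle with fibres `A x`
and smooth sections `S` to the bundle with fibres `B x` and smooth sections `S'`. -/
structure IsFirstOrderOperator {A B : M → Type v} [∀ x, AddCommGroup (A x)] [∀ x, Module ℝ (A x)]
    [∀ x, AddCommGroup (B x)] [∀ x, Module ℝ (B x)] (S : Set M → (∀ x, A x) → Prop)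
    (S' : Set M → (∀ x, B x) → Prop) (D : (∀ x, A x) → ∀ x, B x) : Prop where
  smooth : ∀ (U : Set M) (s : ∀ x, A x), IsOpen U → S U s → S' U (D s)
  congr : ∀ (U : Set M) (s t : ∀ x, A x), IsOpen U → S U s → S U t → (∀ x ∈ U, s x = t x) →
    ∀ x ∈ U, D s x = D t x
  add : ∀ (U : Set M) (s t : ∀ x, A x), IsOpen U → S U s → S U t →
    ∀ x ∈ U, D (s + t) x = D s x + D t x
  smul : ∀ (U : Set M) (c : ℝ) (s : ∀ x, A x), IsOpen U → S U s →
    ∀ x ∈ U, D (c • s) x = c • D s x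
  order : ∀ (U : Set M) (f g : M → ℝ) (s : ∀ x, A x), IsOpen U →
    ContMDiffOn (𝓡 d) 𝓘(ℝ, ℝ) ∞ f U → ContMDiffOn (𝓡 d) 𝓘(ℝ, ℝ) ∞ g U → S U s → ∀ x ∈ U,
      D (fun y => (f y * g y) • s y) x - f x • D (fun y => g y • s y) x
        - g x • D (fun y => f y • s y) x + (f x * g x) • D s x = 0

/-- `σ` is the (first-order) principal symbol of `D` at the covector `ξ`: whenever `f` vanishes at
`x` and `df = ξ` there, `D (f s)` at `x` is `σ (s x)`. -/
def IsPrincipalSymbol {A B : M → Type v} [∀ x, AddCommGroup (A x)] [∀ x, Module ℝ (A x)]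
    [∀ x, AddCommGroup (B x)] [∀ x, Module ℝ (B x)] (S : Set M → (∀ x, A x) → Prop)
    (D : (∀ x, A x) → ∀ x, B x) (x : M) (ξ : TangentSpace (𝓡 d) x →L[ℝ] ℝ)
    (σ : A x →ₗ[ℝ] B x) : Prop :=
  ∀ (U : Set M) (f : M → ℝ) (s : ∀ y, A y), IsOpen U → x ∈ U →
    ContMDiffOn (𝓡 d) 𝓘(ℝ, ℝ) ∞ f U → f x = 0 → mvfderiv (𝓡 d) f x = ξ → S U s →
      D (fun y => f y • s y) x = σ (s x)

variable {A : ℕ → M → Type v} [∀ k x, AddCommGroup (A k x)] [∀ k x, Module ℝ (A k x)]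

variable (d) in
/-- The operators `D k` are first-order operators, consecutive ones compose to zero, and the
sequence of principal symbols at each non-zero covector,
`0 → A 0 → A 1 → A 2 → ⋯`, is exact. -/
structure IsEllipticComplex (S : ∀ k, Set M → (∀ x, A k x) → Prop)
    (D : ∀ k, (∀ x, A k x) → ∀ x, A (k + 1) x) : Prop where
  operator : ∀ k, IsFirstOrderOperator d (S k) (S (k + 1)) (D k)
  comp_eq_zero : ∀ (k : ℕ) (U : Set M) (s : ∀ x, A k x), IsOpen U → S k U s →
    ∀ x ∈ U, D (k + 1) (D k s) x = 0
  elliptic : ∀ (x : M) (ξ : TangentSpace (𝓡 d) x →L[ℝ] ℝ), ξ ≠ 0 →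
    ∃ σ : ∀ k, A k x →ₗ[ℝ] A (k + 1) x,
      (∀ k, IsPrincipalSymbol (S k) (D k) x ξ (σ k)) ∧
      Function.Injective (σ 0) ∧ ∀ k, Function.Exact (σ k) (σ (k + 1))

/-- `s` is closed over `U`. -/
def Closed (S : ∀ k, Set M → (∀ x, A k x) → Prop) (D : ∀ k, (∀ x, A k x) → ∀ x, A (k + 1) x)
    (k : ℕ) (U : Set M) (s : ∀ x, A k x) : Prop :=
  S k U s ∧ ∀ x ∈ U, D k s x = 0

/-- Near the point `x`, the section `s` of the bundle in degree `k + 1` is in the image of the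
operator `D k`. -/
def ExactNear (S : ∀ k, Set M → (∀ x, A k x) → Prop) (D : ∀ k, (∀ x, A k x) → ∀ x, A (k + 1) x)
    (k : ℕ) (x : M) (s : ∀ x, A (k + 1) x) : Prop :=
  ∃ (U : Set M) (t : ∀ x, A k x), IsOpen U ∧ x ∈ U ∧ S k U t ∧ ∀ y ∈ U, D k t y = s y

/-- Local exactness in degree `k + 1`. -/
def LocallyExact (S : ∀ k, Set M → (∀ x, A k x) → Prop)
    (D : ∀ k, (∀ x, A k x) → ∀ x, A (k + 1) x) (k : ℕ) : Prop :=
  ∀ (U : Set M) (s : ∀ x, A (k + 1) x), IsOpen U → Closed S D (k + 1) U s →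
    ∀ x ∈ U, ExactNear S D k x s

/-- The fibrewise linear map `T` identifies the sheaf `P` with the cohomology sheaf in degree `0`
(the sheaf of closed sections): it is injective, and a section is closed exactly when it is the
image of a section of `P`. -/
structure IdentifiesClosedSections (S : ∀ k, Set M → (∀ x, A k x) → Prop)
    (D : ∀ k, (∀ x, A k x) → ∀ x, A (k + 1) x) {W : M → Type v} [∀ x, AddCommGroup (W x)]
    [∀ x, Module ℝ (W x)] (P : Set M → (∀ x, W x) → Prop) (T : ∀ x, W x →ₗ[ℝ] A 0 x) : Prop where
  injective : ∀ x, Function.Injective (T x)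
  closed_iff : ∀ (U : Set M) (s : ∀ x, A 0 x), IsOpen U →
    (Closed S D 0 U s ↔ ∃ p : ∀ x, W x, P U p ∧ ∀ x ∈ U, s x = T x (p x))

/-- The fibrewise linear map `T` induces an isomorphism from the cohomology sheaf in degree
`k + 1` (the sheaf of closed sections modulo the sheaf of locally exact sections) to the sheaf `P`:
it maps closed sections to sections of `P`, a closed section is mapped to zero exactly when it is
locally exact, and every section of `P` is locally the image of a closed section. -/
structure InducesIsoOnCohomology (S : ∀ k, Set M → (∀ x, A k x) → Prop)
    (D : ∀ k, (∀ x, A k x) → ∀ x, A (k + 1) x) (k : ℕ) {W : M → Type v}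
    [∀ x, AddCommGroup (W x)] [∀ x, Module ℝ (W x)] (P : Set M → (∀ x, W x) → Prop)
    (T : ∀ x, A (k + 1) x →ₗ[ℝ] W x) : Prop where
  mapsTo : ∀ (U : Set M) (s : ∀ x, A (k + 1) x), IsOpen U → Closed S D (k + 1) U s →
    P U (fun x => T x (s x))
  eq_zero_iff : ∀ (U : Set M) (s : ∀ x, A (k + 1) x), IsOpen U → Closed S D (k + 1) U s →
    ((∀ x ∈ U, T x (s x) = 0) ↔ ∀ x ∈ U, ExactNear S D k x s)
  surjective : ∀ (U : Set M) (p : ∀ x, W x), IsOpen U → P U p → ∀ x ∈ U,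
    ∃ (U' : Set M) (s : ∀ x, A (k + 1) x), IsOpen U' ∧ x ∈ U' ∧ U' ⊆ U ∧
      Closed S D (k + 1) U' s ∧ ∀ y ∈ U', T y (s y) = p y

end Complexes

/-! ### The twisted complex of a symplectically flat connection -/

section Twisted

variable {d : ℕ} {M : Type u} [TopologicalSpace M] [ChartedSpace (EuclideanSpace ℝ (Fin d)) M]
  [IsManifold (𝓡 d) ∞ M]
  {F : Type w} [NormedAddCommGroup F] [NormedSpace ℝ F]
  {V : M → Type v} [TopologicalSpace (TotalSpace F V)]
  [∀ x, AddCommGroup (V x)] [∀ x, Module ℝ (V x)] [∀ x, TopologicalSpace (V x)]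
  [∀ x, IsTopologicalAddGroup (V x)] [∀ x, ContinuousSMul ℝ (V x)]
  [FiberBundle F V] [VectorBundle ℝ F V]

variable (F) in
/-- Smooth local sections of `V`. -/
def SmoothSection (U : Set M) (s : ∀ x, V x) : Prop :=
  ContMDiffOn (𝓡 d) ((𝓡 d).prod 𝓘(ℝ, F)) ∞ (fun x => TotalSpace.mk' F x (s x)) U

/-- The connection is symplectically flat with endomorphism `Θ`: its curvature is
`(∇_a ∇_b - ∇_b ∇_a) s = 2 J_{ab} Θ s`. -/
def HasSymplecticallyFlatCurvature (J : SymplecticForm d M) (cov : CovariantDerivative (𝓡 d) F V)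
    (Θ : ∀ x, V x →L[ℝ] V x) : Prop :=
  ∀ (X Y : ∀ x : M, TangentSpace (𝓡 d) x) (s : ∀ x, V x),
    SmoothField univ X → SmoothField univ Y → SmoothSection (d := d) F univ s → ∀ x : M,
      cov (fun y => cov s y (Y y)) x (X x) - cov (fun y => cov s y (X y)) x (Y x)
        - cov s x (VectorField.mlieBracket (𝓡 d) X Y x) =
      (2 * J.at x ![X x, Y x]) • Θ x (s x)

/-- The family of endomorphisms `Θ` is parallel: `∇(Θ s) = Θ ∇s` for all smooth local sections. -/
def IsParallelEndomorphism (cov : CovariantDerivative (𝓡 d) F V) (Θ : ∀ x, V x →L[ℝ] V x) : Prop :=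
  ∀ (U : Set M) (s : ∀ x, V x), IsOpen U → SmoothSection (d := d) F U s →
    ∀ x ∈ U, cov (fun y => Θ y (s y)) x = (Θ x).comp (cov s x)

variable (F) in
/-- Smooth local `V`-valued `k`-forms. -/
def SmoothForm (k : ℕ) (U : Set M) (φ : ∀ x : M, TangentSpace (𝓡 d) x [⋀^Fin k]→L[ℝ] V x) : Prop :=
  ContMDiffOn (𝓡 d) ((𝓡 d).prod 𝓘(ℝ, EuclideanSpace ℝ (Fin d) [⋀^Fin k]→L[ℝ] F)) ∞
    (fun x => TotalSpace.mk' (EuclideanSpace ℝ (Fin d) [⋀^Fin k]→L[ℝ] F)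
      (E := fun x : M => TangentSpace (𝓡 d) x [⋀^Fin k]→L[ℝ] V x) x (φ x)) U

/-- `η` is the value at `x` of the coupled exterior derivative of the `V`-valued `k`-form `φ`,
normalised as the antisymmetrisation `∇_{[a} φ_{b…c]}`: for all vector fields `X_0, …, X_k` whose
brackets vanish at `x`,
`(k + 1) η(X_0, …, X_k) = ∑ i, (-1)^i ∇_{X_i} (φ(X_0, …, X̂_i, …, X_k))`.
All tangent vectors at `x` extend to such vector fields, so that `η` is unique; the bracket terms of
the formula for general vector fields vanish for these. -/
def IsExtCovDerivAt (cov : CovariantDerivative (𝓡 d) F V) {k : ℕ}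
    (φ : ∀ x : M, TangentSpace (𝓡 d) x [⋀^Fin k]→L[ℝ] V x) (x : M)
    (η : TangentSpace (𝓡 d) x [⋀^Fin (k + 1)]→L[ℝ] V x) : Prop :=
  ∀ X : Fin (k + 1) → ∀ y : M, TangentSpace (𝓡 d) y,
    (∀ i, ∃ U ∈ 𝓝 x, SmoothField U (X i)) →
    (∀ i j, VectorField.mlieBracket (𝓡 d) (X i) (X j) x = 0) →
    ((k : ℝ) + 1) • η (fun i => X i x) =
      ∑ i : Fin (k + 1), (-1 : ℤ) ^ (i : ℕ) •
        cov (fun y => φ y (fun j => X (i.succAbove j) y)) x (X i x)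

open scoped Classical in
/-- The coupled exterior derivative `∇ : Λ^k ⊗ V → Λ^{k+1} ⊗ V` (with a default value where `φ` is
not differentiable). -/
def extCovDeriv (cov : CovariantDerivative (𝓡 d) F V) {k : ℕ}
    (φ : ∀ x : M, TangentSpace (𝓡 d) x [⋀^Fin k]→L[ℝ] V x) (x : M) :
    TangentSpace (𝓡 d) x [⋀^Fin (k + 1)]→L[ℝ] V x :=
  if h : ∃ η, IsExtCovDerivAt cov φ x η then h.choose else 0

variable (d V) in
/-- The bundles of the complex: `V` in degree `0`, and `Λ^k ⊗ V ⊕ Λ^{k-1} ⊗ V` in degree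
`k ≥ 1`. -/
def Term : ℕ → M → Type v
  | 0, x => V x
  | k + 1, x => (TangentSpace (𝓡 d) x [⋀^Fin (k + 1)]→L[ℝ] V x) ×
      (TangentSpace (𝓡 d) x [⋀^Fin k]→L[ℝ] V x)

instance instAddCommGroupTerm : ∀ (k : ℕ) (x : M), AddCommGroup (Term d V k x)
  | 0, x => inferInstanceAs (AddCommGroup (V x))
  | k + 1, x => inferInstanceAs (AddCommGroup ((TangentSpace (𝓡 d) x [⋀^Fin (k + 1)]→L[ℝ] V x) ×
      (TangentSpace (𝓡 d) x [⋀^Fin k]→L[ℝ] V x)))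

instance instModuleTerm : ∀ (k : ℕ) (x : M), Module ℝ (Term d V k x)
  | 0, x => inferInstanceAs (Module ℝ (V x))
  | k + 1, x => inferInstanceAs (Module ℝ ((TangentSpace (𝓡 d) x [⋀^Fin (k + 1)]→L[ℝ] V x) ×
      (TangentSpace (𝓡 d) x [⋀^Fin k]→L[ℝ] V x)))

variable (d F V) in
/-- Smooth local sections of the bundles of the complex. -/
def SmoothTerm : ∀ k : ℕ, Set M → (∀ x : M, Term d V k x) → Prop
  | 0, U, s => SmoothSection (d := d) F (V := V) U s
  | k + 1, U, s => SmoothForm F (k + 1) U (fun x => (s x).1) ∧ SmoothForm F k U (fun x => (s x).2)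

/-- The operators of the complex: `Σ ↦ (∇Σ, ΘΣ)` in degree `0` and
`(φ, η) ↦ (∇φ + (-1)^k J ∧ η, ∇η + (-1)^k Θφ)` in degree `k ≥ 1`. -/
def twistedD (J : SymplecticForm d M) (cov : CovariantDerivative (𝓡 d) F V)
    (Θ : ∀ x, V x →L[ℝ] V x) :
    ∀ k : ℕ, (∀ x : M, Term d V k x) → ∀ x : M, Term d V (k + 1) x
  | 0, s => fun x =>
      (ContinuousAlternatingMap.ofSubsingleton ℝ (TangentSpace (𝓡 d) x) (V x) (0 : Fin 1)
        (cov s x),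
       ContinuousAlternatingMap.constOfIsEmpty ℝ (TangentSpace (𝓡 d) x) (Fin 0) (Θ x (s x)))
  | k + 1, s => fun x =>
      (extCovDeriv cov (fun y => (s y).1) x + (-1 : ℝ) ^ (k + 1) • wedge (J.at x) (s x).2,
       extCovDeriv cov (fun y => (s y).2) x +
        (-1 : ℝ) ^ (k + 1) • (Θ x).compContinuousAlternatingMap (s x).1)

/-- The fibres of the kernel of `Θ`. -/
abbrev Ker (Θ : ∀ x, V x →L[ℝ] V x) (x : M) : Type v := (Θ x : V x →ₗ[ℝ] V x).ker

/-- The fibres of the cokernel of `Θ`. -/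
abbrev Coker (Θ : ∀ x, V x →L[ℝ] V x) (x : M) : Type v := V x ⧸ (Θ x : V x →ₗ[ℝ] V x).range

variable (d F) in
/-- Smooth sections of the kernel: smooth sections of `V` with values in the kernel. -/
def SmoothKer (Θ : ∀ x, V x →L[ℝ] V x) (U : Set M) (s : ∀ x, Ker Θ x) : Prop :=
  SmoothSection (d := d) F U (fun x => (s x : V x))

variable (d F) in
/-- Smooth sections of the cokernel: locally the classes of smooth sections of `V`. -/
def SmoothCoker (Θ : ∀ x, V x →L[ℝ] V x) (U : Set M) (p : ∀ x, Coker Θ x) : Prop :=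
  ∀ x ∈ U, ∃ (U' : Set M) (s : ∀ y, V y), IsOpen U' ∧ x ∈ U' ∧ U' ⊆ U ∧
    SmoothSection (d := d) F U' s ∧ ∀ y ∈ U', p y = Submodule.Quotient.mk (s y)

/-- The inclusion of the kernel of `Θ` into `V`. -/
def fromKer (Θ : ∀ x, V x →L[ℝ] V x) (x : M) : Ker Θ x →ₗ[ℝ] Term d V 0 x where
  toFun s := (s : V x)
  map_add' _ _ := rfl
  map_smul' _ _ := rfl

/-- The map `(φ, η) ↦ [η]` from `Λ^1 ⊗ V ⊕ V` to the cokernel of `Θ`. -/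
def toCoker (Θ : ∀ x, V x →L[ℝ] V x) (x : M) : Term d V 1 x →ₗ[ℝ] Coker Θ x where
  toFun s := Submodule.Quotient.mk (s.2 ![])
  map_add' _ _ := rfl
  map_smul' _ _ := rfl

end Twisted

end SymplecticallyFlat

end

open SymplecticallyFlat

/-! Locally the complex is gauge equivalent to one with constant coefficients. Differentiating the
equation R = 2JΘ and using dJ = 0, the Bianchi identity gives J ∧ ∇Θ = 0. In dimension at least four
the product with J is injective on one-forms, so ∇Θ = 0 (`bianchi`,
`eq_zero_of_cyclic_sum_eq_zero`); for n = 1 this is assumed and for n = 0 it is empty. Near a point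
choose a one-form α with ∂_a α_b − ∂_b α_a = 2J_{ab}. Then ∇ − αΘ is flat: its curvature is 2JΘ − dα
Θ plus terms in ∇Θ and α ∧ α, which vanish. In a parallel frame of this flat connection Θ becomes a
constant endomorphism T and ∇ becomes d + αT (`exists_gauge`, `exists_normalFrame`).

In such a normal frame the unipotent change (φ, η) ↦ (φ ± α ∧ η/(k+1), η) absorbs α and turns the
twisted operators into those of the mapping cone of T acting on the F-valued de Rham complex
(`modelD_shear`, `NormalFrame.termAt_twistedD`). Everything is then read off from the cone. D² = 0
because d² = 0 and T is constant. The principal symbol is a direct sum of two Koszul complexes,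
hence exact. By the Poincaré lemma the only local cohomology is ker T in degree 0 and coker T in
degree 1 (`modelD_exact`, `modelD_one_eq_zero`).

On the kernel and on the cokernel of Θ the term αT disappears, so the induced connections are plain
differentiation of components; `FlatChart` collects the consequences of this (smooth bundle, flat
connection, locally constant sheaf of parallel sections).

The analytic input consists of the Poincaré lemma (`exists_extDeriv_eq`) and of the existence of
parallel frames of flat connections (`exists_parallel_frame`), the latter by a Picard iteration
along rays. -/

set_option linter.unusedSectionVars false

noncomputable section

namespace SymplecticallyFlat

/-! ### Integrals depending smoothly on a parameter -/

section Parametric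

open MeasureTheory Filter

theorem fderiv_partial_eq_comp_inl {E G : Type*} [NormedAddCommGroup E] [NormedSpace ℝ E]
    [NormedAddCommGroup G] [NormedSpace ℝ G] {f : E → ℝ → G}
    (hf : Differentiable ℝ (Function.uncurry f)) :
    (fun p : E × ℝ => fderiv ℝ (fun y => f y p.2) p.1) =
      fun p => (fderiv ℝ (Function.uncurry f) p).comp (ContinuousLinearMap.inl ℝ E ℝ) := by
  funext p
  exact (HasFDerivAt.comp (f := fun e => (e, p.2)) p.1 (hf (p.1, p.2)).hasFDerivAt
    (hasFDerivAt_prodMk_left p.1 p.2)).fderiv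

/-- The partial derivative is jointly continuous, hence bounded on the product of a closed ball with
[0, 1], which is compact because `E` is finite-dimensional. This constant is the dominating
function. -/
theorem hasFDerivAt_intervalIntegral_of_contDiff {E G : Type*} [NormedAddCommGroup E]
    [NormedSpace ℝ E] [FiniteDimensional ℝ E] [NormedAddCommGroup G] [NormedSpace ℝ G]
    {f : E → ℝ → G} (hf : ContDiff ℝ 1 (Function.uncurry f)) (x : E) :
    HasFDerivAt (fun x => ∫ t in (0 : ℝ)..1, f x t)
      (∫ t in (0 : ℝ)..1, fderiv ℝ (fun y => f y t) x) x := by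
  have hd : ∀ y t, HasFDerivAt (fun y => f y t) (fderiv ℝ (fun y => f y t) y) y := fun y t =>
    ((hf.differentiable one_ne_zero).comp
      (differentiable_id.prodMk (differentiable_const t)) y).hasFDerivAt
  have hc : Continuous (fun p : E × ℝ => fderiv ℝ (fun y => f y p.2) p.1) := by
    have := hf.fderiv_right (m := 0) (by simp)
    rw [fderiv_partial_eq_comp_inl (hf.differentiable one_ne_zero)]
    exact this.continuous.clm_comp continuous_const
  obtain ⟨C, hC⟩ := (((isCompact_closedBall x 1).prod (isCompact_Icc (a := (0 : ℝ)) (b := 1))).image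
    hc).isBounded.exists_norm_le
  have hcx : ∀ y, Continuous (f y) := fun y => hf.continuous.comp (Continuous.prodMk_right y)
  refine intervalIntegral.hasFDerivAt_integral_of_dominated_of_fderiv_le
    (F' := fun y t => fderiv ℝ (fun y => f y t) y) (bound := fun _ => C)
    (Metric.closedBall_mem_nhds x one_pos)
    (Eventually.of_forall fun y => (hcx y).aestronglyMeasurable)
    ((hcx x).intervalIntegrable _ _)
    (hc.comp (Continuous.prodMk_right x)).aestronglyMeasurable
    (Eventually.of_forall fun t ht y hy => hC _ ⟨(y, t), ⟨hy, ?_⟩, rfl⟩)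
    intervalIntegrable_const
    (Eventually.of_forall fun t _ y _ => hd y t)
  rw [uIoc_of_le zero_le_one] at ht
  exact Ioc_subset_Icc_self ht

/-- Induction on the order of differentiability: the derivative of the integral is an integral of
the same kind with values in `E →L[ℝ] G`, so `G` has to vary. Taking `E` in `Type` keeps `E →L[ℝ] G`
in the universe of `G`. -/
theorem contDiff_intervalIntegral {E : Type} {G : Type*} [NormedAddCommGroup E]
    [NormedSpace ℝ E] [FiniteDimensional ℝ E] [NormedAddCommGroup G] [NormedSpace ℝ G]
    {f : E → ℝ → G} (hf : ContDiff ℝ ∞ (Function.uncurry f)) :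
    ContDiff ℝ ∞ (fun x => ∫ t in (0 : ℝ)..1, f x t) := by
  rw [contDiff_infty]
  intro n
  induction n generalizing G with
  | zero =>
    have h := fun x => (hasFDerivAt_intervalIntegral_of_contDiff (hf.of_le (by simp)) x).continuousAt
    exact contDiff_zero.2 (continuous_iff_continuousAt.2 h)
  | succ n ih =>
    have h := hasFDerivAt_intervalIntegral_of_contDiff (f := f) (hf.of_le (by simp))
    push_cast
    rw [contDiff_succ_iff_fderiv]
    refine ⟨fun x => (h x).differentiableAt, by simp, ?_⟩
    have h2 : fderiv ℝ (fun x => ∫ t in (0 : ℝ)..1, f x t) =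
        fun x => ∫ t in (0 : ℝ)..1, fderiv ℝ (fun y => f y t) x := funext fun x => (h x).fderiv
    rw [h2]
    refine ih (f := fun x t => fderiv ℝ (fun y => f y t) x) ?_
    have := hf.fderiv_right (m := ∞) (by simp)
    change ContDiff ℝ ∞ (fun p : E × ℝ => fderiv ℝ (fun y => f y p.2) p.1)
    rw [fderiv_partial_eq_comp_inl (hf.differentiable (by simp))]
    exact this.clm_comp contDiff_const

end Parametric

/-! ### Germs of smooth maps -/

section Germs

open Filter

variable {E G : Type*} [NormedAddCommGroup E] [NormedSpace ℝ E] [FiniteDimensional ℝ E]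
  [NormedAddCommGroup G] [NormedSpace ℝ G]

/-- Multiplication by a bump function. It lets the integrals over segments below be formed on all of
`E`, without keeping track of domains. -/
theorem exists_contDiff_eventuallyEq {f : E → G} {z : E} (hf : ∀ᶠ y in 𝓝 z, ContDiffAt ℝ ∞ f y) :
    ∃ g : E → G, ContDiff ℝ ∞ g ∧ g =ᶠ[𝓝 z] f := by
  obtain ⟨r, hr, h⟩ := Metric.eventually_nhds_iff_ball.1 hf
  let χ : ContDiffBump z := ⟨r / 3, r / 2, by positivity, by linarith⟩
  refine ⟨fun y => χ y • f y, contDiff_iff_contDiffAt.2 fun y => ?_, ?_⟩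
  · by_cases hy : y ∈ Metric.ball z r
    · exact χ.contDiffAt.smul (h y hy)
    · refine (contDiffAt_const (c := (0 : G))).congr_of_eventuallyEq ?_
      have : (Metric.closedBall z (r / 2))ᶜ ∈ 𝓝 y := by
        refine Metric.isClosed_closedBall.isOpen_compl.mem_nhds ?_
        simp only [Metric.mem_ball, not_lt, mem_compl_iff, Metric.mem_closedBall, not_le] at hy ⊢
        linarith
      filter_upwards [this] with w hw
      rw [χ.zero_of_le_dist (not_le.1 fun h' => hw (Metric.mem_closedBall.2 h')).le, zero_smul]
  · filter_upwards [χ.eventuallyEq_one] with y hy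
    simp [hy]

end Germs

/-! ### The Poincaré lemma -/

section Poincare

open Filter ContinuousAlternatingMap

variable {E : Type} {G : Type*} [NormedAddCommGroup E] [NormedSpace ℝ E]
  [NormedAddCommGroup G] [NormedSpace ℝ G]

/-- Insertion of a vector into an alternatisation. -/
theorem curryLeft_alternatizeUncurryFin {k : ℕ} (B : E →L[ℝ] E [⋀^Fin (k + 1)]→L[ℝ] G) (v : E) :
    (alternatizeUncurryFin B).curryLeft v =
      B v - alternatizeUncurryFin
        (((ContinuousLinearMap.apply ℝ (E [⋀^Fin k]→L[ℝ] G) v).comp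
          (curryLeftLI (𝕜 := ℝ) (E := E) (F := G) (n := k)).toContinuousLinearMap).comp B) := by
  ext w
  -- Removing the first slot gives `B v`. Removing a later slot keeps `v` in front and carries one
  -- more sign, which produces the subtracted term. This is the algebraic form of Cartan's formula.
  have h : ∀ j : Fin (k + 1), j.succ.removeNth (Matrix.vecCons v w) =
      Matrix.vecCons v (j.removeNth w) := fun j => by
    funext i
    refine Fin.cases ?_ (fun i => ?_) i
    · simp [Fin.removeNth]
    · simp [Fin.removeNth]
  rw [curryLeft_apply_apply, alternatizeUncurryFin_apply, ContinuousAlternatingMap.sub_apply,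
    alternatizeUncurryFin_apply, Fin.sum_univ_succ, sub_eq_add_neg, ← Finset.sum_neg_distrib]
  congr 1
  · simp [Fin.removeNth_zero, Matrix.vecCons]
  · refine Finset.sum_congr rfl fun j _ => ?_
    rw [h]
    simp [pow_succ]

/-- The integrand of the homotopy operator of the Poincaré lemma. -/
def homotopyIntegrand {X Y : Type*} [NormedAddCommGroup X] [NormedSpace ℝ X]
    [NormedAddCommGroup Y] [NormedSpace ℝ Y] (C : X →L[ℝ] E →L[ℝ] Y) (k : ℕ) (φ : E → X) (z : E)
    (x : E) (t : ℝ) : Y :=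
  t ^ k • C (φ (z + t • (x - z))) (x - z)

section homotopyIntegrand

variable {X Y : Type*} [NormedAddCommGroup X] [NormedSpace ℝ X]
    [NormedAddCommGroup Y] [NormedSpace ℝ Y] (C : X →L[ℝ] E →L[ℝ] Y) (k : ℕ) {φ : E → X}
    (hφ : ContDiff ℝ ∞ φ) (z : E)
include hφ

theorem contDiff_homotopyIntegrand :
    ContDiff ℝ ∞ (Function.uncurry (homotopyIntegrand C k φ z)) := by
  have hp : ContDiff ℝ ∞ (fun p : E × ℝ => z + p.2 • (p.1 - z)) := by fun_prop
  have h1 : ContDiff ℝ ∞ (fun p : E × ℝ => C (φ (z + p.2 • (p.1 - z)))) :=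
    C.contDiff.comp (hφ.comp hp)
  have h2 : ContDiff ℝ ∞ (fun p : E × ℝ => C (φ (z + p.2 • (p.1 - z))) (p.1 - z)) :=
    h1.clm_apply (by fun_prop)
  have h3 : ContDiff ℝ ∞ (fun p : E × ℝ => p.2 ^ k) := by fun_prop
  exact h3.smul h2

theorem fderiv_homotopyIntegrand (x : E) (t : ℝ) :
    fderiv ℝ (fun y => homotopyIntegrand C k φ z y t) x = t ^ k •
      (t • ((ContinuousLinearMap.apply ℝ Y (x - z)).comp C).comp
        (fderiv ℝ φ (z + t • (x - z))) + C (φ (z + t • (x - z)))) := by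
  have h1 : HasFDerivAt (fun y : E => z + t • (y - z)) (t • ContinuousLinearMap.id ℝ E) x :=
    (((hasFDerivAt_id x).sub_const z).const_smul t).const_add z
  have h2 := (hφ.differentiable (by simp) (z + t • (x - z))).hasFDerivAt.comp x h1
  have h3 := (C.hasFDerivAt.comp x h2).clm_apply ((hasFDerivAt_id x).sub_const z)
  refine (h3.const_smul (t ^ k)).fderiv.trans ?_
  ext a
  simp only [_root_.smul_apply, _root_.add_apply,
    ContinuousLinearMap.comp_apply, ContinuousLinearMap.flip_apply,
    ContinuousLinearMap.apply_apply, ContinuousLinearMap.id_apply, map_smul, Function.comp_apply, id]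
  rw [add_comm]

theorem continuous_fderiv_homotopyIntegrand (x : E) :
    Continuous fun t => fderiv ℝ (fun y => homotopyIntegrand C k φ z y t) x := by
  simp only [fderiv_homotopyIntegrand C k hφ]
  have h0 : Continuous fun t : ℝ => z + t • (x - z) := by fun_prop
  have h1 := (hφ.continuous_fderiv (by simp)).comp h0
  have h2 := hφ.continuous.comp h0
  exact (continuous_pow k).smul ((continuous_id.smul (continuous_const.clm_comp h1)).add
    (C.continuous.comp h2))

/-- A linear operation `L` on the derivative of the homotopy integral passes under the integral
sign, and it remains to recognise the integrand as a total derivative in t. In the Poincaré lemma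
`L` is the alternatisation. -/
theorem map_fderiv_integral_homotopyIntegrand [FiniteDimensional ℝ E] {Y' : Type*}
    [NormedAddCommGroup Y'] [NormedSpace ℝ Y'] [CompleteSpace Y'] [CompleteSpace Y]
    (L : (E →L[ℝ] Y) →L[ℝ] Y') (x : E) (u : ℝ → Y')
    (hu : ∀ t ∈ Icc (0 : ℝ) 1, HasDerivAt u
      (L (fderiv ℝ (fun y => homotopyIntegrand C k φ z y t) x)) t) :
    L (fderiv ℝ (fun y => ∫ t in (0 : ℝ)..1, homotopyIntegrand C k φ z y t) x) = u 1 - u 0 := by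
  have hcont := continuous_fderiv_homotopyIntegrand C k hφ z x
  rw [(hasFDerivAt_intervalIntegral_of_contDiff
      ((contDiff_homotopyIntegrand C k hφ z).of_le (by simp)) x).fderiv,
    ← L.intervalIntegral_comp_comm (hcont.intervalIntegrable _ _)]
  refine intervalIntegral.integral_eq_sub_of_hasDerivAt (fun t ht => hu t ?_)
    ((L.continuous.comp hcont).intervalIntegrable _ _)
  rwa [uIcc_of_le zero_le_one] at ht

end homotopyIntegrand

variable [FiniteDimensional ℝ E] [CompleteSpace G]

/-- The primitive is the cone integral ∫₀¹ t^k ι_{x−z} φ(z + t(x−z)) dt. By Cartan's formula and dφ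
= 0, the exterior derivative of its integrand is the t-derivative of t^{k+1} φ(z + t(x−z)), which
integrates to φ(x). -/
theorem exists_extDeriv_eq {k : ℕ} {φ : E → E [⋀^Fin (k + 1)]→L[ℝ] G} {z : E}
    (hφ : ∀ᶠ y in 𝓝 z, ContDiffAt ℝ ∞ φ y) (hd : ∀ᶠ y in 𝓝 z, extDeriv φ y = 0) :
    ∃ β : E → E [⋀^Fin k]→L[ℝ] G, ContDiff ℝ ∞ β ∧ ∀ᶠ y in 𝓝 z, extDeriv β y = φ y := by
  -- The new representative is smooth everywhere; closedness stays local, on a ball that contains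
  -- the segments from its centre.
  obtain ⟨φ', hs, hφ'⟩ := exists_contDiff_eventuallyEq hφ
  have hd' : ∀ᶠ y in 𝓝 z, extDeriv φ' y = 0 := by
    filter_upwards [hφ'.eventuallyEq_nhds, hd] with y hy h
    rw [hy.extDeriv_eq, h]
  suffices H : ∃ β : E → E [⋀^Fin k]→L[ℝ] G, ContDiff ℝ ∞ β ∧
      ∀ᶠ y in 𝓝 z, extDeriv β y = φ' y by
    obtain ⟨β, hβ, h⟩ := H
    exact ⟨β, hβ, by filter_upwards [h, hφ'] with y h1 h2 using h1.trans h2⟩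
  clear hφ hd hφ'
  obtain ⟨r, hr, hball⟩ := Metric.eventually_nhds_iff_ball.1 hd'
  set C : (E [⋀^Fin (k + 1)]→L[ℝ] G) →L[ℝ] (E →L[ℝ] E [⋀^Fin k]→L[ℝ] G) :=
    (curryLeftLI (𝕜 := ℝ) (E := E) (F := G) (n := k)).toContinuousLinearMap with hC
  have hf := contDiff_homotopyIntegrand C k hs z
  refine ⟨fun x => ∫ t in (0 : ℝ)..1, homotopyIntegrand C k φ' z x t,
    contDiff_intervalIntegral hf, ?_⟩
  filter_upwards [Metric.ball_mem_nhds z hr] with x hx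
  have hdφ := hs.differentiable (by simp)
  refine (map_fderiv_integral_homotopyIntegrand C k hs z (alternatizeUncurryFinCLM ℝ E G) x
    (fun t : ℝ => t ^ (k + 1) • φ' (z + t • (x - z))) fun t ht => ?_).trans (by simp)
  have hmem : z + t • (x - z) ∈ Metric.ball z r := by
    rw [Metric.mem_ball, dist_eq_norm] at hx ⊢
    rw [add_sub_cancel_left, norm_smul, Real.norm_eq_abs, abs_of_nonneg ht.1]
    exact (mul_le_of_le_one_left (norm_nonneg _) ht.2).trans_lt hx
  have h1 := curryLeft_alternatizeUncurryFin (fderiv ℝ φ' (z + t • (x - z))) (x - z)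
  have h2 : alternatizeUncurryFin (fderiv ℝ φ' (z + t • (x - z))) = 0 := hball _ hmem
  rw [h2] at h1
  -- Closedness enters here: Cartan's formula reduces to the statement that alternating ι_{x−z} Dφ
  -- gives the derivative of φ along x − z.
  have h3 : alternatizeUncurryFin
      (((ContinuousLinearMap.apply ℝ (E [⋀^Fin k]→L[ℝ] G) (x - z)).comp C).comp
      (fderiv ℝ φ' (z + t • (x - z)))) = fderiv ℝ φ' (z + t • (x - z)) (x - z) :=
    (sub_eq_zero.1 (h1.symm.trans (by ext; simp))).symm
  rw [fderiv_homotopyIntegrand C k hs, alternatizeUncurryFinCLM_apply, alternatizeUncurryFin_smul,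
    alternatizeUncurryFin_add, alternatizeUncurryFin_smul, h3]
  have h4 : alternatizeUncurryFin (C (φ' (z + t • (x - z)))) =
    (k + 1) • φ' (z + t • (x - z)) := alternatizeUncurryFin_curryLeft _
  rw [h4]
  have h5 : HasDerivAt (fun t : ℝ => z + t • (x - z)) (x - z) t := by
    simpa using ((hasDerivAt_id t).smul_const (x - z)).const_add z
  have h6 := (hasDerivAt_pow (k + 1) t).smul ((hdφ (z + t • (x - z))).hasFDerivAt.comp_hasDerivAt t h5)
  refine HasDerivAt.congr_deriv h6 ?_
  simp only [Nat.add_sub_cancel, smul_add, smul_smul, ← Nat.cast_smul_eq_nsmul ℝ, pow_succ,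
    Function.comp_apply, mul_comm (t ^ k) ((k + 1 : ℕ) : ℝ)]

end Poincare

/-! ### Parallel frames of flat connections -/

section Flat

open Filter

variable {E : Type} {R : Type*} [NormedAddCommGroup E] [NormedSpace ℝ E]
  [NormedRing R] [NormedAlgebra ℝ R]

/-- The one-form `a ↦ A(a) g`. -/
def mulForm (A : E → E →L[ℝ] R) (g : E → R) (x : E) : E →L[ℝ] R :=
  ((ContinuousLinearMap.mul ℝ R).flip (g x)).comp (A x)

@[simp]
theorem mulForm_apply (A : E → E →L[ℝ] R) (g : E → R) (x a : E) :
    mulForm A g x a = A x a * g x := rfl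

theorem contDiffOn_mulForm {A : E → E →L[ℝ] R} {g : E → R} {n : ℕ∞ω} {s : Set E}
    (hA : ContDiffOn ℝ n A s) (hg : ContDiffOn ℝ n g s) : ContDiffOn ℝ n (mulForm A g) s :=
  ((ContinuousLinearMap.mul ℝ R).flip.contDiff.comp_contDiffOn hg).clm_comp hA

theorem contDiff_mulForm {A : E → E →L[ℝ] R} {g : E → R} (hA : ContDiff ℝ ∞ A)
    (hg : ContDiff ℝ ∞ g) : ContDiff ℝ ∞ (mulForm A g) :=
  ((ContinuousLinearMap.mul ℝ R).flip.contDiff.comp hg).clm_comp hA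

theorem fderiv_mulForm {A : E → E →L[ℝ] R} {g : E → R} {x : E} (hA : DifferentiableAt ℝ A x)
    (hg : DifferentiableAt ℝ g x) (a v : E) :
    fderiv ℝ (mulForm A g) x a v = fderiv ℝ A x a v * g x + A x v * fderiv ℝ g x a := by
  have h := ((ContinuousLinearMap.mul ℝ R).flip.hasFDerivAt.comp x hg.hasFDerivAt).clm_comp
    hA.hasFDerivAt
  rw [show fderiv ℝ (mulForm A g) x = _ from h.fderiv]
  simp [add_comm]

variable [FiniteDimensional ℝ E]

/-- The homotopy operator of the Poincaré lemma on one-forms inverts the derivative up to the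
exterior derivative. -/
theorem norm_fderiv_homotopy_sub_le {G : Type*} [NormedAddCommGroup G] [NormedSpace ℝ G]
    [CompleteSpace G] {φ : E → E →L[ℝ] G} (hφ : ContDiff ℝ ∞ φ) (z x a : E) {K : ℝ}
    (hK : ∀ t ∈ Icc (0 : ℝ) 1, ‖fderiv ℝ φ (z + t • (x - z)) a (x - z) -
      fderiv ℝ φ (z + t • (x - z)) (x - z) a‖ ≤ K) :
    ‖fderiv ℝ (fun y => ∫ t in (0 : ℝ)..1,
      homotopyIntegrand (ContinuousLinearMap.id ℝ (E →L[ℝ] G)) 0 φ z y t) x a - φ x a‖ ≤ K := by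
  set C := ContinuousLinearMap.id ℝ (E →L[ℝ] G)
  have hcont := continuous_fderiv_homotopyIntegrand C 0 hφ z x
  rw [(hasFDerivAt_intervalIntegral_of_contDiff
      ((contDiff_homotopyIntegrand C 0 hφ z).of_le (by simp)) x).fderiv,
    ContinuousLinearMap.intervalIntegral_apply (hcont.intervalIntegrable _ _)]
  have h5 : ∀ t : ℝ, HasDerivAt (fun t : ℝ => z + t • (x - z)) (x - z) t := fun t => by
    simpa using ((hasDerivAt_id t).smul_const (x - z)).const_add z
  -- The function t φ(z + t(x−z)) a vanishes at t = 0 and equals `φ x a` at t = 1, so `φ x a` is the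
  -- integral of its derivative and can be compared with the homotopy integral under one integral
  -- sign.
  have hu : ∀ t ∈ uIcc (0 : ℝ) 1, HasDerivAt (fun t : ℝ => t • φ (z + t • (x - z)) a)
      (t • fderiv ℝ φ (z + t • (x - z)) (x - z) a + φ (z + t • (x - z)) a) t := fun t _ => by
    have h6 := (hφ.differentiable (by simp) (z + t • (x - z))).hasFDerivAt.comp_hasDerivAt t (h5 t)
    have h7 := h6.clm_apply (hasDerivAt_const t a)
    have h8 := (hasDerivAt_id t).smul h7
    refine HasDerivAt.congr_deriv h8 ?_
    simp
  have h0 : Continuous fun t : ℝ => z + t • (x - z) := by fun_prop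
  have hc : Continuous fun t : ℝ =>
      t • fderiv ℝ φ (z + t • (x - z)) (x - z) a + φ (z + t • (x - z)) a := by
    have h1 := (hφ.continuous_fderiv (by simp)).comp h0
    have h2 := hφ.continuous.comp h0
    exact (continuous_id.smul ((h1.clm_apply continuous_const).clm_apply continuous_const)).add
      (h2.clm_apply continuous_const)
  have hi := intervalIntegral.integral_eq_sub_of_hasDerivAt hu (hc.intervalIntegrable _ _)
  have h1 : φ x a = (1 : ℝ) • φ (z + (1 : ℝ) • (x - z)) a -
      (0 : ℝ) • φ (z + (0 : ℝ) • (x - z)) a := by simp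
  rw [h1, ← hi, ← intervalIntegral.integral_sub
    ((hcont.clm_apply continuous_const).intervalIntegrable _ _) (hc.intervalIntegrable _ _)]
  refine (intervalIntegral.norm_integral_le_of_norm_le_const (C := K) fun t ht => ?_).trans
    (by simp)
  rw [uIoc_of_le zero_le_one] at ht
  rw [fderiv_homotopyIntegrand C 0 hφ]
  -- The two integrands differ by t times the exterior derivative of φ on the pair (a, x − z).
  have h2 : (t ^ 0 • (t • ((ContinuousLinearMap.apply ℝ G (x - z)).comp C).comp
        (fderiv ℝ φ (z + t • (x - z))) + C (φ (z + t • (x - z))))) a -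
        (t • fderiv ℝ φ (z + t • (x - z)) (x - z) a + φ (z + t • (x - z)) a) =
      t • (fderiv ℝ φ (z + t • (x - z)) a (x - z) -
        fderiv ℝ φ (z + t • (x - z)) (x - z) a) := by
    simp only [_root_.smul_apply, _root_.add_apply, ContinuousLinearMap.comp_apply,
      ContinuousLinearMap.apply_apply, ContinuousLinearMap.id_apply, C, pow_zero, one_smul, smul_sub]
    abel
  rw [h2, norm_smul, Real.norm_eq_abs, abs_of_nonneg ht.1.le]
  exact (mul_le_of_le_one_left (norm_nonneg _) ht.2).trans (hK t (Ioc_subset_Icc_self ht))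

/-- The Picard iterates for the equation `dg = -A g` with `g z = 1`. -/
def picard (A : E → E →L[ℝ] R) (z : E) : ℕ → E → R
  | 0 => fun _ => 1
  | n + 1 => fun x => 1 - ∫ t in (0 : ℝ)..1,
      homotopyIntegrand (ContinuousLinearMap.id ℝ (E →L[ℝ] R)) 0 (mulForm A (picard A z n)) z x t

theorem contDiff_picard {A : E → E →L[ℝ] R} (hA : ContDiff ℝ ∞ A) (z : E) (n : ℕ) :
    ContDiff ℝ ∞ (picard A z n) := by
  induction n with
  | zero => exact contDiff_const
  | succ n ih => exact contDiff_const.sub (contDiff_intervalIntegral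
      (contDiff_homotopyIntegrand _ 0 (contDiff_mulForm hA ih) z))

omit [FiniteDimensional ℝ E] in
theorem picard_self (A : E → E →L[ℝ] R) (z : E) (n : ℕ) : picard A z n z = 1 := by
  cases n <;> simp [picard, homotopyIntegrand]

omit [FiniteDimensional ℝ E] in
theorem segment_mem_ball {z x : E} {r t : ℝ} (hx : x ∈ Metric.ball z r) (ht : t ∈ Icc (0 : ℝ) 1) :
    z + t • (x - z) ∈ Metric.ball z r := by
  rw [Metric.mem_ball, dist_eq_norm] at hx ⊢
  rw [add_sub_cancel_left, norm_smul, Real.norm_eq_abs, abs_of_nonneg ht.1]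
  exact (mul_le_of_le_one_left (norm_nonneg _) ht.2).trans_lt hx

/-! ### Convergence of the Picard iteration -/

section Estimates

variable {A : E → E →L[ℝ] R} (hA : ContDiff ℝ ∞ A) {z : E} {r C : ℝ} (hC : 0 ≤ C)
  (hAC : ∀ x ∈ Metric.ball z r, ‖A x‖ ≤ C) (hr : C * r ≤ 1 / 4)
include hA hC hAC hr

/-- When C r ≤ 1/4, integrating `A f` along rays shrinks the supremum norm by a factor 1/4; the
weaker factor 1/2 is recorded. The norm of 1 is kept because a normed ring need not satisfy ‖1‖ = 1.
-/
theorem norm_picard_succ_sub_le (n : ℕ) : ∀ x ∈ Metric.ball z r,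
    ‖picard A z (n + 1) x - picard A z n x‖ ≤ ‖(1 : R)‖ / 2 * (1 / 2) ^ n := by
  have key : ∀ (f : E → R) (K : ℝ), 0 ≤ K → (∀ y ∈ Metric.ball z r, ‖f y‖ ≤ K) →
      ∀ x ∈ Metric.ball z r, ‖∫ t in (0 : ℝ)..1,
        homotopyIntegrand (ContinuousLinearMap.id ℝ (E →L[ℝ] R)) 0 (mulForm A f) z x t‖ ≤ K / 2 := by
    intro f K hK hf x hx
    refine (intervalIntegral.norm_integral_le_of_norm_le_const (C := K / 2) fun t ht => ?_).trans
      (by simp)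
    rw [uIoc_of_le zero_le_one] at ht
    have hm := segment_mem_ball hx (Ioc_subset_Icc_self ht)
    simp only [homotopyIntegrand, pow_zero, one_smul, ContinuousLinearMap.id_apply, mulForm_apply]
    have hxr : ‖x - z‖ ≤ r := by rw [← dist_eq_norm]; exact (Metric.mem_ball.1 hx).le
    calc _ ≤ ‖A (z + t • (x - z)) (x - z)‖ * ‖f (z + t • (x - z))‖ := norm_mul_le _ _
      _ ≤ (C * r) * K := mul_le_mul ((ContinuousLinearMap.le_of_opNorm_le _ (hAC _ hm) _).trans
          (mul_le_mul_of_nonneg_left hxr hC)) (hf _ hm) (norm_nonneg _)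
          (mul_nonneg hC ((norm_nonneg _).trans hxr))
      _ ≤ (1 / 4) * K := mul_le_mul_of_nonneg_right hr hK
      _ ≤ K / 2 := by linarith
  induction n with
  | zero =>
    intro x hx
    have h := key (fun _ => 1) ‖(1 : R)‖ (norm_nonneg _) (fun _ _ => le_rfl) x hx
    simpa [picard] using h
  | succ n ih =>
    intro x hx
    have h := key (picard A z (n + 1) - picard A z n) _ (by positivity) ih x hx
    have hsub : picard A z (n + 1 + 1) x - picard A z (n + 1) x = -∫ t in (0 : ℝ)..1,
        homotopyIntegrand (ContinuousLinearMap.id ℝ (E →L[ℝ] R)) 0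
          (mulForm A (picard A z (n + 1) - picard A z n)) z x t := by
      have hi : ∀ m, IntervalIntegrable (fun t => homotopyIntegrand
          (ContinuousLinearMap.id ℝ (E →L[ℝ] R)) 0 (mulForm A (picard A z m)) z x t)
          MeasureTheory.volume 0 1 := fun m =>
        ((contDiff_homotopyIntegrand (ContinuousLinearMap.id ℝ (E →L[ℝ] R)) 0
          (contDiff_mulForm hA (contDiff_picard hA z m)) z).continuous.comp
          (Continuous.prodMk_right x)).intervalIntegrable _ _
      have he : (fun t => homotopyIntegrand (ContinuousLinearMap.id ℝ (E →L[ℝ] R)) 0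
          (mulForm A (picard A z (n + 1) - picard A z n)) z x t) = fun t =>
          homotopyIntegrand (ContinuousLinearMap.id ℝ (E →L[ℝ] R)) 0
            (mulForm A (picard A z (n + 1))) z x t -
          homotopyIntegrand (ContinuousLinearMap.id ℝ (E →L[ℝ] R)) 0
            (mulForm A (picard A z n)) z x t := by
        funext t
        simp [homotopyIntegrand, mul_sub]
      rw [he, intervalIntegral.integral_sub (hi _) (hi _)]
      simp only [picard]
      abel
    rw [hsub, norm_neg]
    refine h.trans (le_of_eq ?_)
    ring

/-- Convergence alone does not yield a solution in several variables: the defect dg + Ag must tend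
to zero, and this is where flatness is used. The homotopy operator inverts d up to the exterior
derivative of `A g`, which flatness turns into a product of A with the defect of g. If K bounds the
defect, the two resulting terms contribute at most 2 · (1/4) · K. Replacing g by the next iterate in
`A g` adds at most K/8, so the bound shrinks by a factor below 3/4. -/
theorem norm_fderiv_picard_add_le [CompleteSpace R]
    (hflat : ∀ x ∈ Metric.ball z r, ∀ a b, fderiv ℝ A x a b - fderiv ℝ A x b a +
      A x a * A x b - A x b * A x a = 0) (n : ℕ) : ∀ x ∈ Metric.ball z r,
    ‖fderiv ℝ (picard A z n) x + mulForm A (picard A z n) x‖ ≤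
      4 * C * ‖(1 : R)‖ * (3 / 4) ^ n := by
  have hmul : ∀ (f : E → R) (x : E), x ∈ Metric.ball z r → ‖mulForm A f x‖ ≤ C * ‖f x‖ := by
    intro f x hx
    refine ContinuousLinearMap.opNorm_le_bound _ (by positivity) fun a => ?_
    calc _ ≤ ‖A x a‖ * ‖f x‖ := norm_mul_le _ _
      _ ≤ (C * ‖a‖) * ‖f x‖ := mul_le_mul_of_nonneg_right
          (ContinuousLinearMap.le_of_opNorm_le _ (hAC _ hx) _) (norm_nonneg _)
      _ = _ := by ring
  induction n with
  | zero =>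
    intro x hx
    have h0 : fderiv ℝ (picard A z 0) x = 0 := fderiv_const_apply _
    rw [h0, zero_add, pow_zero, mul_one]
    refine (hmul _ x hx).trans ?_
    simp only [picard]
    nlinarith [mul_nonneg hC (norm_nonneg (1 : R))]
  | succ n ih =>
    intro x hx
    set K := 4 * C * ‖(1 : R)‖ * (3 / 4) ^ n with hK
    have hK0 : 0 ≤ K := by positivity
    have hg := contDiff_picard hA z n
    have hxr : ‖x - z‖ ≤ r := by rw [← dist_eq_norm]; exact (Metric.mem_ball.1 hx).le
    have h1 : ‖fderiv ℝ (picard A z (n + 1)) x + mulForm A (picard A z n) x‖ ≤ K / 2 := by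
      refine ContinuousLinearMap.opNorm_le_bound _ (by positivity) fun a => ?_
      have h2 : fderiv ℝ (picard A z (n + 1)) x = -fderiv ℝ (fun y => ∫ t in (0 : ℝ)..1,
          homotopyIntegrand (ContinuousLinearMap.id ℝ (E →L[ℝ] R)) 0
            (mulForm A (picard A z n)) z y t) x := fderiv_const_sub _
      rw [h2, ← norm_neg]
      have h3 : -((-fderiv ℝ (fun y => ∫ t in (0 : ℝ)..1,
          homotopyIntegrand (ContinuousLinearMap.id ℝ (E →L[ℝ] R)) 0
            (mulForm A (picard A z n)) z y t) x + mulForm A (picard A z n) x) a) =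
          fderiv ℝ (fun y => ∫ t in (0 : ℝ)..1,
          homotopyIntegrand (ContinuousLinearMap.id ℝ (E →L[ℝ] R)) 0
            (mulForm A (picard A z n)) z y t) x a - mulForm A (picard A z n) x a := by
        simp [sub_eq_add_neg, add_comm]
      rw [h3]
      refine norm_fderiv_homotopy_sub_le (contDiff_mulForm hA hg) z x a fun t ht => ?_
      have hm := segment_mem_ball hx ht
      set y := z + t • (x - z)
      set v := x - z
      rw [fderiv_mulForm (hA.differentiable (by simp) y) (hg.differentiable (by simp) y),
        fderiv_mulForm (hA.differentiable (by simp) y) (hg.differentiable (by simp) y)]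
      have hf := hflat y hm a v
      -- The derivative of A is eliminated by flatness; what is left is the antisymmetrised product
      -- of A and the defect.
      have h4 : fderiv ℝ A y a v * picard A z n y + A y v * fderiv ℝ (picard A z n) y a -
          (fderiv ℝ A y v a * picard A z n y + A y a * fderiv ℝ (picard A z n) y v) =
          A y v * (fderiv ℝ (picard A z n) y + mulForm A (picard A z n) y) a -
          A y a * (fderiv ℝ (picard A z n) y + mulForm A (picard A z n) y) v := by
        have h5 : fderiv ℝ A y a v = fderiv ℝ A y v a - A y a * A y v + A y v * A y a := by
          rw [← sub_eq_zero, ← hf]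
          abel
        rw [h5]
        simp only [_root_.add_apply, mulForm_apply]
        noncomm_ring
      rw [h4]
      have h6 : ∀ b c : E, ‖A y b * (fderiv ℝ (picard A z n) y + mulForm A (picard A z n) y) c‖ ≤
          (C * ‖b‖) * (K * ‖c‖) := fun b c => (norm_mul_le _ _).trans
        (mul_le_mul (ContinuousLinearMap.le_of_opNorm_le _ (hAC _ hm) _)
          (ContinuousLinearMap.le_of_opNorm_le _ (ih y hm) _) (norm_nonneg _) (by positivity))
      refine (norm_sub_le _ _).trans ((add_le_add (h6 v a) (h6 a v)).trans ?_)
      have h7 : C * ‖v‖ ≤ 1 / 4 := (mul_le_mul_of_nonneg_left hxr hC).trans hr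
      have h8 := mul_le_mul_of_nonneg_right h7 (mul_nonneg hK0 (norm_nonneg a))
      calc _ = 2 * (C * ‖v‖ * (K * ‖a‖)) := by ring
        _ ≤ 2 * (1 / 4 * (K * ‖a‖)) := by linarith
        _ = K / 2 * ‖a‖ := by ring
    have h9 : fderiv ℝ (picard A z (n + 1)) x + mulForm A (picard A z (n + 1)) x =
        (fderiv ℝ (picard A z (n + 1)) x + mulForm A (picard A z n) x) +
          mulForm A (picard A z (n + 1) - picard A z n) x := by
      ext a
      simp only [_root_.add_apply, mulForm_apply, Pi.sub_apply]
      noncomm_ring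
    rw [h9]
    have h10 : (1 / 2 : ℝ) ^ n ≤ (3 / 4) ^ n := pow_le_pow_left₀ (by norm_num) (by norm_num) n
    have h11 := (hmul (picard A z (n + 1) - picard A z n) x hx).trans
      (mul_le_mul_of_nonneg_left (norm_picard_succ_sub_le hA hC hAC hr n x hx) hC)
    refine (norm_add_le _ _).trans ((add_le_add h1 h11).trans ?_)
    have h12 := mul_le_mul_of_nonneg_left h10 (mul_nonneg hC (norm_nonneg (1 : R)))
    rw [pow_succ]
    rw [hK]
    nlinarith [h12]

end Estimates

/-- The iterates converge, and since the defect tends to zero uniformly their derivatives converge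
uniformly to −Ag. Hence the limit is differentiable and solves dg = −Ag. -/
theorem exists_parallel_frame [CompleteSpace R] {A : E → E →L[ℝ] R} {z : E}
    (hA : ∀ᶠ y in 𝓝 z, ContDiffAt ℝ ∞ A y)
    (hflat : ∀ᶠ y in 𝓝 z, ∀ a b, fderiv ℝ A y a b - fderiv ℝ A y b a +
      A y a * A y b - A y b * A y a = 0) :
    ∃ g : E → R, g z = 1 ∧ ∀ᶠ y in 𝓝 z, ContDiffAt ℝ ∞ g y ∧
      ∀ a, fderiv ℝ g y a = -(A y a * g y) := by
  obtain ⟨A', hA', hAA'⟩ := exists_contDiff_eventuallyEq hA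
  have hflat' : ∀ᶠ y in 𝓝 z, ∀ a b, fderiv ℝ A' y a b - fderiv ℝ A' y b a +
      A' y a * A' y b - A' y b * A' y a = 0 := by
    filter_upwards [hAA'.eventuallyEq_nhds, hflat] with y hy h
    rw [hy.fderiv_eq, hy.eq_of_nhds]
    exact h
  suffices H : ∃ g : E → R, g z = 1 ∧ ∀ᶠ y in 𝓝 z, ContDiffAt ℝ ∞ g y ∧
      ∀ a, fderiv ℝ g y a = -(A' y a * g y) by
    obtain ⟨g, h1, h2⟩ := H
    refine ⟨g, h1, ?_⟩
    filter_upwards [h2, hAA'] with y h3 h4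
    rwa [← h4]
  clear hAA' hA hflat
  -- The summand 1 makes C positive and leaves room for the bound to persist near z; the radius
  -- 1/(4C) then gives C r ≤ 1/4.
  set C : ℝ := ‖A' z‖ + 1 with hCdef
  have hC : 0 < C := by positivity
  have hbd : ∀ᶠ y in 𝓝 z, ‖A' y‖ ≤ C := by
    have := hA'.continuous.norm.tendsto z
    filter_upwards [this.eventually (gt_mem_nhds (lt_add_one _))] with y hy using hy.le
  obtain ⟨r₀, hr₀, hball⟩ := Metric.eventually_nhds_iff_ball.1 (hbd.and hflat')
  set r := min r₀ (1 / (4 * C)) with hrdef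
  have hr0 : 0 < r := by positivity
  have hr : C * r ≤ 1 / 4 := by
    calc C * r ≤ C * (1 / (4 * C)) := mul_le_mul_of_nonneg_left (min_le_right _ _) hC.le
      _ = 1 / 4 := by field_simp
  have hsub : Metric.ball z r ⊆ Metric.ball z r₀ := Metric.ball_subset_ball (min_le_left _ _)
  have hAC : ∀ x ∈ Metric.ball z r, ‖A' x‖ ≤ C := fun x hx => (hball x (hsub hx)).1
  have hfl := fun x (hx : x ∈ Metric.ball z r) => (hball x (hsub hx)).2
  have e1 := norm_picard_succ_sub_le hA' hC.le hAC hr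
  have e2 := norm_fderiv_picard_add_le hA' hC.le hAC hr hfl
  have hdist : ∀ x ∈ Metric.ball z r, ∀ n, dist (picard A' z n x) (picard A' z (n + 1) x) ≤
      ‖(1 : R)‖ / 2 * (1 / 2) ^ n := fun x hx n => by
    rw [dist_comm, dist_eq_norm]
    exact e1 n x hx
  have hlim : ∀ x, ∃ l, x ∈ Metric.ball z r →
      Tendsto (fun n => picard A' z n x) atTop (𝓝 l) := fun x => by
    by_cases hx : x ∈ Metric.ball z r
    · obtain ⟨l, hl⟩ := cauchySeq_tendsto_of_complete
        (cauchySeq_of_le_geometric _ _ (by norm_num) (hdist x hx))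
      exact ⟨l, fun _ => hl⟩
    · exact ⟨0, fun h => absurd h hx⟩
  choose g hg using hlim
  have hgd : ∀ x ∈ Metric.ball z r, ∀ n, ‖picard A' z n x - g x‖ ≤ ‖(1 : R)‖ * (3 / 4) ^ n := by
    intro x hx n
    rw [← dist_eq_norm]
    refine (dist_le_of_le_geometric_of_tendsto _ _ (by norm_num) (hdist x hx) (hg x hx) n).trans ?_
    have h10 : (1 / 2 : ℝ) ^ n ≤ (3 / 4) ^ n := pow_le_pow_left₀ (by norm_num) (by norm_num) n
    have := mul_le_mul_of_nonneg_left h10 (norm_nonneg (1 : R))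
    refine le_trans (le_of_eq ?_) this
    ring
  have hmul : ∀ (f : E → R) (x : E), x ∈ Metric.ball z r → ‖mulForm A' f x‖ ≤ C * ‖f x‖ := by
    intro f x hx
    refine ContinuousLinearMap.opNorm_le_bound _ (by positivity) fun a => ?_
    calc _ ≤ ‖A' x a‖ * ‖f x‖ := norm_mul_le _ _
      _ ≤ (C * ‖a‖) * ‖f x‖ := mul_le_mul_of_nonneg_right
          (ContinuousLinearMap.le_of_opNorm_le _ (hAC _ hx) _) (norm_nonneg _)
      _ = _ := by ring
  have hunif : TendstoUniformlyOn (fun n => fderiv ℝ (picard A' z n)) (fun x => -mulForm A' g x)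
      atTop (Metric.ball z r) := by
    rw [Metric.tendstoUniformlyOn_iff]
    intro ε hε
    have ht : Tendsto (fun n : ℕ => (5 * C * ‖(1 : R)‖) * (3 / 4 : ℝ) ^ n) atTop (𝓝 0) := by
      simpa using (tendsto_pow_atTop_nhds_zero_of_lt_one (by norm_num : (0 : ℝ) ≤ 3 / 4)
        (by norm_num)).const_mul (5 * C * ‖(1 : R)‖)
    filter_upwards [ht.eventually (gt_mem_nhds hε)] with n hn x hx
    refine lt_of_le_of_lt ?_ hn
    rw [dist_comm, dist_eq_norm]
    have h1 : fderiv ℝ (picard A' z n) x - -mulForm A' g x =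
        (fderiv ℝ (picard A' z n) x + mulForm A' (picard A' z n) x) -
          mulForm A' (picard A' z n - g) x := by
      ext a
      simp only [_root_.add_apply, _root_.sub_apply, _root_.neg_apply, mulForm_apply, Pi.sub_apply]
      noncomm_ring
    rw [h1]
    have h2 := (hmul (picard A' z n - g) x hx).trans
      (mul_le_mul_of_nonneg_left (hgd x hx n) hC.le)
    refine (norm_sub_le _ _).trans ((add_le_add (e2 n x hx) h2).trans (le_of_eq ?_))
    ring
  have hder : ∀ x ∈ Metric.ball z r, HasFDerivAt g (-mulForm A' g x) x := fun x hx =>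
    hasFDerivAt_of_tendstoUniformlyOn Metric.isOpen_ball hunif
      (fun n y _ => ((contDiff_picard hA' z n).differentiable (by simp) y).hasFDerivAt)
      (fun y hy => hg y hy) hx
  -- Bootstrapping: the derivative of g is −Ag, so each order of smoothness of g gives the next.
  have hsm : ∀ n : ℕ, ContDiffOn ℝ n g (Metric.ball z r) := by
    intro n
    induction n with
    | zero => exact contDiffOn_zero.2 fun x hx => (hder x hx).continuousAt.continuousWithinAt
    | succ n ih =>
      push_cast
      rw [contDiffOn_succ_iff_fderiv_of_isOpen Metric.isOpen_ball]
      refine ⟨fun x hx => (hder x hx).differentiableAt.differentiableWithinAt, by simp, ?_⟩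
      refine ContDiffOn.congr (f := fun x => -mulForm A' g x) ?_ fun x hx => (hder x hx).fderiv
      exact (contDiffOn_mulForm ((hA'.of_le (by exact_mod_cast le_top)).contDiffOn) ih).neg
  refine ⟨g, ?_, ?_⟩
  · refine tendsto_nhds_unique (hg z (Metric.mem_ball_self hr0)) ?_
    simp [picard_self]
  · filter_upwards [Metric.ball_mem_nhds z hr0] with x hx
    refine ⟨(contDiffOn_infty.2 hsm).contDiffAt (Metric.isOpen_ball.mem_nhds hx), fun a => ?_⟩
    rw [(hder x hx).fderiv]
    rfl

end Flat

/-! ### The Bianchi identity -/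

section Bianchi

open Filter

variable {E : Type} [NormedAddCommGroup E] [NormedSpace ℝ E]

theorem twoForm_swap {T W : Type*} [AddCommGroup T] [Module ℝ T] [TopologicalSpace T]
    [AddCommGroup W] [Module ℝ W] [TopologicalSpace W] (J : T [⋀^Fin 2]→L[ℝ] W) (u v : T) :
    J ![u, v] = -J ![v, u] := by
  have h : ![v, u] ∘ Equiv.swap (0 : Fin 2) 1 = ![u, v] := by
    funext i
    fin_cases i <;> simp
  have := J.toAlternatingMap.map_swap ![v, u] (i := 0) (j := 1) (by decide)
  rw [h] at this
  exact this

theorem two_le_infty : (2 : ℕ∞ω) ≤ ∞ := by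
  exact WithTop.coe_le_coe.2 (le_top : (2 : ℕ∞) ≤ ⊤)

/-- On a symplectic vector space of dimension at least four, the product with the symplectic form
is injective on one-forms. -/
theorem eq_zero_of_cyclic_sum_eq_zero [FiniteDimensional ℝ E] {R : Type*} [AddCommGroup R]
    [Module ℝ R] (B : E →ₗ[ℝ] E →ₗ[ℝ] ℝ) (hanti : ∀ a b, B a b = -B b a)
    (hnd : ∀ a, (∀ b, B a b = 0) → a = 0) (hdim : 4 ≤ Module.finrank ℝ E) (P : E →ₗ[ℝ] R)
    (hP : ∀ a b c, B a b • P c + B b c • P a + B c a • P b = 0) : P = 0 := by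
  ext c
  by_cases hc : c = 0
  · simp [hc]
  obtain ⟨w, hw⟩ : ∃ w, B c w ≠ 0 := by
    by_contra! h
    exact hc (hnd c h)
  -- The hyperplane orthogonal to c cannot be isotropic. If it were, a vector a in it with B(a, w) =
  -- 0 would be orthogonal both to the hyperplane and to w, which together span, so a = 0. Then B(·,
  -- w) would embed the hyperplane into ℝ and the dimension would be at most 2.
  obtain ⟨a, ha, b, hb, hab⟩ : ∃ a, B c a = 0 ∧ ∃ b, B c b = 0 ∧ B a b ≠ 0 := by
    by_contra! h
    have hinj : Function.Injective ((B.flip w).comp (B c).ker.subtype) := by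
      rw [← LinearMap.ker_eq_bot, LinearMap.ker_eq_bot']
      rintro ⟨a, ha⟩ h0
      have h0' : B a w = 0 := h0
      refine Subtype.ext (hnd a fun b => ?_)
      have h1 : B c (b - (B c b / B c w) • w) = 0 := by
        simp [div_mul_cancel₀ _ hw]
      have h2 := h a ha _ h1
      simpa [h0'] using h2
    have h1 := LinearMap.finrank_le_finrank_of_injective hinj
    have h2 := (B c).finrank_range_add_finrank_ker
    have h3 := (B c).range.finrank_le
    simp only [Module.finrank_self] at h1 h3
    omega
  -- As a and b are orthogonal to c, only the term in `P c` survives.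
  have h := hP a b c
  rw [hanti b c, hb, ha] at h
  simpa [hab] using h

theorem fderiv_bracket {R : Type*} [NormedRing R] [NormedAlgebra ℝ R] {u v : E → R} {y : E}
    (hu : DifferentiableAt ℝ u y) (hv : DifferentiableAt ℝ v y) (c : E) :
    fderiv ℝ (fun x => u x * v x - v x * u x) y c =
      fderiv ℝ u y c * v y + u y * fderiv ℝ v y c -
        (fderiv ℝ v y c * u y + v y * fderiv ℝ u y c) := by
  have h := (hu.hasFDerivAt.mul' hv.hasFDerivAt).sub (hv.hasFDerivAt.mul' hu.hasFDerivAt)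
  rw [show fderiv ℝ (fun x => u x * v x - v x * u x) y = _ from h.fderiv]
  simp [add_comm]

/-- The curvature equation on two directions is differentiated in the third and summed cyclically.
Second derivatives of A cancel by symmetry and derivatives of J cancel because J is closed. The
first-order terms in A combine with the commutators of A and the curvature, leaving J ∧ ∇Θ = 0. -/
theorem bianchi {R : Type*} [NormedRing R] [NormedAlgebra ℝ R] {A : E → E →L[ℝ] R} {Θ : E → R}
    {J : E → E [⋀^Fin 2]→L[ℝ] ℝ} {y : E} (hA : ContDiffAt ℝ ∞ A y) (hΘ : DifferentiableAt ℝ Θ y)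
    (hJ : DifferentiableAt ℝ J y)
    (hclosed : ∀ a b c, fderiv ℝ (fun x => J x ![b, c]) y a - fderiv ℝ (fun x => J x ![a, c]) y b +
      fderiv ℝ (fun x => J x ![a, b]) y c = 0)
    (hcurv : ∀ᶠ x in 𝓝 y, ∀ a b, fderiv ℝ A x a b - fderiv ℝ A x b a +
      (A x a * A x b - A x b * A x a) = (2 * J x ![a, b]) • Θ x) (a b c : E) :
    J y ![a, b] • (fderiv ℝ Θ y c + (A y c * Θ y - Θ y * A y c)) +
      J y ![b, c] • (fderiv ℝ Θ y a + (A y a * Θ y - Θ y * A y a)) +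
      J y ![c, a] • (fderiv ℝ Θ y b + (A y b * Θ y - Θ y * A y b)) = 0 := by
  have hA1 : DifferentiableAt ℝ A y := hA.differentiableAt (by simp)
  have hA2 : DifferentiableAt ℝ (fderiv ℝ A) y :=
    (hA.fderiv_right (m := ∞) (by simp)).differentiableAt (by simp)
  have hsymm : ∀ u v, fderiv ℝ (fderiv ℝ A) y u v = fderiv ℝ (fderiv ℝ A) y v u :=
    (hA.isSymmSndFDerivAt (by simpa using two_le_infty)).eq
  have hAe : ∀ u v, fderiv ℝ (fun x => A x v) y u = fderiv ℝ A y u v := fun u v => by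
    rw [fderiv_clm_apply hA1 (differentiableAt_const v)]
    simp
  have hdA : ∀ v, DifferentiableAt ℝ (fun x => A x v) y := fun v =>
    hA1.clm_apply (differentiableAt_const v)
  have hA2e : ∀ u v, DifferentiableAt ℝ (fun x => fderiv ℝ A x u v) y := fun u v =>
    (hA2.clm_apply (differentiableAt_const u)).clm_apply (differentiableAt_const v)
  have hA2d : ∀ w u v, fderiv ℝ (fun x => fderiv ℝ A x u v) y w =
      fderiv ℝ (fderiv ℝ A) y w u v := fun w u v => by
    rw [fderiv_clm_apply (hA2.clm_apply (differentiableAt_const u)) (differentiableAt_const v),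
      fderiv_clm_apply hA2 (differentiableAt_const u)]
    simp
  have hJe : ∀ u v, DifferentiableAt ℝ (fun x => J x ![u, v]) y := fun u v =>
    hJ.continuousAlternatingMap_apply_const _
  have main : ∀ a b c, fderiv ℝ (fderiv ℝ A) y c a b - fderiv ℝ (fderiv ℝ A) y c b a +
      (fderiv ℝ A y c a * A y b + A y a * fderiv ℝ A y c b -
        (fderiv ℝ A y c b * A y a + A y b * fderiv ℝ A y c a)) =
      (2 * J y ![a, b]) • fderiv ℝ Θ y c + (2 * fderiv ℝ (fun x => J x ![a, b]) y c) • Θ y := by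
    intro a b c
    have h1 : (fun x => fderiv ℝ A x a b - fderiv ℝ A x b a +
      (A x a * A x b - A x b * A x a)) =ᶠ[𝓝 y] fun x => (2 * J x ![a, b]) • Θ x := by
      filter_upwards [hcurv] with x hx using hx a b
    have h2 := congrArg (fun L : E →L[ℝ] R => L c) (h1.fderiv_eq (𝕜 := ℝ))
    have h3 : fderiv ℝ (fun x => fderiv ℝ A x a b - fderiv ℝ A x b a +
        (A x a * A x b - A x b * A x a)) y = fderiv ℝ (fun x => fderiv ℝ A x a b) y -
        fderiv ℝ (fun x => fderiv ℝ A x b a) y +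
        fderiv ℝ (fun x => A x a * A x b - A x b * A x a) y := by
      exact (((hA2e a b).hasFDerivAt.sub (hA2e b a).hasFDerivAt).add
        (DifferentiableAt.hasFDerivAt (f := fun x => A x a * A x b - A x b * A x a)
          (((hdA a).mul (hdA b)).sub ((hdA b).mul (hdA a))))).fderiv
    have h4 : fderiv ℝ (fun x => (2 * J x ![a, b]) • Θ x) y c =
        (2 * J y ![a, b]) • fderiv ℝ Θ y c +
          (2 * fderiv ℝ (fun x => J x ![a, b]) y c) • Θ y := by
      rw [fderiv_fun_smul ((hJe a b).const_mul 2) hΘ, fderiv_const_mul (hJe a b)]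
      simp
    simp only [h3, h4, _root_.add_apply, _root_.sub_apply, hA2d, fderiv_bracket (hdA a) (hdA b),
      hAe] at h2
    exact h2
  have hc := hcurv.self_of_nhds
  have hcl := hclosed a b c
  have hJsw : fderiv ℝ (fun x => J x ![c, a]) y b = -fderiv ℝ (fun x => J x ![a, c]) y b := by
    have h1 : (fun x => J x ![c, a]) = fun x => -J x ![a, c] := by
      funext x
      exact twoForm_swap _ _ _
    rw [h1, fderiv_fun_neg]
    rfl
  have m1 := main a b c
  have m2 := main b c a
  have m3 := main c a b
  have c1 := hc a b
  have c2 := hc b c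
  have c3 := hc c a
  have hT : (2 * fderiv ℝ (fun x => J x ![a, b]) y c) • Θ y +
      (2 * fderiv ℝ (fun x => J x ![b, c]) y a) • Θ y +
      (2 * fderiv ℝ (fun x => J x ![c, a]) y b) • Θ y = 0 := by
    rw [← add_smul, ← add_smul, hJsw]
    have : 2 * fderiv ℝ (fun x => J x ![a, b]) y c + 2 * fderiv ℝ (fun x => J x ![b, c]) y a +
      2 * -fderiv ℝ (fun x => J x ![a, c]) y b = 0 := by linarith
    rw [this, zero_smul]
  -- The commutators of A with 2JΘ are rewritten, by the curvature equation read backwards, in terms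
  -- of A and its first derivatives, so that they cancel against the differentiated equation.
  have b1 : (2 * J y ![a, b]) • (A y c * Θ y - Θ y * A y c) = A y c * ((2 * J y ![a, b]) • Θ y) -
      ((2 * J y ![a, b]) • Θ y) * A y c := by simp [smul_sub]
  have b2 : (2 * J y ![b, c]) • (A y a * Θ y - Θ y * A y a) = A y a * ((2 * J y ![b, c]) • Θ y) -
      ((2 * J y ![b, c]) • Θ y) * A y a := by simp [smul_sub]
  have b3 : (2 * J y ![c, a]) • (A y b * Θ y - Θ y * A y b) = A y b * ((2 * J y ![c, a]) • Θ y) -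
      ((2 * J y ![c, a]) • Θ y) * A y b := by simp [smul_sub]
  rw [← c1] at b1
  rw [← c2] at b2
  rw [← c3] at b3
  have s1 := hsymm c a
  have s2 := hsymm c b
  have s3 := hsymm a b
  rw [s1, s2] at m1
  rw [s3] at m2
  refine (smul_right_injective R (two_ne_zero (α := ℝ))) ?_
  simp only [smul_add, smul_smul, smul_zero]
  have e1 := eq_sub_of_add_eq m1.symm
  have e2 := eq_sub_of_add_eq m2.symm
  have e3 := eq_sub_of_add_eq m3.symm
  rw [b1, b2, b3, e1, e2, e3]
  have e4 : (2 * fderiv ℝ (fun x => J x ![c, a]) y b) • Θ y =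
      -((2 * fderiv ℝ (fun x => J x ![a, b]) y c) • Θ y) -
      (2 * fderiv ℝ (fun x => J x ![b, c]) y a) • Θ y := by
    rw [← sub_eq_zero, ← hT]
    abel
  rw [e4]
  noncomm_ring

end Bianchi

/-! ### Local normal form of symplectically flat connections -/

section Gauge

open Filter

theorem eventually_eq_of_fderiv_eq_zero {E G : Type*} [NormedAddCommGroup E] [NormedSpace ℝ E]
    [NormedAddCommGroup G] [NormedSpace ℝ G] {f : E → G} {z : E}
    (hf : ∀ᶠ y in 𝓝 z, DifferentiableAt ℝ f y ∧ fderiv ℝ f y = 0) : ∀ᶠ y in 𝓝 z, f y = f z := by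
  obtain ⟨r, hr, h⟩ := Metric.eventually_nhds_iff_ball.1 hf
  filter_upwards [Metric.ball_mem_nhds z hr] with y hy
  exact (convex_ball z r).is_const_of_fderivWithin_eq_zero (𝕜 := ℝ)
    (fun x hx => (h x hx).1.differentiableWithinAt)
    (fun x hx => by
      rw [fderivWithin_of_isOpen Metric.isOpen_ball hx]
      exact (h x hx).2) hy (Metric.mem_ball_self hr)

variable {E : Type} [NormedAddCommGroup E] [NormedSpace ℝ E]

theorem extDeriv_twoForm_apply {J : E → E [⋀^Fin 2]→L[ℝ] ℝ} {y : E} (hJ : DifferentiableAt ℝ J y)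
    (v : Fin 3 → E) : extDeriv J y v = fderiv ℝ (fun x => J x ![v 1, v 2]) y (v 0) -
      fderiv ℝ (fun x => J x ![v 0, v 2]) y (v 1) + fderiv ℝ (fun x => J x ![v 0, v 1]) y (v 2) := by
  have h0 : ∀ m : Fin 2 → E, m = ![m 0, m 1] := fun m => by
    funext i
    fin_cases i <;> rfl
  rw [extDeriv_apply hJ, Fin.sum_univ_three, h0 (Fin.removeNth 0 v), h0 (Fin.removeNth 1 v),
    h0 (Fin.removeNth 2 v)]
  have e1 : Fin.removeNth 0 v 0 = v 1 := rfl
  have e2 : Fin.removeNth 0 v 1 = v 2 := rfl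
  have e3 : Fin.removeNth 1 v 0 = v 0 := rfl
  have e4 : Fin.removeNth 1 v 1 = v 2 := rfl
  have e5 : Fin.removeNth 2 v 0 = v 0 := rfl
  have e6 : Fin.removeNth 2 v 1 = v 1 := rfl
  rw [e1, e2, e3, e4, e5, e6]
  norm_num
  abel

theorem extDeriv_oneForm_apply {β : E → E [⋀^Fin 1]→L[ℝ] ℝ} {y : E} (hβ : DifferentiableAt ℝ β y)
    (a b : E) : extDeriv β y ![a, b] = fderiv ℝ (fun x => β x ![b]) y a -
      fderiv ℝ (fun x => β x ![a]) y b := by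
  have e1 : Fin.removeNth 0 ![a, b] = ![b] := by
    funext i
    fin_cases i; rfl
  have e2 : Fin.removeNth 1 ![a, b] = ![a] := by
    funext i
    fin_cases i; rfl
  rw [extDeriv_apply hβ, Fin.sum_univ_two, e1, e2]
  norm_num
  abel

/-- A symplectic potential. -/
theorem exists_potential [FiniteDimensional ℝ E] {J : E → E [⋀^Fin 2]→L[ℝ] ℝ} {z : E}
    (hJ : ∀ᶠ y in 𝓝 z, ContDiffAt ℝ ∞ J y) (hd : ∀ᶠ y in 𝓝 z, extDeriv J y = 0) :
    ∃ α : E → E →L[ℝ] ℝ, ContDiff ℝ ∞ α ∧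
      ∀ᶠ y in 𝓝 z, ∀ a b, fderiv ℝ α y a b - fderiv ℝ α y b a = 2 * J y ![a, b] := by
  obtain ⟨β, hβ, hdβ⟩ := exists_extDeriv_eq hJ hd
  let L : (E [⋀^Fin 1]→L[ℝ] ℝ) →L[ℝ] (E →L[ℝ] ℝ) :=
    (ContinuousAlternatingMap.ofSubsingletonLIE (𝕜 := ℝ) (E := E) (F := ℝ)
      (0 : Fin 1)).symm.toContinuousLinearEquiv.toContinuousLinearMap
  have hL : ∀ (γ : E [⋀^Fin 1]→L[ℝ] ℝ) (a : E), L γ a = γ ![a] := fun γ a => by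
    have : (fun _ : Fin 1 => a) = ![a] := by
      funext i
      fin_cases i; rfl
    simp [L, this]
  -- The factor 2 matches the convention that the curvature is 2JΘ.
  refine ⟨fun y => ((2 : ℝ) • L) (β y), ((2 : ℝ) • L).contDiff.comp hβ, ?_⟩
  filter_upwards [hdβ] with y hy a b
  have d1 : DifferentiableAt ℝ β y := hβ.contDiffAt.differentiableAt (by simp)
  have h1 : ∀ u v, fderiv ℝ (fun y => ((2 : ℝ) • L) (β y)) y u v =
      2 * fderiv ℝ (fun x => β x ![v]) y u := fun u v => by
    have : (fun x => β x ![v]) = fun x => L (β x) v := by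
      funext x
      rw [hL]
    rw [this]
    have d2 : DifferentiableAt ℝ (fun x => L (β x)) y := L.differentiableAt.comp y d1
    rw [fderiv_clm_apply d2 (differentiableAt_const v)]
    have h3 : HasFDerivAt (fun x => ((2 : ℝ) • L) (β x)) ((2 : ℝ) • fderiv ℝ (fun x => L (β x)) y) y :=
      d2.hasFDerivAt.const_smul (2 : ℝ)
    rw [h3.fderiv]
    simp
  rw [h1, h1, ← hy, extDeriv_oneForm_apply d1, mul_sub]

variable {R : Type*} [NormedRing R] [NormedAlgebra ℝ R] [CompleteSpace R]

/-- The connection matrix A − αΘ is flat: dα Θ cancels the curvature, the derivative of Θ is the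
commutator of Θ with A since Θ is parallel, and the terms quadratic in α cancel. A parallel frame g
of it also trivialises Θ, because Θ is parallel for A − αΘ as well (it commutes with itself). -/
theorem exists_gauge [FiniteDimensional ℝ E] {A : E → E →L[ℝ] R} {Θ : E → R}
    {α : E → E →L[ℝ] ℝ} {z : E}
    (hA : ∀ᶠ y in 𝓝 z, ContDiffAt ℝ ∞ A y) (hΘ : ∀ᶠ y in 𝓝 z, ContDiffAt ℝ ∞ Θ y)
    (hα : ContDiff ℝ ∞ α)
    (hcurv : ∀ᶠ x in 𝓝 z, ∀ a b, fderiv ℝ A x a b - fderiv ℝ A x b a +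
      (A x a * A x b - A x b * A x a) = (fderiv ℝ α x a b - fderiv ℝ α x b a) • Θ x)
    (hP : ∀ᶠ x in 𝓝 z, ∀ c, fderiv ℝ Θ x c + (A x c * Θ x - Θ x * A x c) = 0) :
    ∃ g h : E → R, ∀ᶠ y in 𝓝 z, ContDiffAt ℝ ∞ g y ∧ ContDiffAt ℝ ∞ h y ∧ g y * h y = 1 ∧
      h y * g y = 1 ∧ (∀ a, fderiv ℝ g y a = -((A y a - α y a • Θ y) * g y)) ∧
      h y * Θ y * g y = Θ z := by
  have hA' : ∀ᶠ y in 𝓝 z, ContDiffAt ℝ ∞ (fun y => A y - (α y).smulRight (Θ y)) y := by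
    filter_upwards [hA, hΘ] with y h1 h2
    exact h1.sub (hα.contDiffAt.smulRight h2)
  obtain ⟨g, hgz, hg⟩ := exists_parallel_frame hA' (by
    filter_upwards [hA, hΘ, hcurv, hP, hA'] with y h1 h2 h3 h4 hA'y a b
    have d1 := h1.differentiableAt (by simp)
    have d2 := h2.differentiableAt (by simp)
    have d3 : DifferentiableAt ℝ α y := hα.contDiffAt.differentiableAt (by simp)
    have e : ∀ u v, fderiv ℝ (fun y => A y - (α y).smulRight (Θ y)) y u v =
        fderiv ℝ A y u v - (fderiv ℝ α y u v • Θ y + α y v • fderiv ℝ Θ y u) := fun u v => by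
      have f1 : fderiv ℝ (fun y => (A y - (α y).smulRight (Θ y)) v) y u =
          fderiv ℝ (fun y => A y - (α y).smulRight (Θ y)) y u v := by
        rw [fderiv_clm_apply ((hA'y).differentiableAt (by simp)) (differentiableAt_const v)]
        simp
      have d4 : DifferentiableAt ℝ (fun y => A y v) y := d1.clm_apply (differentiableAt_const v)
      have d5 : DifferentiableAt ℝ (fun y => α y v) y := d3.clm_apply (differentiableAt_const v)
      have f2 : HasFDerivAt (fun y => A y v - α y v • Θ y) _ y :=
        d4.hasFDerivAt.sub (d5.hasFDerivAt.smul d2.hasFDerivAt)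
      rw [← f1]
      simp only [_root_.sub_apply, ContinuousLinearMap.smulRight_apply]
      rw [f2.fderiv, fderiv_clm_apply d1 (differentiableAt_const v),
        fderiv_clm_apply d3 (differentiableAt_const v)]
      simp
      abel
    have h5 : ∀ u, fderiv ℝ Θ y u = Θ y * A y u - A y u * Θ y := fun u => by
      rw [← sub_eq_zero, ← h4 u]; abel
    rw [e, e, h5, h5]
    have h6 := h3 a b
    simp only [_root_.sub_apply, ContinuousLinearMap.smulRight_apply, sub_smul, mul_sub, sub_mul,
      smul_mul_assoc, mul_smul_comm, smul_sub, smul_smul, mul_comm (α y b) (α y a)] at h6 ⊢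
    rw [← sub_eq_zero] at h6
    rw [← h6]
    abel)
  have hunit : ∀ᶠ y in 𝓝 z, IsUnit (g y) := by
    have : ContinuousAt g z := (hg.self_of_nhds.1).continuousAt
    refine this.eventually (Units.isOpen.mem_nhds ?_)
    rw [hgz]
    exact isUnit_one
  have hinv : ∀ᶠ y in 𝓝 z, ContDiffAt ℝ ∞ (fun y => Ring.inverse (g y)) y := by
    filter_upwards [hg, hunit] with y h1 h2
    obtain ⟨u, hu⟩ := h2
    exact ContDiffAt.comp y (f := g) (g := Ring.inverse) (by rw [← hu]; exact contDiffAt_ringInverse ℝ u) h1.1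
  have hgg : ∀ᶠ y in 𝓝 z, (∀ a, fderiv ℝ g y a = -((A y a - α y a • Θ y) * g y)) := by
    filter_upwards [hg] with y h1 a
    simpa using h1.2 a
  -- The derivative of g⁻¹Θg is the covariant derivative of Θ conjugated by g, hence zero.
  have hT : ∀ᶠ y in 𝓝 z, Ring.inverse (g y) * Θ y * g y = Ring.inverse (g z) * Θ z * g z := by
    apply eventually_eq_of_fderiv_eq_zero
    filter_upwards [hg, hunit, hunit.eventually_nhds, hinv, hΘ, hP, hgg] with y h1 h2 h2' h3 h4 h5 h6
    have d1 := h1.1.differentiableAt (by simp)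
    have d3 := h3.differentiableAt (by simp)
    have d4 := h4.differentiableAt (by simp)
    refine ⟨(d3.mul d4).mul d1, ?_⟩
    have k1 : (fun y => Ring.inverse (g y) * g y) =ᶠ[𝓝 y] fun _ => 1 := by
      filter_upwards [h2'] with x hx using Ring.inverse_mul_cancel _ hx
    ext a
    have k2 : HasFDerivAt (fun y => Ring.inverse (g y) * g y) _ y :=
      d3.hasFDerivAt.mul' d1.hasFDerivAt
    have k3 := congrArg (fun L : E →L[ℝ] R => L a)
      (k2.unique ((hasFDerivAt_const (1 : R) y).congr_of_eventuallyEq k1))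
    have k5 : HasFDerivAt (fun y => Ring.inverse (g y) * Θ y * g y) _ y :=
      (d3.hasFDerivAt.mul' d4.hasFDerivAt).mul' d1.hasFDerivAt
    rw [k5.fderiv]
    have h5' : fderiv ℝ Θ y a = Θ y * A y a - A y a * Θ y := by
      rw [← sub_eq_zero, ← h5 a]; abel
    simp [h6, h5'] at k3 ⊢
    generalize fderiv ℝ (fun y => Ring.inverse (g y)) y a = dH at k3 ⊢
    generalize Ring.inverse (g y) = H at k3 ⊢
    -- The derivative of the inverse comes from differentiating g⁻¹g = 1, recorded in `k3`, and
    -- cancelling the unit g on the right.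
    have k4 : dH = H * (A y a - α y a • Θ y) := by
      refine h2.mul_right_cancel ?_
      rw [mul_assoc, ← sub_eq_zero, ← k3]
      abel
    rw [k4]
    simp only [mul_sub, sub_mul, mul_assoc, smul_mul_assoc, mul_smul_comm]
    abel
  refine ⟨g, fun y => Ring.inverse (g y), ?_⟩
  filter_upwards [hg, hunit, hinv, hT, hgg] with y h1 h2 h3 h4 h5
  refine ⟨h1.1, h3, Ring.mul_inverse_cancel _ h2, Ring.inverse_mul_cancel _ h2, h5, ?_⟩
  rw [h4, hgz]
  simp

end Gauge

/-! ### Products with one-forms -/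

section OneForms

open Filter ContinuousAlternatingMap

variable {E : Type} {F : Type*} [NormedAddCommGroup E] [NormedSpace ℝ E]
  [NormedAddCommGroup F] [NormedSpace ℝ F] {k : ℕ}

/-- The (unnormalised) product of a one-form and a `k`-form. -/
def oneWedge (α : E →L[ℝ] ℝ) (φ : E [⋀^Fin k]→L[ℝ] F) : E [⋀^Fin (k + 1)]→L[ℝ] F :=
  alternatizeUncurryFin (α.smulRight φ)

/-- The bilinear map `(a, b) ↦ B(a, b) φ`. -/
def formSmul (B : E →L[ℝ] E →L[ℝ] ℝ) (φ : E [⋀^Fin k]→L[ℝ] F) :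
    E →L[ℝ] E →L[ℝ] E [⋀^Fin k]→L[ℝ] F :=
  ((ContinuousLinearMap.smulRightL ℝ E (E [⋀^Fin k]→L[ℝ] F)).flip φ).comp B

theorem formSmul_apply (B : E →L[ℝ] E →L[ℝ] ℝ) (φ : E [⋀^Fin k]→L[ℝ] F) (a b : E) :
    formSmul B φ a b = B a b • φ := rfl

/-- The double alternatisation is antisymmetric. -/
theorem alternatize_alternatize_flip (f : E →L[ℝ] E →L[ℝ] E [⋀^Fin k]→L[ℝ] F) :
    alternatizeUncurryFin (alternatizeUncurryFinCLM ℝ E F ∘L f.flip) =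
      -alternatizeUncurryFin (alternatizeUncurryFinCLM ℝ E F ∘L f) := by
  ext v
  rw [alternatizeUncurryFin_alternatizeUncurryFinCLM_comp_apply, ContinuousAlternatingMap.neg_apply,
    alternatizeUncurryFin_alternatizeUncurryFinCLM_comp_apply, ← Finset.sum_neg_distrib]
  refine Finset.sum_congr rfl fun i _ => ?_
  rw [← Finset.sum_neg_distrib]
  refine Finset.sum_congr rfl fun j _ => ?_
  rw [← smul_neg, neg_sub]
  rfl

theorem alternatize_alternatize_apply (f : E →L[ℝ] E →L[ℝ] E [⋀^Fin k]→L[ℝ] F) (v : Fin (k + 2) → E) :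
    alternatizeUncurryFin (alternatizeUncurryFinCLM ℝ E F ∘L f) v =
      ∑ i : Fin (k + 2), (-1 : ℤ) ^ (i : ℕ) • ∑ j : Fin (k + 1), (-1 : ℤ) ^ (j : ℕ) •
        f (v i) (i.removeNth v j) (j.removeNth (i.removeNth v)) := by
  rw [alternatizeUncurryFin_apply]
  refine Finset.sum_congr rfl fun i _ => ?_
  rw [ContinuousLinearMap.comp_apply, alternatizeUncurryFinCLM_apply, alternatizeUncurryFin_apply]

/-- Double alternatisation sees only the antisymmetric part of B. With B the derivative of a
potential α, this identifies J ∧ φ with a multiple of the term dα ∧ φ in the derivative of α ∧ φ. -/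
theorem wedge_eq_alternatize {J : E [⋀^Fin 2]→L[ℝ] ℝ} {B : E →L[ℝ] E →L[ℝ] ℝ}
    (hJ : ∀ a b, B a b - B b a = 2 * J ![a, b]) (φ : E [⋀^Fin k]→L[ℝ] F) :
    wedge J φ = (((k : ℝ) + 2) * ((k : ℝ) + 1))⁻¹ •
      alternatizeUncurryFin (alternatizeUncurryFinCLM ℝ E F ∘L formSmul B φ) := by
  have h1 : alternatizeUncurryFin (alternatizeUncurryFinCLM ℝ E F ∘L formSmul B φ) =
      (2⁻¹ : ℝ) • (alternatizeUncurryFin (alternatizeUncurryFinCLM ℝ E F ∘L formSmul B φ) -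
        alternatizeUncurryFin (alternatizeUncurryFinCLM ℝ E F ∘L (formSmul B φ).flip)) := by
    rw [alternatize_alternatize_flip, sub_neg_eq_add, ← two_smul ℝ, smul_smul]
    norm_num
  rw [h1]
  ext v
  rw [wedge_apply, ContinuousAlternatingMap.smul_apply, ContinuousAlternatingMap.smul_apply,
    ContinuousAlternatingMap.sub_apply, alternatize_alternatize_apply, alternatize_alternatize_apply,
    ← Finset.sum_sub_distrib, Finset.smul_sum (r := (2⁻¹ : ℝ))]
  congr 1
  refine Finset.sum_congr rfl fun i _ => ?_
  rw [← smul_sub, ← Finset.sum_sub_distrib, smul_comm (2⁻¹ : ℝ), Finset.smul_sum (r := (2⁻¹ : ℝ))]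
  congr 1
  refine Finset.sum_congr rfl fun j _ => ?_
  rw [← smul_sub, smul_comm (2⁻¹ : ℝ)]
  congr 1
  rw [ContinuousLinearMap.flip_apply, formSmul_apply, formSmul_apply,
    ContinuousAlternatingMap.smul_apply, ContinuousAlternatingMap.smul_apply, ← sub_smul, hJ,
    smul_smul, inv_mul_cancel_left₀ two_ne_zero]

/-- The double alternatisation of the symmetric tensor α ⊗ α vanishes. -/
theorem oneWedge_oneWedge (α : E →L[ℝ] ℝ) (φ : E [⋀^Fin k]→L[ℝ] F) :
    oneWedge α (oneWedge α φ) = 0 := by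
  have h : α.smulRight (oneWedge α φ) = alternatizeUncurryFinCLM ℝ E F ∘L
      formSmul (α.smulRight α) φ := by
    ext1 a
    rw [ContinuousLinearMap.comp_apply, alternatizeUncurryFinCLM_apply,
      ContinuousLinearMap.smulRight_apply, oneWedge, ← alternatizeUncurryFin_smul]
    congr 1
    ext1 b
    simp [formSmul_apply, smul_smul]
  rw [oneWedge, h]
  refine alternatizeUncurryFin_alternatizeUncurryFinCLM_comp_of_symmetric fun a b => ?_
  simp [formSmul_apply, mul_comm]

theorem oneWedge_eq_of_isEmpty (α : E →L[ℝ] ℝ) (φ : E [⋀^Fin 0]→L[ℝ] F) (v : Fin 1 → E) :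
    oneWedge α φ v = α (v 0) • φ ![] := by
  rw [oneWedge, alternatizeUncurryFin_apply, Fin.sum_univ_one]
  simp [Subsingleton.elim (Fin.removeNth 0 v) ![]]

theorem oneWedge_add (α : E →L[ℝ] ℝ) (φ ψ : E [⋀^Fin k]→L[ℝ] F) :
    oneWedge α (φ + ψ) = oneWedge α φ + oneWedge α ψ := by
  ext v
  simp [oneWedge, alternatizeUncurryFin_apply, Finset.sum_add_distrib]

theorem oneWedge_smul (α : E →L[ℝ] ℝ) (c : ℝ) (φ : E [⋀^Fin k]→L[ℝ] F) :
    oneWedge α (c • φ) = c • oneWedge α φ := by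
  ext v
  simp [oneWedge, alternatizeUncurryFin_apply, Finset.smul_sum, smul_comm c]

theorem comp_oneWedge {G : Type*} [NormedAddCommGroup G] [NormedSpace ℝ G] (T : F →L[ℝ] G)
    (α : E →L[ℝ] ℝ) (φ : E [⋀^Fin k]→L[ℝ] F) :
    T.compContinuousAlternatingMap (oneWedge α φ) =
      oneWedge α (T.compContinuousAlternatingMap φ) := by
  ext v
  simp [oneWedge, alternatizeUncurryFin_apply]

/-- Exactness of the Koszul complex of a non-zero covector. -/
theorem exists_eq_oneWedge {ξ : E →L[ℝ] ℝ} (hξ : ξ ≠ 0) {φ : E [⋀^Fin (k + 1)]→L[ℝ] F}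
    (h : oneWedge ξ φ = 0) : ∃ ψ, φ = oneWedge ξ ψ := by
  obtain ⟨u, hu⟩ : ∃ u, ξ u ≠ 0 := by
    by_contra! h
    exact hξ (by ext u; simpa using h u)
  obtain ⟨v, hv⟩ : ∃ v, ξ v = 1 := ⟨(ξ u)⁻¹ • u, by simp [hu]⟩
  -- Insertion of a vector v with ξ(v) = 1 is a contracting homotopy: ι_v(ξ ∧ φ) = φ − ξ ∧ ι_v φ.
  refine ⟨φ.curryLeft v, ?_⟩
  have h1 := curryLeft_alternatizeUncurryFin (ξ.smulRight φ) v
  rw [← oneWedge, h, ContinuousLinearMap.smulRight_apply, hv, one_smul] at h1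
  have h2 : (0 : E [⋀^Fin (k + 2)]→L[ℝ] F).curryLeft v = 0 := rfl
  rw [h2, eq_comm, sub_eq_zero] at h1
  exact h1

theorem eq_zero_of_oneWedge_eq_zero {ξ : E →L[ℝ] ℝ} (hξ : ξ ≠ 0) {φ : E [⋀^Fin 0]→L[ℝ] F}
    (h : oneWedge ξ φ = 0) : φ = 0 := by
  obtain ⟨u, hu⟩ : ∃ u, ξ u ≠ 0 := by
    by_contra! h
    exact hξ (by ext u; simpa using h u)
  have h1 : oneWedge ξ φ ![u] = 0 := by rw [h]; rfl
  rw [oneWedge_eq_of_isEmpty] at h1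
  ext v
  rw [Subsingleton.elim v ![]]
  simpa [hu] using h1

theorem hasFDerivAt_smulRight {X Y : Type*} [NormedAddCommGroup X] [NormedSpace ℝ X]
    [NormedAddCommGroup Y] [NormedSpace ℝ Y] (Λ : (E →L[ℝ] X) →L[ℝ] Y) {α : E → E →L[ℝ] ℝ}
    {η : E → X} {y : E} (hα : DifferentiableAt ℝ α y) (hη : DifferentiableAt ℝ η y) :
    HasFDerivAt (fun x => Λ ((α x).smulRight (η x)))
      (Λ ∘L ((ContinuousLinearMap.smulRightL ℝ E X (α y)).comp (fderiv ℝ η y) +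
        ((ContinuousLinearMap.smulRightL ℝ E X).flip (η y)).comp (fderiv ℝ α y))) y :=
  Λ.hasFDerivAt.comp y
    ((ContinuousLinearMap.smulRightL ℝ E X).hasFDerivAt_of_bilinear hα.hasFDerivAt hη.hasFDerivAt)

theorem contDiffAt_clm_smulRight {X Y : Type*} [NormedAddCommGroup X] [NormedSpace ℝ X]
    [NormedAddCommGroup Y] [NormedSpace ℝ Y] (Λ : (E →L[ℝ] X) →L[ℝ] Y) {α : E → E →L[ℝ] ℝ}
    {η : E → X} {y : E} (hα : ContDiffAt ℝ ∞ α y) (hη : ContDiffAt ℝ ∞ η y) :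
    ContDiffAt ℝ ∞ (fun x => Λ ((α x).smulRight (η x))) y :=
  Λ.contDiff.contDiffAt.comp y (hα.smulRight hη)

theorem contDiffAt_oneWedge {α : E → E →L[ℝ] ℝ} {η : E → E [⋀^Fin k]→L[ℝ] F} {y : E}
    (hα : ContDiffAt ℝ ∞ α y) (hη : ContDiffAt ℝ ∞ η y) :
    ContDiffAt ℝ ∞ (fun x => oneWedge (α x) (η x)) y :=
  contDiffAt_clm_smulRight (alternatizeUncurryFinCLM ℝ E F) hα hη

/-- The Leibniz rule d(α ∧ η) = dα ∧ η − α ∧ dη, in unnormalised products; the first term is left as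
a double alternatisation so that it can be matched with `wedge`. -/
theorem extDeriv_oneWedge {α : E → E →L[ℝ] ℝ} {η : E → E [⋀^Fin k]→L[ℝ] F} {y : E}
    (hα : DifferentiableAt ℝ α y) (hη : DifferentiableAt ℝ η y) :
    extDeriv (fun x => oneWedge (α x) (η x)) y =
      alternatizeUncurryFin (alternatizeUncurryFinCLM ℝ E F ∘L formSmul (fderiv ℝ α y) (η y)) -
        oneWedge (α y) (extDeriv η y) := by
  have h := hasFDerivAt_smulRight (alternatizeUncurryFinCLM ℝ E F (n := k)) hα hη
  have h1 : fderiv ℝ (fun x => oneWedge (α x) (η x)) y = _ := h.fderiv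
  rw [extDeriv, h1, ContinuousLinearMap.comp_add, alternatizeUncurryFin_add,
    sub_eq_neg_add]
  congr 1
  let f : E →L[ℝ] E →L[ℝ] E [⋀^Fin k]→L[ℝ] F :=
    (ContinuousLinearMap.smulRightL ℝ E (E [⋀^Fin k]→L[ℝ] F) (α y)).comp (fderiv ℝ η y)
  -- In α ∧ dη the slot of α is alternated last, in the derivative of α ∧ η the slot of
  -- differentiation is. Exchanging the two gives the minus sign.
  have h2 : (α y).smulRight (extDeriv η y) = alternatizeUncurryFinCLM ℝ E F ∘L f.flip := by
    ext1 a
    rw [ContinuousLinearMap.comp_apply, alternatizeUncurryFinCLM_apply,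
      ContinuousLinearMap.smulRight_apply, extDeriv, ← alternatizeUncurryFin_smul]
    rfl
  rw [oneWedge, h2, alternatize_alternatize_flip, neg_neg]

end OneForms

/-! ### The model complex -/

section Model

open Filter ContinuousAlternatingMap

universe u₁

/-- The fibres of the model complex. -/
def MTerm (E : Type) (F : Type u₁) [NormedAddCommGroup E] [NormedSpace ℝ E]
    [NormedAddCommGroup F] [NormedSpace ℝ F] : ℕ → Type u₁
  | 0 => F
  | k + 1 => (E [⋀^Fin (k + 1)]→L[ℝ] F) × (E [⋀^Fin k]→L[ℝ] F)

variable {E : Type} {F : Type u₁} [NormedAddCommGroup E] [NormedSpace ℝ E]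
  [NormedAddCommGroup F] [NormedSpace ℝ F]

instance : ∀ k, NormedAddCommGroup (MTerm E F k)
  | 0 => inferInstanceAs (NormedAddCommGroup F)
  | k + 1 => inferInstanceAs
      (NormedAddCommGroup ((E [⋀^Fin (k + 1)]→L[ℝ] F) × (E [⋀^Fin k]→L[ℝ] F)))

instance : ∀ k, NormedSpace ℝ (MTerm E F k)
  | 0 => inferInstanceAs (NormedSpace ℝ F)
  | k + 1 => inferInstanceAs
      (NormedSpace ℝ ((E [⋀^Fin (k + 1)]→L[ℝ] F) × (E [⋀^Fin k]→L[ℝ] F)))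

/-- The leading part of the model operators, as a function of the derivative. -/
def modelSymbol : ∀ k, (E →L[ℝ] MTerm E F k) →L[ℝ] MTerm E F (k + 1)
  | 0 => ((ofSubsingletonLIE (𝕜 := ℝ) (E := E) (F := F) (0 : Fin 1)).toContinuousLinearEquiv
      : (E →L[ℝ] F) →L[ℝ] E [⋀^Fin 1]→L[ℝ] F).prod 0
  | k + 1 =>
    (((k : ℝ) + 2)⁻¹ • (alternatizeUncurryFinCLM ℝ E F (n := k + 1)).comp
      ((ContinuousLinearMap.fst ℝ (E [⋀^Fin (k + 1)]→L[ℝ] F) (E [⋀^Fin k]→L[ℝ] F)).postcomp E)).prod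
    (((k : ℝ) + 1)⁻¹ • (alternatizeUncurryFinCLM ℝ E F (n := k)).comp
      ((ContinuousLinearMap.snd ℝ (E [⋀^Fin (k + 1)]→L[ℝ] F) (E [⋀^Fin k]→L[ℝ] F)).postcomp E))

/-- The part of order zero of the model operators. -/
def modelPotential (T : F →L[ℝ] F) : ∀ k, MTerm E F k →L[ℝ] MTerm E F (k + 1)
  | 0 => (0 : F →L[ℝ] E [⋀^Fin 1]→L[ℝ] F).prod
      (((constOfIsEmptyLIE ℝ E F (Fin 0)).toContinuousLinearEquiv
      : F →L[ℝ] E [⋀^Fin 0]→L[ℝ] F).comp T)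
  | k + 1 => (0 : (E [⋀^Fin (k + 1)]→L[ℝ] F) × (E [⋀^Fin k]→L[ℝ] F) →L[ℝ] (E [⋀^Fin (k + 2)]→L[ℝ] F)).prod
      ((-1 : ℝ) ^ (k + 1) • (ContinuousLinearMap.compContinuousAlternatingMapCLM ℝ E F F (Fin (k + 1)) T).comp
        (ContinuousLinearMap.fst ℝ (E [⋀^Fin (k + 1)]→L[ℝ] F) (E [⋀^Fin k]→L[ℝ] F)))

/-- The model operators. -/
def modelD (T : F →L[ℝ] F) (k : ℕ) (f : E → MTerm E F k) (y : E) : MTerm E F (k + 1) :=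
  modelSymbol k (fderiv ℝ f y) + modelPotential T k (f y)

/-- The first component. -/
def mfst (k : ℕ) : MTerm E F (k + 1) →L[ℝ] E [⋀^Fin (k + 1)]→L[ℝ] F :=
  ContinuousLinearMap.fst ℝ (E [⋀^Fin (k + 1)]→L[ℝ] F) (E [⋀^Fin k]→L[ℝ] F)

/-- The second component. -/
def msnd (k : ℕ) : MTerm E F (k + 1) →L[ℝ] E [⋀^Fin k]→L[ℝ] F :=
  ContinuousLinearMap.snd ℝ (E [⋀^Fin (k + 1)]→L[ℝ] F) (E [⋀^Fin k]→L[ℝ] F)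

/-- A pair of forms. -/
def mpair {k : ℕ} (φ : E [⋀^Fin (k + 1)]→L[ℝ] F) (η : E [⋀^Fin k]→L[ℝ] F) : MTerm E F (k + 1) :=
  (φ, η)

variable {k : ℕ}

theorem mfst_mpair (φ : E [⋀^Fin (k + 1)]→L[ℝ] F) (η : E [⋀^Fin k]→L[ℝ] F) :
    mfst k (mpair φ η) = φ := rfl

theorem msnd_mpair (φ : E [⋀^Fin (k + 1)]→L[ℝ] F) (η : E [⋀^Fin k]→L[ℝ] F) :
    msnd k (mpair φ η) = η := rfl

theorem mterm_ext {u v : MTerm E F (k + 1)} (h1 : mfst k u = mfst k v) (h2 : msnd k u = msnd k v) :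
    u = v := Prod.ext h1 h2

theorem fderiv_clm_comp {X Y : Type*} [NormedAddCommGroup X] [NormedSpace ℝ X]
    [NormedAddCommGroup Y] [NormedSpace ℝ Y] (Λ : X →L[ℝ] Y) {f : E → X} {y : E}
    (hf : DifferentiableAt ℝ f y) : fderiv ℝ (fun x => Λ (f x)) y = Λ.comp (fderiv ℝ f y) :=
  (Λ.hasFDerivAt.comp y hf.hasFDerivAt).fderiv

theorem contDiffAt_clm_comp {X Y : Type*} [NormedAddCommGroup X] [NormedSpace ℝ X]
    [NormedAddCommGroup Y] [NormedSpace ℝ Y] (Λ : X →L[ℝ] Y) {f : E → X} {y : E} {n : ℕ∞ω}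
    (hf : ContDiffAt ℝ n f y) : ContDiffAt ℝ n (fun x => Λ (f x)) y :=
  Λ.contDiff.contDiffAt.comp y hf

theorem contDiffAt_mterm_iff {f : E → MTerm E F (k + 1)} {y : E} : ContDiffAt ℝ ∞ f y ↔
    ContDiffAt ℝ ∞ (fun x => mfst k (f x)) y ∧ ContDiffAt ℝ ∞ (fun x => msnd k (f x)) y :=
  ⟨fun h => ⟨contDiffAt_clm_comp (mfst k) h, contDiffAt_clm_comp (msnd k) h⟩,
    fun h => h.1.prodMk h.2⟩

theorem msnd_modelSymbol_zero (L : E →L[ℝ] MTerm E F 0) :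
    msnd 0 (modelSymbol 0 L) = 0 := rfl

theorem mfst_modelSymbol_succ (L : E →L[ℝ] MTerm E F (k + 1)) :
    mfst (k + 1) (modelSymbol (k + 1) L) =
      ((k : ℝ) + 2)⁻¹ • alternatizeUncurryFin ((mfst k).comp L) := rfl

theorem msnd_modelSymbol_succ (L : E →L[ℝ] MTerm E F (k + 1)) :
    msnd (k + 1) (modelSymbol (k + 1) L) =
      ((k : ℝ) + 1)⁻¹ • alternatizeUncurryFin ((msnd k).comp L) := rfl

theorem mfst_modelD_zero (T : F →L[ℝ] F) (f : E → F) (y : E) :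
    mfst 0 (modelD T 0 f y) = ofSubsingleton ℝ E F (0 : Fin 1) (fderiv ℝ f y) :=
  add_zero _

theorem msnd_modelD_zero (T : F →L[ℝ] F) (f : E → F) (y : E) :
    msnd 0 (modelD T 0 f y) = constOfIsEmpty ℝ E (Fin 0) (T (f y)) :=
  zero_add _

theorem mfst_modelD_succ (T : F →L[ℝ] F) {f : E → MTerm E F (k + 1)} {y : E}
    (hf : DifferentiableAt ℝ f y) :
    mfst (k + 1) (modelD T (k + 1) f y) =
      ((k : ℝ) + 2)⁻¹ • extDeriv (fun x => mfst k (f x)) y := by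
  have h : fderiv ℝ (fun x => mfst k (f x)) y = (mfst k).comp (fderiv ℝ f y) :=
    fderiv_clm_comp (mfst k) hf
  rw [extDeriv, h]
  exact add_zero _

theorem msnd_modelD_succ (T : F →L[ℝ] F) {f : E → MTerm E F (k + 1)} {y : E}
    (hf : DifferentiableAt ℝ f y) :
    msnd (k + 1) (modelD T (k + 1) f y) =
      ((k : ℝ) + 1)⁻¹ • extDeriv (fun x => msnd k (f x)) y +
      (-1 : ℝ) ^ (k + 1) • T.compContinuousAlternatingMap (mfst k (f y)) := by
  have h : fderiv ℝ (fun x => msnd k (f x)) y = (msnd k).comp (fderiv ℝ f y) :=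
    fderiv_clm_comp (msnd k) hf
  rw [extDeriv, h]
  rfl

theorem contDiffAt_modelD {T : F →L[ℝ] F} {f : E → MTerm E F k} {y : E}
    (hf : ContDiffAt ℝ ∞ f y) : ContDiffAt ℝ ∞ (modelD T k f) y :=
  ((modelSymbol k).contDiff.contDiffAt.comp y (hf.fderiv_right (by simp))).add
    ((modelPotential T k).contDiff.contDiffAt.comp y hf)

theorem modelD_congr {T : F →L[ℝ] F} {f g : E → MTerm E F k} {y : E} (h : f =ᶠ[𝓝 y] g) :
    modelD T k f y = modelD T k g y := by
  rw [modelD, modelD, h.fderiv_eq, h.eq_of_nhds]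

theorem modelD_add {T : F →L[ℝ] F} {f g : E → MTerm E F k} {y : E}
    (hf : DifferentiableAt ℝ f y) (hg : DifferentiableAt ℝ g y) :
    modelD T k (fun x => f x + g x) y = modelD T k f y + modelD T k g y := by
  rw [modelD, modelD, modelD, fderiv_fun_add hf hg, map_add, map_add]
  abel

theorem modelD_smul {T : F →L[ℝ] F} {u : E → ℝ} {f : E → MTerm E F k} {y : E}
    (hu : DifferentiableAt ℝ u y) (hf : DifferentiableAt ℝ f y) :
    modelD T k (fun x => u x • f x) y =
      u y • modelD T k f y + modelSymbol k ((fderiv ℝ u y).smulRight (f y)) := by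
  rw [modelD, modelD, fderiv_fun_smul hu hf, map_add, map_smul, map_smul, smul_add]
  abel

theorem alternatize_comp (T : F →L[ℝ] F) (f : E →L[ℝ] E [⋀^Fin k]→L[ℝ] F) :
    alternatizeUncurryFin
      ((ContinuousLinearMap.compContinuousAlternatingMapCLM ℝ E F F (Fin k) T).comp f) =
      T.compContinuousAlternatingMap (alternatizeUncurryFin f) := by
  ext v
  rw [alternatizeUncurryFin_apply, ContinuousLinearMap.compContinuousAlternatingMap_coe,
    Function.comp_apply, alternatizeUncurryFin_apply, _root_.map_sum]
  refine Finset.sum_congr rfl fun i _ => ?_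
  rw [map_zsmul]
  rfl

theorem extDeriv_comp (T : F →L[ℝ] F) {φ : E → E [⋀^Fin k]→L[ℝ] F} {y : E}
    (hφ : DifferentiableAt ℝ φ y) :
    extDeriv (fun x => T.compContinuousAlternatingMap (φ x)) y =
      T.compContinuousAlternatingMap (extDeriv φ y) := by
  have h : fderiv ℝ (fun x => T.compContinuousAlternatingMap (φ x)) y =
      (ContinuousLinearMap.compContinuousAlternatingMapCLM ℝ E F F (Fin k) T).comp
        (fderiv ℝ φ y) :=
    ((ContinuousLinearMap.compContinuousAlternatingMapCLM ℝ E F F (Fin k) T).hasFDerivAt.comp y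
      hφ.hasFDerivAt).fderiv
  rw [extDeriv, h, alternatize_comp]
  rfl

theorem contDiffAt_comp (T : F →L[ℝ] F) {φ : E → E [⋀^Fin k]→L[ℝ] F} {y : E}
    (hφ : ContDiffAt ℝ ∞ φ y) : ContDiffAt ℝ ∞ (fun x => T.compContinuousAlternatingMap (φ x)) y :=
  (ContinuousLinearMap.compContinuousAlternatingMapCLM ℝ E F F (Fin k) T).contDiff.contDiffAt.comp
    y hφ

theorem contDiffAt_clm_fderiv {X Y : Type*} [NormedAddCommGroup X] [NormedSpace ℝ X]
    [NormedAddCommGroup Y] [NormedSpace ℝ Y] (Λ : (E →L[ℝ] X) →L[ℝ] Y) {f : E → X} {y : E}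
    (hf : ContDiffAt ℝ ∞ f y) : ContDiffAt ℝ ∞ (fun x => Λ (fderiv ℝ f x)) y :=
  Λ.contDiff.contDiffAt.comp y (hf.fderiv_right (by simp))

theorem contDiffAt_extDeriv {φ : E → E [⋀^Fin k]→L[ℝ] F} {y : E}
    (hφ : ContDiffAt ℝ ∞ φ y) : ContDiffAt ℝ ∞ (extDeriv φ) y :=
  contDiffAt_clm_fderiv (alternatizeUncurryFinCLM ℝ E F) hφ

theorem extDeriv_extDeriv_eq_zero {φ : E → E [⋀^Fin k]→L[ℝ] F} {y : E}
    (hφ : ContDiffAt ℝ ∞ φ y) : extDeriv (extDeriv φ) y = 0 :=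
  extDeriv_extDeriv_apply hφ (by simpa using two_le_infty)

theorem modelD_modelD_zero (T : F →L[ℝ] F) {f : E → F} {y : E}
    (hf : ContDiffAt ℝ ∞ f y) : modelD T 1 (modelD T 0 f) y = 0 := by
  have h1 : DifferentiableAt ℝ (modelD T 0 f) y :=
    (contDiffAt_modelD (k := 0) hf).differentiableAt (by simp)
  have hf0 : ContDiffAt ℝ ∞ (fun x => constOfIsEmpty ℝ E (Fin 0) (f x)) y :=
    (constOfIsEmptyLIE ℝ E F (Fin 0)).toContinuousLinearEquiv.contDiff.contDiffAt.comp y hf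
  have e1 : (fun x => mfst 0 (modelD T 0 f x)) =
      extDeriv (fun x => constOfIsEmpty ℝ E (Fin 0) (f x)) := by
    funext x
    rw [mfst_modelD_zero, extDeriv_constOfIsEmpty]
  have e2 : (fun x => msnd 0 (modelD T 0 f x)) = fun x =>
      T.compContinuousAlternatingMap (constOfIsEmpty ℝ E (Fin 0) (f x)) := by
    funext x
    rw [msnd_modelD_zero]
    rfl
  refine mterm_ext ?_ ?_
  · rw [mfst_modelD_succ T h1, e1, extDeriv_extDeriv_eq_zero hf0, smul_zero, _root_.map_zero]
  · rw [msnd_modelD_succ T h1, e2, extDeriv_comp T (hf0.differentiableAt (by simp)),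
      show mfst 0 (modelD T 0 f y) = _ from congrFun e1 y, _root_.map_zero]
    norm_num

/-- Besides d² = 0, the constant endomorphism T commutes with d, and the two mixed terms carry the
same factor 1/(k+2) with opposite signs. -/
theorem modelD_modelD_succ (T : F →L[ℝ] F) {f : E → MTerm E F (k + 1)} {y : E}
    (hf : ∀ᶠ x in 𝓝 y, ContDiffAt ℝ ∞ f x) :
    modelD T (k + 2) (modelD T (k + 1) f) y = 0 := by
  have h1 : DifferentiableAt ℝ (modelD T (k + 1) f) y :=
    (contDiffAt_modelD hf.self_of_nhds).differentiableAt (by simp)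
  obtain ⟨f1, f2⟩ := contDiffAt_mterm_iff.1 hf.self_of_nhds
  have e1 : (fun x => mfst (k + 1) (modelD T (k + 1) f x)) =ᶠ[𝓝 y]
      ((k : ℝ) + 2)⁻¹ • extDeriv (fun x => mfst k (f x)) := by
    filter_upwards [hf] with x hx using mfst_modelD_succ T (hx.differentiableAt (by simp))
  have e2 : (fun x => msnd (k + 1) (modelD T (k + 1) f x)) =ᶠ[𝓝 y]
      ((k : ℝ) + 1)⁻¹ • extDeriv (fun x => msnd k (f x)) +
        (-1 : ℝ) ^ (k + 1) • fun x => T.compContinuousAlternatingMap (mfst k (f x)) := by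
    filter_upwards [hf] with x hx using msnd_modelD_succ T (hx.differentiableAt (by simp))
  refine mterm_ext ?_ ?_
  · rw [mfst_modelD_succ T h1, e1.extDeriv_eq, extDeriv_smul, extDeriv_extDeriv_eq_zero f1,
      smul_zero, smul_zero, _root_.map_zero]
  · have d1 : DifferentiableAt ℝ (((k : ℝ) + 1)⁻¹ • extDeriv (fun x => msnd k (f x))) y :=
      ((contDiffAt_extDeriv f2).differentiableAt (by simp)).const_smul _
    have d2 : DifferentiableAt ℝ ((-1 : ℝ) ^ (k + 1) • fun x =>
        T.compContinuousAlternatingMap (mfst k (f x))) y :=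
      ((contDiffAt_comp T f1).differentiableAt (by simp)).const_smul _
    have e3 : T.compContinuousAlternatingMap
        (((k : ℝ) + 2)⁻¹ • extDeriv (fun x => mfst k (f x)) y) =
        ((k : ℝ) + 2)⁻¹ • T.compContinuousAlternatingMap (extDeriv (fun x => mfst k (f x)) y) := by
      ext v
      simp
    rw [msnd_modelD_succ T h1, e2.extDeriv_eq, extDeriv_add d1 d2, extDeriv_smul, extDeriv_smul,
      extDeriv_extDeriv_eq_zero f2, smul_zero, zero_add,
      extDeriv_comp T (f1.differentiableAt (by simp)),
      show mfst (k + 1) (modelD T (k + 1) f y) = _ from e1.eq_of_nhds, Pi.smul_apply, e3, smul_smul,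
      smul_smul, ← add_smul, _root_.map_zero]
    convert zero_smul ℝ _ using 2
    push_cast
    ring

theorem modelD_modelD (T : F →L[ℝ] F) {f : E → MTerm E F k} {y : E}
    (hf : ∀ᶠ x in 𝓝 y, ContDiffAt ℝ ∞ f x) : modelD T (k + 1) (modelD T k f) y = 0 := by
  cases k with
  | zero => exact modelD_modelD_zero T hf.self_of_nhds
  | succ k => exact modelD_modelD_succ T hf

/-- Sections in degree zero as forms. -/
def mbase : MTerm E F 0 →L[ℝ] E [⋀^Fin 0]→L[ℝ] F :=
  ((constOfIsEmptyLIE ℝ E F (Fin 0)).toContinuousLinearEquiv : F →L[ℝ] E [⋀^Fin 0]→L[ℝ] F)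

theorem mfst_modelSymbol_smulRight_zero (ξ : E →L[ℝ] ℝ) (u : MTerm E F 0) :
    mfst 0 (modelSymbol 0 (ξ.smulRight u)) = oneWedge ξ (mbase u) := by
  ext v
  exact (oneWedge_eq_of_isEmpty (F := F) ξ (mbase u) v).symm

theorem mfst_modelSymbol_smulRight (ξ : E →L[ℝ] ℝ) (u : MTerm E F (k + 1)) :
    mfst (k + 1) (modelSymbol (k + 1) (ξ.smulRight u)) =
      ((k : ℝ) + 2)⁻¹ • oneWedge ξ (mfst k u) := by
  rw [mfst_modelSymbol_succ, oneWedge, show (mfst k).comp (ξ.smulRight u) = ξ.smulRight (mfst k u)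
    from ContinuousLinearMap.ext fun v => (mfst k).map_smul (ξ v) u]

theorem msnd_modelSymbol_smulRight (ξ : E →L[ℝ] ℝ) (u : MTerm E F (k + 1)) :
    msnd (k + 1) (modelSymbol (k + 1) (ξ.smulRight u)) =
      ((k : ℝ) + 1)⁻¹ • oneWedge ξ (msnd k u) := by
  rw [msnd_modelSymbol_succ, oneWedge, show (msnd k).comp (ξ.smulRight u) = ξ.smulRight (msnd k u)
    from ContinuousLinearMap.ext fun v => (msnd k).map_smul (ξ v) u]

theorem oneWedge_zero (ξ : E →L[ℝ] ℝ) : oneWedge ξ (0 : E [⋀^Fin k]→L[ℝ] F) = 0 := by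
  simpa using oneWedge_smul ξ 0 (0 : E [⋀^Fin k]→L[ℝ] F)

/-- The symbol ignores the term in T, so it acts on each component as a positive multiple of the
product with ξ. -/
theorem modelSymbol_comp (ξ : E →L[ℝ] ℝ) (u : MTerm E F k) :
    modelSymbol (k + 1) (ξ.smulRight (modelSymbol k (ξ.smulRight u))) = 0 := by
  refine mterm_ext ?_ ?_
  · rw [mfst_modelSymbol_smulRight, _root_.map_zero]
    cases k with
    | zero => rw [mfst_modelSymbol_smulRight_zero, oneWedge_oneWedge, smul_zero]
    | succ k => rw [mfst_modelSymbol_smulRight, oneWedge_smul, oneWedge_oneWedge, smul_zero,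
        smul_zero]
  · rw [msnd_modelSymbol_smulRight, _root_.map_zero]
    cases k with
    | zero => rw [msnd_modelSymbol_zero, oneWedge_zero, smul_zero]
    | succ k => rw [msnd_modelSymbol_smulRight, oneWedge_smul, oneWedge_oneWedge, smul_zero,
        smul_zero]

theorem modelSymbol_injective {ξ : E →L[ℝ] ℝ} (hξ : ξ ≠ 0) {u : MTerm E F 0}
    (hu : modelSymbol 0 (ξ.smulRight u) = 0) : u = 0 := by
  have h := mfst_modelSymbol_smulRight_zero ξ u
  rw [hu, _root_.map_zero] at h
  have h1 := eq_zero_of_oneWedge_eq_zero hξ h.symm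
  exact congrArg (fun φ : E [⋀^Fin 0]→L[ℝ] F => φ ![]) h1

/-- Koszul exactness is applied to each component; the primitives are rescaled to undo the factors
1/(k+2) and 1/(k+1). -/
theorem modelSymbol_exact {ξ : E →L[ℝ] ℝ} (hξ : ξ ≠ 0) {u : MTerm E F (k + 1)}
    (hu : modelSymbol (k + 1) (ξ.smulRight u) = 0) :
    ∃ v : MTerm E F k, modelSymbol k (ξ.smulRight v) = u := by
  have h1 := mfst_modelSymbol_smulRight ξ u
  have h2 := msnd_modelSymbol_smulRight ξ u
  have hk : ((k : ℝ) + 2)⁻¹ ≠ 0 := by positivity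
  have hk' : ((k : ℝ) + 1)⁻¹ ≠ 0 := by positivity
  rw [hu, _root_.map_zero, eq_comm, smul_eq_zero_iff_right hk] at h1
  rw [hu, _root_.map_zero, eq_comm, smul_eq_zero_iff_right hk'] at h2
  obtain ⟨φ, hφ⟩ := exists_eq_oneWedge hξ h1
  cases k with
  -- In degree one the second component is a 0-form. The Koszul complex of the second summand starts
  -- here, so injectivity takes the place of exactness.
  | zero =>
    obtain ⟨w, hw⟩ : ∃ w : MTerm E F 0, mbase w = φ := by
      refine ⟨(φ ![] : F), ?_⟩
      ext v
      rw [Subsingleton.elim v ![]]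
      rfl
    refine ⟨w, mterm_ext ?_ ?_⟩
    · rw [mfst_modelSymbol_smulRight_zero, hφ, hw]
    · rw [msnd_modelSymbol_zero, eq_zero_of_oneWedge_eq_zero hξ h2]
  | succ k =>
    obtain ⟨η, hη⟩ := exists_eq_oneWedge hξ h2
    refine ⟨mpair (((k : ℝ) + 2) • φ) (((k : ℝ) + 1) • η), mterm_ext ?_ ?_⟩
    · rw [mfst_modelSymbol_smulRight, mfst_mpair, oneWedge_smul, smul_smul, hφ,
        inv_mul_cancel₀ (by positivity), one_smul]
    · rw [msnd_modelSymbol_smulRight, msnd_mpair, oneWedge_smul, smul_smul, hη,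
        inv_mul_cancel₀ (by positivity), one_smul]

/-! ### Local cohomology of the model complex -/

section Exactness

/-- These constant cocycles represent the cohomology in degree one. -/
theorem modelD_one_const (T : F →L[ℝ] F) (c : F) (y : E) :
    modelD T 1 (fun _ => mpair 0 (constOfIsEmpty ℝ E (Fin 0) c)) y = 0 := by
  have h : DifferentiableAt ℝ
    (fun _ : E => (mpair 0 (constOfIsEmpty ℝ E (Fin 0) c) : MTerm E F 1)) y :=
    differentiableAt_const _
  have h0 : ∀ (m : ℕ) (φ : E [⋀^Fin m]→L[ℝ] F), extDeriv (fun _ : E => φ) y = 0 := fun m φ => by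
    rw [extDeriv, fderiv_fun_const, Pi.zero_apply]
    exact (alternatizeUncurryFinCLM ℝ E F).map_zero
  refine mterm_ext ?_ ?_
  · rw [mfst_modelD_succ T h]
    simp only [mfst_mpair, h0, smul_zero, _root_.map_zero]
  · rw [msnd_modelD_succ T h]
    simp only [mfst_mpair, msnd_mpair, h0, smul_zero, _root_.map_zero, zero_add]
    ext v
    simp

variable [FiniteDimensional ℝ E] [CompleteSpace F]

/-- The usual argument for a mapping cone. The first component is closed, hence dβ. The closedness
of the pair says that the second component, corrected by a multiple of Tβ, is closed. It has
positive degree here, so the Poincaré lemma applies a second time. -/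
theorem modelD_exact (T : F →L[ℝ] F) {f : E → MTerm E F (k + 2)} {z : E}
    (hf : ∀ᶠ y in 𝓝 z, ContDiffAt ℝ ∞ f y) (h0 : ∀ᶠ y in 𝓝 z, modelD T (k + 2) f y = 0) :
    ∃ g : E → MTerm E F (k + 1), ContDiff ℝ ∞ g ∧ ∀ᶠ y in 𝓝 z, modelD T (k + 1) g y = f y := by
  have hk : (((k + 1 : ℕ) : ℝ) + 2)⁻¹ ≠ 0 := by positivity
  have hk2 : ((k : ℝ) + 2) ≠ 0 := by positivity
  have hk1 : ((k : ℝ) + 1) ≠ 0 := by positivity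
  have hf1 : ∀ᶠ y in 𝓝 z, ContDiffAt ℝ ∞ (fun x => mfst (k + 1) (f x)) y := by
    filter_upwards [hf] with y hy using (contDiffAt_mterm_iff.1 hy).1
  have hf2 : ∀ᶠ y in 𝓝 z, ContDiffAt ℝ ∞ (fun x => msnd (k + 1) (f x)) y := by
    filter_upwards [hf] with y hy using (contDiffAt_mterm_iff.1 hy).2
  have h1 : ∀ᶠ y in 𝓝 z, extDeriv (fun x => mfst (k + 1) (f x)) y = 0 := by
    filter_upwards [hf, h0] with y hy h
    have := mfst_modelD_succ T (hy.differentiableAt (by simp))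
    rwa [h, _root_.map_zero, eq_comm, smul_eq_zero_iff_right hk] at this
  obtain ⟨β, hβ, hdβ⟩ := exists_extDeriv_eq hf1 h1
  have hβy : ∀ y, ContDiffAt ℝ ∞ β y := fun y => hβ.contDiffAt
  -- The coefficient of Tβ comes from clearing the factor 1/(k+2) in front of the exterior
  -- derivative in the second equation.
  obtain ⟨γ, hγ, hdγ⟩ := exists_extDeriv_eq
    (φ := fun x => msnd (k + 1) (f x) + (((k : ℝ) + 2) * (-1 : ℝ) ^ k) •
      T.compContinuousAlternatingMap (β x)) (z := z)
    (by
      filter_upwards [hf2] with y hy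
      exact hy.add ((contDiffAt_comp T (hβy y)).const_smul _))
    (by
      filter_upwards [hf, hf2, h0, hdβ] with y hy hy2 h hb
      have h3 := msnd_modelD_succ T (hy.differentiableAt (by simp))
      have d2 : DifferentiableAt ℝ ((((k : ℝ) + 2) * (-1 : ℝ) ^ k) • fun x =>
          T.compContinuousAlternatingMap (β x)) y :=
        ((contDiffAt_comp T (hβy y)).differentiableAt (by simp)).const_smul _
      have h4 := extDeriv_add (hy2.differentiableAt (by simp)) d2
      rw [extDeriv_smul, extDeriv_comp T ((hβy y).differentiableAt (by simp)), hb] at h4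
      rw [h, _root_.map_zero] at h3
      refine h4.trans ?_
      have h5 : (((k + 1 : ℕ) : ℝ) + 1) • (0 : E [⋀^Fin (k + 2)]→L[ℝ] F) = _ :=
        congrArg (fun φ => (((k + 1 : ℕ) : ℝ) + 1) • φ) h3
      rw [smul_zero, smul_add, smul_smul, mul_inv_cancel₀ (by positivity), one_smul, smul_smul]
        at h5
      rw [h5]
      congr 2
      push_cast
      ring)
  have hg : ContDiff ℝ ∞ (fun x => (mpair (((k : ℝ) + 2) • β x) (((k : ℝ) + 1) • γ x) :
      MTerm E F (k + 1))) :=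
    ContDiff.prodMk (f := fun x => ((k : ℝ) + 2) • β x) (g := fun x => ((k : ℝ) + 1) • γ x)
      (hβ.const_smul _) (hγ.const_smul _)
  refine ⟨_, hg, ?_⟩
  filter_upwards [hdβ, hdγ] with y hb hc
  have hd : DifferentiableAt ℝ (fun x => (mpair (((k : ℝ) + 2) • β x) (((k : ℝ) + 1) • γ x) :
      MTerm E F (k + 1))) y :=
    hg.contDiffAt.differentiableAt (by simp)
  refine mterm_ext ?_ ?_
  · rw [mfst_modelD_succ T hd]
    simp only [mfst_mpair]
    rw [show (extDeriv (fun x => ((k : ℝ) + 2) • β x) y) = _ from extDeriv_smul ((k : ℝ) + 2) β, hb,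
      smul_smul, inv_mul_cancel₀ hk2, one_smul]
  · rw [msnd_modelD_succ T hd]
    simp only [mfst_mpair, msnd_mpair]
    rw [show (extDeriv (fun x => ((k : ℝ) + 1) • γ x) y) = _ from extDeriv_smul ((k : ℝ) + 1) γ, hc,
      smul_smul, inv_mul_cancel₀ hk1, one_smul]
    have e3 : T.compContinuousAlternatingMap (((k : ℝ) + 2) • β y) =
      ((k : ℝ) + 2) • T.compContinuousAlternatingMap (β y) := by
      ext v
      simp
    rw [e3, smul_smul, add_assoc, ← add_smul]
    convert add_zero _ using 2
    convert zero_smul ℝ _ using 2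
    ring

/-- In degree one the second application of the Poincaré lemma is not available: the corrected
second component is a function with zero derivative, that is, a constant c. This constant is the
obstruction to exactness. -/
theorem modelD_one_eq_zero (T : F →L[ℝ] F) {f : E → MTerm E F 1} {z : E}
    (hf : ∀ᶠ y in 𝓝 z, ContDiffAt ℝ ∞ f y) (h0 : ∀ᶠ y in 𝓝 z, modelD T 1 f y = 0) :
    ∃ (ψ : E → F) (c : F), ContDiff ℝ ∞ ψ ∧ ∀ᶠ y in 𝓝 z,
      f y = modelD T 0 ψ y + mpair 0 (constOfIsEmpty ℝ E (Fin 0) c) := by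
  have hf1 : ∀ᶠ y in 𝓝 z, ContDiffAt ℝ ∞ (fun x => mfst 0 (f x)) y := by
    filter_upwards [hf] with y hy using (contDiffAt_mterm_iff.1 hy).1
  have hf2 : ∀ᶠ y in 𝓝 z, ContDiffAt ℝ ∞ (fun x => msnd 0 (f x)) y := by
    filter_upwards [hf] with y hy using (contDiffAt_mterm_iff.1 hy).2
  have h1 : ∀ᶠ y in 𝓝 z, extDeriv (fun x => mfst 0 (f x)) y = 0 := by
    filter_upwards [hf, h0] with y hy h
    have := mfst_modelD_succ T (hy.differentiableAt (by simp))
    rwa [h, _root_.map_zero, eq_comm, smul_eq_zero_iff_right (by positivity)] at this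
  obtain ⟨β, hβ, hdβ⟩ := exists_extDeriv_eq hf1 h1
  let Λ : (E [⋀^Fin 0]→L[ℝ] F) →L[ℝ] F :=
    (constOfIsEmptyLIE ℝ E F (Fin 0)).symm.toContinuousLinearEquiv.toContinuousLinearMap
  have hΛ : ∀ φ, constOfIsEmpty ℝ E (Fin 0) (Λ φ) = φ := fun φ =>
    (constOfIsEmptyLIE ℝ E F (Fin 0)).apply_symm_apply φ
  have hψ : ContDiff ℝ ∞ (fun x => Λ (β x)) := Λ.contDiff.comp hβ
  have hdψ : ∀ y, ofSubsingleton ℝ E F (0 : Fin 1) (fderiv ℝ (fun x => Λ (β x)) y) =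
      extDeriv β y := fun y => by
    rw [← extDeriv_constOfIsEmpty]
    simp only [hΛ]
  -- The second cocycle equation says exactly that the function η − Tψ has zero derivative.
  have hcst : ∀ᶠ y in 𝓝 z, Λ (msnd 0 (f y)) - T (Λ (β y)) = Λ (msnd 0 (f z)) - T (Λ (β z)) := by
    apply eventually_eq_of_fderiv_eq_zero
    filter_upwards [hf, hf2, h0, hdβ] with y hy hy2 h hb
    have d1 : ContDiffAt ℝ ∞ (fun y => Λ (msnd 0 (f y)) - T (Λ (β y))) y :=
      (contDiffAt_clm_comp Λ hy2).sub (contDiffAt_clm_comp T hψ.contDiffAt)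
    refine ⟨d1.differentiableAt (by simp), ?_⟩
    have h3 := msnd_modelD_succ T (hy.differentiableAt (by simp))
    rw [h, _root_.map_zero, ← hb, ← hdψ] at h3
    have h4 := extDeriv_constOfIsEmpty (𝕜 := ℝ) (fun x => Λ (msnd 0 (f x))) y
    simp only [hΛ] at h4
    rw [h4] at h3
    have e : fderiv ℝ (fun y => Λ (msnd 0 (f y)) - T (Λ (β y))) y = _ :=
      (((contDiffAt_clm_comp Λ hy2).differentiableAt (by simp)).hasFDerivAt.sub
        (T.hasFDerivAt.comp y (hψ.contDiffAt.differentiableAt (by simp)).hasFDerivAt)).fderiv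
    rw [e]
    ext a
    have h5 := congrArg (fun φ : E [⋀^Fin 1]→L[ℝ] F => φ ![a]) h3
    simp at h5
    simp [h5]
    rw [sub_eq_add_neg]
  refine ⟨fun x => Λ (β x), Λ (msnd 0 (f z)) - T (Λ (β z)), hψ, ?_⟩
  filter_upwards [hdβ, hcst] with y hb hc
  refine mterm_ext ?_ ?_
  · rw [_root_.map_add, mfst_modelD_zero, mfst_mpair, hdψ, hb, add_zero]
  · rw [_root_.map_add, msnd_modelD_zero, msnd_mpair, ← hc]
    ext v
    have := congrArg (fun φ : E [⋀^Fin 0]→L[ℝ] F => φ v) (hΛ (msnd 0 (f y)))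
    simp at this
    simp [← this]

end Exactness

/-- The coefficient in `shear`. -/
def shearCoeff (k : ℕ) : ℝ := (-1 : ℝ) ^ (k + 1) * ((k : ℝ) + 1)⁻¹

/-- The algebraic change of frame that removes the potential of the connection. -/
def shear (α : E →L[ℝ] ℝ) : ∀ k, MTerm E F k ≃ₗ[ℝ] MTerm E F k
  | 0 => LinearEquiv.refl ℝ F
  | k + 1 =>
    { toFun := fun u => mpair (mfst k u + shearCoeff k • oneWedge α (msnd k u)) (msnd k u)
      invFun := fun u => mpair (mfst k u - shearCoeff k • oneWedge α (msnd k u)) (msnd k u)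
      map_add' := fun u v => by
        refine mterm_ext ?_ ?_
        · simp only [_root_.map_add, mfst_mpair, oneWedge_add, smul_add]
          abel
        · simp only [_root_.map_add, msnd_mpair]
      map_smul' := fun c u => by
        refine mterm_ext ?_ ?_
        · simp only [_root_.map_smul, mfst_mpair, oneWedge_smul, smul_add, RingHom.id_apply]
          rw [smul_comm]
        · simp only [_root_.map_smul, msnd_mpair, RingHom.id_apply]
      left_inv := fun u => by
        refine mterm_ext ?_ ?_
        · simp only [mfst_mpair, msnd_mpair, add_sub_cancel_right]
        · simp only [msnd_mpair]
      right_inv := fun u => by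
        refine mterm_ext ?_ ?_
        · simp only [mfst_mpair, msnd_mpair, sub_add_cancel]
        · simp only [msnd_mpair] }

theorem shear_mpair (α : E →L[ℝ] ℝ) (φ : E [⋀^Fin (k + 1)]→L[ℝ] F) (η : E [⋀^Fin k]→L[ℝ] F) :
    shear α (k + 1) (mpair φ η) = mpair (φ + shearCoeff k • oneWedge α η) η := rfl

/-- With s_k = (−1)^{k+1}/(k+1) the change of frame intertwines the cone of T with the twisted
operator for the connection d + αT. The value of s_k turns the dα ∧ η term of d(α ∧ η) into ±J ∧ η
with the normalisation of `wedge`. The term α ∧ Tη needed in the second component comes from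
applying T to the shifted first component. The term α ∧ Tφ in the first component cancels against
the next shear. -/
theorem modelD_shear (T : F →L[ℝ] F) {α : E → E →L[ℝ] ℝ} {φ : E → E [⋀^Fin (k + 1)]→L[ℝ] F}
    {η : E → E [⋀^Fin k]→L[ℝ] F} {y : E} (hα : ContDiffAt ℝ ∞ α y) (hφ : ContDiffAt ℝ ∞ φ y)
    (hη : ContDiffAt ℝ ∞ η y) {J : E [⋀^Fin 2]→L[ℝ] ℝ}
    (hJ : ∀ a b, fderiv ℝ α y a b - fderiv ℝ α y b a = 2 * J ![a, b]) :
    modelD T (k + 1) (fun x => shear (α x) (k + 1) (mpair (φ x) (η x))) y =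
      shear (α y) (k + 2) (mpair
        (((k : ℝ) + 2)⁻¹ • (extDeriv φ y + oneWedge (α y) (T.compContinuousAlternatingMap (φ y))) +
          (-1 : ℝ) ^ (k + 1) • wedge J (η y))
        (((k : ℝ) + 1)⁻¹ • (extDeriv η y + oneWedge (α y) (T.compContinuousAlternatingMap (η y))) +
          (-1 : ℝ) ^ (k + 1) • T.compContinuousAlternatingMap (φ y))) := by
  have c1 : ContDiffAt ℝ ∞ (fun x => φ x + shearCoeff k • oneWedge (α x) (η x)) y :=
    hφ.add ((contDiffAt_oneWedge hα hη).const_smul _)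
  have hd : DifferentiableAt ℝ (fun x => shear (α x) (k + 1) (mpair (φ x) (η x))) y :=
    (contDiffAt_mterm_iff.2 ⟨c1, hη⟩).differentiableAt (by simp)
  have d1 := extDeriv_add (hφ.differentiableAt (by simp))
    (((contDiffAt_oneWedge hα hη).differentiableAt (by simp)).const_smul (shearCoeff k))
  have d2 := extDeriv_oneWedge (hα.differentiableAt (by simp)) (hη.differentiableAt (by simp))
  rw [extDeriv_smul, d2] at d1
  have hc : shearCoeff (k + 1) = -((-1 : ℝ) ^ (k + 1) * ((k : ℝ) + 2)⁻¹) := by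
    rw [shearCoeff]
    push_cast
    ring
  have hk2 : ((k : ℝ) + 2) ≠ 0 := by positivity
  have hk1 : ((k : ℝ) + 1) ≠ 0 := by positivity
  have hs : ((-1 : ℝ) ^ (k + 1)) * ((-1 : ℝ) ^ (k + 1)) = 1 := by
    rw [← mul_pow]
    norm_num
  rw [shear_mpair]
  refine mterm_ext ?_ ?_
  · rw [mfst_modelD_succ T hd]
    refine (congrArg (fun ψ => ((k : ℝ) + 2)⁻¹ • ψ) d1).trans ?_
    rw [mfst_mpair, wedge_eq_alternatize hJ, oneWedge_add, oneWedge_smul, oneWedge_smul,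
      oneWedge_add, oneWedge_oneWedge, add_zero, hc, shearCoeff]
    generalize oneWedge (α y) (extDeriv η y) = u1
    generalize oneWedge (α y) (T.compContinuousAlternatingMap (φ y)) = u2
    generalize alternatizeUncurryFin (alternatizeUncurryFinCLM ℝ E F ∘L _) = u3
    -- Of the sign only its square matters; the four coefficients can then be compared separately.
    generalize (-1 : ℝ) ^ (k + 1) = e at hs ⊢
    match_scalars
    · ring
    · field_simp
    · field_simp
    · field_simp
      linear_combination hs
  · rw [msnd_modelD_succ T hd]
    have e1 : T.compContinuousAlternatingMap (φ y + shearCoeff k • oneWedge (α y) (η y)) =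
        T.compContinuousAlternatingMap (φ y) +
          shearCoeff k • oneWedge (α y) (T.compContinuousAlternatingMap (η y)) := by
      rw [← comp_oneWedge]
      ext v
      simp
    have e2 : (fun x => msnd k (shear (α x) (k + 1) (mpair (φ x) (η x)))) = η := rfl
    rw [e2, shear_mpair, mfst_mpair, msnd_mpair, e1, shearCoeff]
    generalize (-1 : ℝ) ^ (k + 1) = e at hs ⊢
    match_scalars
    · ring
    · ring
    · field_simp
      linear_combination hs

/-- In degree zero there is nothing to shear, and in degree one the shear subtracts α ⊗ Tf, which
removes α from the derivative d + αT. -/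
theorem modelD_zero_shear (T : F →L[ℝ] F) (α : E →L[ℝ] ℝ) (f : E → F) (y : E) :
    modelD T 0 f y = shear α 1 (mpair
      (ofSubsingleton ℝ E F (0 : Fin 1) (fderiv ℝ f y + α.smulRight (T (f y))))
      (constOfIsEmpty ℝ E (Fin 0) (T (f y)))) := by
  rw [shear_mpair]
  refine mterm_ext ?_ ?_
  · rw [mfst_modelD_zero, mfst_mpair]
    ext v
    rw [ContinuousAlternatingMap.add_apply, ContinuousAlternatingMap.smul_apply, oneWedge_eq_of_isEmpty]
    simp [shearCoeff]
  · rw [msnd_modelD_zero, msnd_mpair]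

end Model

/-! ### Coordinates -/

section Coordinates

open Filter

universe u₁

variable {d : ℕ} {M : Type u₁} [TopologicalSpace M]
  [ChartedSpace (EuclideanSpace ℝ (Fin d)) M]

variable (d) in
/-- The coordinates around a point. -/
def crd (x₀ : M) : M → EuclideanSpace ℝ (Fin d) := extChartAt (𝓡 d) x₀

variable (d) in
/-- The inverse of the coordinates. -/
def crdInv (x₀ : M) : EuclideanSpace ℝ (Fin d) → M := (extChartAt (𝓡 d) x₀).symm

variable (d) in
/-- The domain of the coordinates. -/
def crdDom (x₀ : M) : Set M := (chartAt (EuclideanSpace ℝ (Fin d)) x₀).source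

variable {x₀ y : M}

theorem isOpen_crdDom : IsOpen (crdDom d x₀) := (chartAt _ x₀).open_source

theorem mem_crdDom : x₀ ∈ crdDom d x₀ := mem_chart_source _ x₀

theorem crdInv_crd (hy : y ∈ crdDom d x₀) : crdInv d x₀ (crd d x₀ y) = y :=
  (extChartAt (𝓡 d) x₀).left_inv (by rwa [extChartAt_source])

theorem crd_mem_target (hy : y ∈ crdDom d x₀) : crd d x₀ y ∈ (extChartAt (𝓡 d) x₀).target :=
  (extChartAt (𝓡 d) x₀).map_source (by rwa [extChartAt_source])

theorem eventually_crd_crdInv (hy : y ∈ crdDom d x₀) :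
    ∀ᶠ z in 𝓝 (crd d x₀ y), crd d x₀ (crdInv d x₀ z) = z := by
  filter_upwards [(isOpen_extChartAt_target x₀).mem_nhds (crd_mem_target hy)] with z hz
  exact (extChartAt (𝓡 d) x₀).right_inv hz

theorem continuousAt_crd (hy : y ∈ crdDom d x₀) : ContinuousAt (crd d x₀) y :=
  continuousAt_extChartAt' (by rwa [extChartAt_source])

theorem continuousAt_crdInv (hy : y ∈ crdDom d x₀) : ContinuousAt (crdInv d x₀) (crd d x₀ y) :=
  continuousAt_extChartAt_symm'' (crd_mem_target hy)

/-- Used throughout to move statements about germs between the manifold and the coordinate space. -/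
theorem eventually_crdInv_iff (hy : y ∈ crdDom d x₀) {p : M → Prop} :
    (∀ᶠ z in 𝓝 (crd d x₀ y), p (crdInv d x₀ z)) ↔ ∀ᶠ x in 𝓝 y, p x := by
  refine ⟨fun h => ?_, fun h => ?_⟩
  · filter_upwards [(continuousAt_crd hy).eventually h, isOpen_crdDom.mem_nhds hy] with x hx hx'
    rwa [crdInv_crd hx'] at hx
  · have := continuousAt_crdInv hy
    rw [ContinuousAt, crdInv_crd hy] at this
    exact this.eventually h

theorem eventually_crd_iff (hy : y ∈ crdDom d x₀) {p : EuclideanSpace ℝ (Fin d) → Prop} :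
    (∀ᶠ x in 𝓝 y, p (crd d x₀ x)) ↔ ∀ᶠ z in 𝓝 (crd d x₀ y), p z := by
  rw [← eventually_crdInv_iff hy]
  refine eventually_congr ?_
  filter_upwards [eventually_crd_crdInv hy] with z hz
  rw [hz]

variable [IsManifold (𝓡 d) ∞ M]

theorem contDiffAt_congr_iff {X Y : Type*} [NormedAddCommGroup X] [NormedSpace ℝ X]
    [NormedAddCommGroup Y] [NormedSpace ℝ Y] {f g : X → Y} {x : X} (h : f =ᶠ[𝓝 x] g) :
    ContDiffAt ℝ ∞ f x ↔ ContDiffAt ℝ ∞ g x :=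
  ⟨fun hf => hf.congr_of_eventuallyEq h.symm, fun hg => hg.congr_of_eventuallyEq h⟩

theorem contMDiffAt_iff_crd {G : Type*} [NormedAddCommGroup G] [NormedSpace ℝ G] {f : M → G}
    (hy : y ∈ crdDom d x₀) : ContMDiffAt (𝓡 d) 𝓘(ℝ, G) ∞ f y ↔
      ContDiffAt ℝ ∞ (fun z => f (crdInv d x₀ z)) (crd d x₀ y) := by
  rw [contMDiffAt_iff_source_of_mem_source hy, ModelWithCorners.range_eq_univ,
    contMDiffWithinAt_univ, contMDiffAt_iff_contDiffAt]
  rfl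

theorem mdifferentiableAt_crd (hy : y ∈ crdDom d x₀) :
    MDifferentiableAt (𝓡 d) 𝓘(ℝ, EuclideanSpace ℝ (Fin d)) (crd d x₀) y :=
  haveI : IsManifold (𝓡 d) 1 M := IsManifold.of_le (n := ∞) (by simp)
  mdifferentiableAt_extChartAt hy

variable (d) in
/-- The derivative of the coordinates. -/
def crdDeriv (x₀ y : M) : TangentSpace (𝓡 d) y →L[ℝ] EuclideanSpace ℝ (Fin d) :=
  (trivializationAt (EuclideanSpace ℝ (Fin d)) (TangentSpace (𝓡 d)) x₀).continuousLinearMapAt ℝ y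

variable (d) in
/-- The coordinate vector fields. -/
def crdField (x₀ y : M) : EuclideanSpace ℝ (Fin d) →L[ℝ] TangentSpace (𝓡 d) y :=
  (trivializationAt (EuclideanSpace ℝ (Fin d)) (TangentSpace (𝓡 d)) x₀).symmL ℝ y

theorem mem_baseSet_tangent (hy : y ∈ crdDom d x₀) :
    y ∈ (trivializationAt (EuclideanSpace ℝ (Fin d)) (TangentSpace (𝓡 d)) x₀).baseSet := by
  simpa [crdDom] using hy

theorem crdField_crdDeriv (hy : y ∈ crdDom d x₀) (a : TangentSpace (𝓡 d) y) :
    crdField d x₀ y (crdDeriv d x₀ y a) = a :=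
  Trivialization.symmL_continuousLinearMapAt _ (mem_baseSet_tangent hy) a

theorem crdDeriv_crdField (hy : y ∈ crdDom d x₀) (a : EuclideanSpace ℝ (Fin d)) :
    crdDeriv d x₀ y (crdField d x₀ y a) = a :=
  Trivialization.continuousLinearMapAt_symmL _ (mem_baseSet_tangent hy) a

theorem mvfderiv_eq_crd {G : Type*} [NormedAddCommGroup G] [NormedSpace ℝ G] {f : M → G}
    (hy : y ∈ crdDom d x₀) (hf : ContMDiffAt (𝓡 d) 𝓘(ℝ, G) ∞ f y) (a : TangentSpace (𝓡 d) y) :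
    mvfderiv (𝓡 d) f y a =
      fderiv ℝ (fun z => f (crdInv d x₀ z)) (crd d x₀ y) (crdDeriv d x₀ y a) := by
  have h1 : DifferentiableAt ℝ (fun z => f (crdInv d x₀ z)) (crd d x₀ y) :=
    ((contMDiffAt_iff_crd hy).1 hf).differentiableAt (by simp)
  have h2 : f =ᶠ[𝓝 y] (fun z => f (crdInv d x₀ z)) ∘ crd d x₀ := by
    filter_upwards [isOpen_crdDom.mem_nhds hy] with x hx
    rw [Function.comp_apply, crdInv_crd hx]
  have h3 := mfderiv_comp y h1.mdifferentiableAt (mdifferentiableAt_crd hy)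
  rw [← h2.mfderiv_eq, mfderiv_eq_fderiv] at h3
  rw [mvfderiv, h3, crdDeriv, TangentBundle.continuousLinearMapAt_trivializationAt hy]
  rfl

/-- The components of a vector field in coordinates. -/
def fieldRep (x₀ : M) (X : ∀ x : M, TangentSpace (𝓡 d) x) (z : EuclideanSpace ℝ (Fin d)) :
    EuclideanSpace ℝ (Fin d) :=
  crdDeriv d x₀ (crdInv d x₀ z) (X (crdInv d x₀ z))

/-- The vector field `X` is smooth at a point. -/
def SmoothFieldAt (X : ∀ x : M, TangentSpace (𝓡 d) x) (y : M) : Prop :=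
  ContMDiffAt (𝓡 d) ((𝓡 d).prod 𝓘(ℝ, EuclideanSpace ℝ (Fin d))) ∞
    (fun x => TotalSpace.mk' (EuclideanSpace ℝ (Fin d)) x (X x)) y

omit [IsManifold (𝓡 d) ∞ M] in
theorem contMDiffOn_iff_of_isOpen {H' : Type*} {E' : Type*} [NormedAddCommGroup E'] [NormedSpace ℝ E']
    [TopologicalSpace H']
    {I' : ModelWithCorners ℝ E' H'} {N : Type*} [TopologicalSpace N] [ChartedSpace H' N]
    {f : M → N} {U : Set M} (hU : IsOpen U) :
    ContMDiffOn (𝓡 d) I' ∞ f U ↔ ∀ x ∈ U, ContMDiffAt (𝓡 d) I' ∞ f x :=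
  ⟨fun h _ hx => h.contMDiffAt (hU.mem_nhds hx), fun h x hx => (h x hx).contMDiffWithinAt⟩

theorem smoothField_iff {U : Set M} (hU : IsOpen U) {X : ∀ x : M, TangentSpace (𝓡 d) x} :
    SmoothField U X ↔ ∀ x ∈ U, SmoothFieldAt X x := contMDiffOn_iff_of_isOpen hU

theorem smoothFieldAt_iff (hy : y ∈ crdDom d x₀) {X : ∀ x : M, TangentSpace (𝓡 d) x} :
    SmoothFieldAt X y ↔ ContDiffAt ℝ ∞ (fieldRep x₀ X) (crd d x₀ y) := by
  have h1 := Trivialization.contMDiffAt_section_iff (IB := 𝓡 d) (n := ∞) (s := X)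
    (trivializationAt (EuclideanSpace ℝ (Fin d)) (TangentSpace (𝓡 d)) x₀) (mem_baseSet_tangent hy)
  rw [SmoothFieldAt, h1, contMDiffAt_iff_crd hy]
  refine contDiffAt_congr_iff ?_
  filter_upwards [(eventually_crdInv_iff hy).2 (isOpen_crdDom.mem_nhds hy)] with z hz
  rw [fieldRep, crdDeriv, Trivialization.continuousLinearMapAt_apply,
    Trivialization.coe_linearMapAt_of_mem _ (mem_baseSet_tangent hz)]

theorem fieldRep_crd (hy : y ∈ crdDom d x₀) (X : ∀ x : M, TangentSpace (𝓡 d) x) :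
    fieldRep x₀ X (crd d x₀ y) = crdDeriv d x₀ y (X y) := by
  rw [fieldRep, crdInv_crd hy]

/-- The representative of a vector field is its pullback along the inverse chart, and pullback is
natural for Lie brackets. -/
theorem mlieBracket_eq_crd (hy : y ∈ crdDom d x₀) {X Y : ∀ x : M, TangentSpace (𝓡 d) x}
    (hX : SmoothFieldAt X y) (hY : SmoothFieldAt Y y) :
    crdDeriv d x₀ y (VectorField.mlieBracket (𝓡 d) X Y y) =
      VectorField.lieBracket ℝ (fieldRep x₀ X) (fieldRep x₀ Y) (crd d x₀ y) := by
  have hX' : MDifferentiableAt (𝓡 d) ((𝓡 d).prod 𝓘(ℝ, EuclideanSpace ℝ (Fin d)))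
      (fun x => TotalSpace.mk' (EuclideanSpace ℝ (Fin d)) x (X x)) (crdInv d x₀ (crd d x₀ y)) := by
    rw [crdInv_crd hy]
    exact ContMDiffAt.mdifferentiableAt hX (by simp)
  have hY' : MDifferentiableAt (𝓡 d) ((𝓡 d).prod 𝓘(ℝ, EuclideanSpace ℝ (Fin d)))
      (fun x => TotalSpace.mk' (EuclideanSpace ℝ (Fin d)) x (Y x)) (crdInv d x₀ (crd d x₀ y)) := by
    rw [crdInv_crd hy]
    exact ContMDiffAt.mdifferentiableAt hY (by simp)
  have hc : ContMDiffAt 𝓘(ℝ, EuclideanSpace ℝ (Fin d)) (𝓡 d) ∞ (crdInv d x₀) (crd d x₀ y) :=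
    (contMDiffOn_extChartAt_symm x₀).contMDiffAt
      ((isOpen_extChartAt_target x₀).mem_nhds (crd_mem_target hy))
  have hpull : ∀ Z : (∀ x : M, TangentSpace (𝓡 d) x), ∀ᶠ z in 𝓝 (crd d x₀ y),
      VectorField.mpullback 𝓘(ℝ, EuclideanSpace ℝ (Fin d)) (𝓡 d) (crdInv d x₀) Z z =
        fieldRep x₀ Z z := fun Z => by
    filter_upwards [eventually_crd_crdInv hy,
      (eventually_crdInv_iff hy).2 (isOpen_crdDom.mem_nhds hy)] with z hz hz'
    have h1 : mfderiv 𝓘(ℝ, EuclideanSpace ℝ (Fin d)) (𝓡 d) (crdInv d x₀) z =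
        crdField d x₀ (crdInv d x₀ z) := by
      rw [crdField, TangentBundle.symmL_trivializationAt hz', ModelWithCorners.range_eq_univ,
        mfderivWithin_univ]
      have h0 : ∀ w, w = z → (mfderiv 𝓘(ℝ, EuclideanSpace ℝ (Fin d)) (𝓡 d) (crdInv d x₀) z :
          EuclideanSpace ℝ (Fin d) →L[ℝ] EuclideanSpace ℝ (Fin d)) =
          mfderiv 𝓘(ℝ, EuclideanSpace ℝ (Fin d)) (𝓡 d) (crdInv d x₀) w := by
        rintro w rfl
        rfl
      exact h0 _ hz
    have h2 : ContinuousLinearMap.inverse (crdField d x₀ (crdInv d x₀ z)) =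
        crdDeriv d x₀ (crdInv d x₀ z) :=
      ContinuousLinearMap.inverse_eq
        (ContinuousLinearMap.ext fun a => crdField_crdDeriv hz' a)
        (ContinuousLinearMap.ext fun a => crdDeriv_crdField hz' a)
    rw [VectorField.mpullback_apply]
    exact (congrArg (fun Λ => ContinuousLinearMap.inverse Λ (Z (crdInv d x₀ z))) h1).trans
      (congrArg (fun Λ => Λ (Z (crdInv d x₀ z))) h2)
  have : IsManifold (𝓡 d) (minSmoothness ℝ 2) M :=
    IsManifold.of_le (n := ∞) (by simpa using two_le_infty)
  have h := VectorField.mpullback_mlieBracket hX' hY' hc (by simpa using two_le_infty)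
  have h2 := (hpull (VectorField.mlieBracket (𝓡 d) X Y)).self_of_nhds
  rw [h, fieldRep_crd hy] at h2
  have h3 : ∀ v w : EuclideanSpace ℝ (Fin d) → EuclideanSpace ℝ (Fin d),
      VectorField.mlieBracket 𝓘(ℝ, EuclideanSpace ℝ (Fin d)) v w =
        VectorField.lieBracket ℝ v w := fun v w => by
    exact (VectorField.mlieBracketWithin_univ (I := 𝓘(ℝ, EuclideanSpace ℝ (Fin d)))).symm.trans
      (VectorField.mlieBracketWithin_eq_lieBracketWithin.trans VectorField.lieBracketWithin_univ)
  rw [← h2]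
  refine (congrFun (h3 _ _) _).trans ?_
  exact Filter.EventuallyEq.lieBracket_vectorField_eq (E := EuclideanSpace ℝ (Fin d)) (hpull X) (hpull Y)

/-- The vector field with constant components. -/
theorem smoothFieldAt_crdField (hy : y ∈ crdDom d x₀) (a : EuclideanSpace ℝ (Fin d)) :
    SmoothFieldAt (fun x => crdField d x₀ x a) y := by
  rw [smoothFieldAt_iff hy]
  refine (contDiffAt_const (c := a)).congr_of_eventuallyEq ?_
  filter_upwards [(eventually_crdInv_iff hy).2 (isOpen_crdDom.mem_nhds hy)] with z hz
  rw [fieldRep, crdDeriv_crdField hz]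

end Coordinates

/-! ### Smoothness of form-valued functions -/

section FormValued

variable {E : Type} {X F : Type*} [NormedAddCommGroup E] [NormedSpace ℝ E]
  [NormedAddCommGroup X] [NormedSpace ℝ X] [NormedAddCommGroup F] [NormedSpace ℝ F]
  [FiniteDimensional ℝ F] {k : ℕ}

/-- Evaluation is jointly analytic in the multilinear map and its arguments. -/
theorem contDiffAt_form_apply {φ : X → E [⋀^Fin k]→L[ℝ] F} {v : X → Fin k → E} {y : X}
    (hφ : ContDiffAt ℝ ∞ φ y) (hv : ∀ i, ContDiffAt ℝ ∞ (fun x => v x i) y) :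
    ContDiffAt ℝ ∞ (fun x => φ x (v x)) y := by
  have : CompleteSpace F := FiniteDimensional.complete ℝ F
  let Λ : (E [⋀^Fin k]→L[ℝ] F) →L[ℝ] ContinuousMultilinearMap ℝ (fun _ : Fin k => E) F :=
    ContinuousAlternatingMap.toContinuousMultilinearMapCLM ℝ
  have h := (Λ.analyticAt_uncurry_of_multilinear (x := (φ y, v y))).contDiffAt (n := ∞)
  exact h.comp y (f := fun x => (φ x, v x)) (hφ.prodMk (contDiffAt_pi.2 hv))

/-- A form is determined by its values on tuples of basis vectors; this injective linear map has a
linear left inverse, continuous because finitely many values in a finite-dimensional space are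
involved. -/
theorem contDiffAt_form_iff [FiniteDimensional ℝ E] {φ : X → E [⋀^Fin k]→L[ℝ] F} {y : X} :
    ContDiffAt ℝ ∞ φ y ↔ ∀ v : Fin k → E, ContDiffAt ℝ ∞ (fun x => φ x v) y := by
  refine ⟨fun h v => contDiffAt_form_apply h fun i => contDiffAt_const, fun h => ?_⟩
  let b := Module.finBasis ℝ E
  let ev : (E [⋀^Fin k]→L[ℝ] F) →ₗ[ℝ] ((Fin k → Fin (Module.finrank ℝ E)) → F) :=
    { toFun := fun φ w => φ fun i => b (w i)
      map_add' := fun _ _ => rfl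
      map_smul' := fun _ _ => rfl }
  have hev : Function.Injective ev := fun φ ψ h => by
    refine ContinuousAlternatingMap.toAlternatingMap_injective ?_
    exact b.ext_alternating fun v _ => congrFun h v
  obtain ⟨Λ, hΛ⟩ := ev.exists_leftInverse_of_injective (LinearMap.ker_eq_bot.2 hev)
  have h1 : φ = fun x => Λ.toContinuousLinearMap (ev (φ x)) :=
    funext fun x => (LinearMap.congr_fun hΛ (φ x)).symm
  rw [h1]
  exact Λ.toContinuousLinearMap.contDiff.contDiffAt.comp y
    (f := fun x => ev (φ x)) (contDiffAt_pi.2 fun w => h fun i => b (w i))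

end FormValued

/-! ### Local frames -/

section Frames

open Filter

universe u₁ v₁ w₁

variable {d : ℕ} {M : Type u₁} [TopologicalSpace M]
  [ChartedSpace (EuclideanSpace ℝ (Fin d)) M] [IsManifold (𝓡 d) ∞ M]
  {F : Type w₁} [NormedAddCommGroup F] [NormedSpace ℝ F]
  {V : M → Type v₁} [TopologicalSpace (TotalSpace F V)]
  [∀ x, AddCommGroup (V x)] [∀ x, Module ℝ (V x)] [∀ x, TopologicalSpace (V x)]
  [∀ x, IsTopologicalAddGroup (V x)] [∀ x, ContinuousSMul ℝ (V x)]
  [FiberBundle F V] [VectorBundle ℝ F V]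

variable (d F) in
/-- The section `s` is smooth at a point. -/
def SmoothSectionAt (s : ∀ x, V x) (y : M) : Prop :=
  ContMDiffAt (𝓡 d) ((𝓡 d).prod 𝓘(ℝ, F)) ∞ (fun x => TotalSpace.mk' F x (s x)) y

theorem smoothSection_iff {U : Set M} (hU : IsOpen U) {s : ∀ x, V x} :
    SmoothSection (d := d) F U s ↔ ∀ x ∈ U, SmoothSectionAt d F s x :=
  contMDiffOn_iff_of_isOpen hU

theorem SmoothSectionAt.mdifferentiableAt {s : ∀ x, V x} {y : M} (hs : SmoothSectionAt d F s y) :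
    MDifferentiableAt (𝓡 d) ((𝓡 d).prod 𝓘(ℝ, F)) (fun x => TotalSpace.mk' F x (s x)) y :=
  ContMDiffAt.mdifferentiableAt hs (by simp)

variable (d F V) in
/-- A trivialisation of the bundle `V` over a neighbourhood `U` of `x₀` contained in the domain of
the coordinates around `x₀`. -/
structure Frame (x₀ : M) (U : Set M) where
  isOpen : IsOpen U
  mem : x₀ ∈ U
  subset : U ⊆ crdDom d x₀
  /-- The components of a vector. -/
  τ : ∀ y, V y →L[ℝ] F
  /-- The vector with given components. -/
  τ' : ∀ y, F →L[ℝ] V y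
  left_inv : ∀ y ∈ U, ∀ v, τ' y (τ y v) = v
  right_inv : ∀ y ∈ U, ∀ v, τ y (τ' y v) = v
  smooth_iff : ∀ y ∈ U, ∀ s : ∀ x, V x, SmoothSectionAt d F s y ↔
    ContDiffAt ℝ ∞ (fun z => τ (crdInv d x₀ z) (s (crdInv d x₀ z))) (crd d x₀ y)

variable {x₀ : M} {U : Set M}

/-- The components of a section. -/
def Frame.rep (fr : Frame d F V x₀ U) (s : ∀ x, V x) (z : EuclideanSpace ℝ (Fin d)) : F :=
  fr.τ (crdInv d x₀ z) (s (crdInv d x₀ z))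

theorem Frame.rep_crd (fr : Frame d F V x₀ U) (s : ∀ x, V x) {y : M} (hy : y ∈ U) :
    fr.rep s (crd d x₀ y) = fr.τ y (s y) := by
  rw [Frame.rep, crdInv_crd (fr.subset hy)]

/-- The frame given by the bundle. -/
def standardFrame [ContMDiffVectorBundle ∞ F V (𝓡 d)] (x₀ : M) :
    Frame d F V x₀ (crdDom d x₀ ∩ (trivializationAt F V x₀).baseSet) where
  isOpen := isOpen_crdDom.inter (trivializationAt F V x₀).open_baseSet
  mem := ⟨mem_crdDom, mem_baseSet_trivializationAt F V x₀⟩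
  subset := inter_subset_left
  τ y := (trivializationAt F V x₀).continuousLinearMapAt ℝ y
  τ' y := (trivializationAt F V x₀).symmL ℝ y
  left_inv _ hy v := Trivialization.symmL_continuousLinearMapAt _ hy.2 v
  right_inv _ hy v := Trivialization.continuousLinearMapAt_symmL _ hy.2 v
  smooth_iff y hy s := by
    rw [SmoothSectionAt, Trivialization.contMDiffAt_section_iff (trivializationAt F V x₀) hy.2,
      contMDiffAt_iff_crd hy.1]
    refine contDiffAt_congr_iff ?_
    filter_upwards [(eventually_crdInv_iff hy.1).2
      ((trivializationAt F V x₀).open_baseSet.mem_nhds hy.2)] with z hz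
    rw [Trivialization.continuousLinearMapAt_apply, Trivialization.coe_linearMapAt_of_mem _ hz]

/-- The components of a form at a point. -/
def Frame.formAt (fr : Frame d F V x₀ U) {k : ℕ} {y : M}
    (φ : TangentSpace (𝓡 d) y [⋀^Fin k]→L[ℝ] V y) : EuclideanSpace ℝ (Fin d) [⋀^Fin k]→L[ℝ] F :=
  (fr.τ y).compContinuousAlternatingMap (φ.compContinuousLinearMap (crdField d x₀ y))

/-- The components of a form. -/
def Frame.formRep (fr : Frame d F V x₀ U) {k : ℕ}
    (φ : ∀ x : M, TangentSpace (𝓡 d) x [⋀^Fin k]→L[ℝ] V x) (z : EuclideanSpace ℝ (Fin d)) :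
    EuclideanSpace ℝ (Fin d) [⋀^Fin k]→L[ℝ] F :=
  fr.formAt (φ (crdInv d x₀ z))

variable (d F) in
/-- The form `φ` is smooth at a point. -/
def SmoothFormAt {k : ℕ} (φ : ∀ x : M, TangentSpace (𝓡 d) x [⋀^Fin k]→L[ℝ] V x) (y : M) : Prop :=
  ContMDiffAt (𝓡 d) ((𝓡 d).prod 𝓘(ℝ, EuclideanSpace ℝ (Fin d) [⋀^Fin k]→L[ℝ] F)) ∞
    (fun x => TotalSpace.mk' (EuclideanSpace ℝ (Fin d) [⋀^Fin k]→L[ℝ] F)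
      (E := fun x : M => TangentSpace (𝓡 d) x [⋀^Fin k]→L[ℝ] V x) x (φ x)) y

variable {k : ℕ} {φ : ∀ x : M, TangentSpace (𝓡 d) x [⋀^Fin k]→L[ℝ] V x} {y : M}

theorem smoothForm_iff (hU : IsOpen U) :
    SmoothForm F k U φ ↔ ∀ x ∈ U, SmoothFormAt d F φ x :=
  contMDiffOn_iff_of_isOpen hU

theorem Frame.formRep_crd (fr : Frame d F V x₀ U) (hy : y ∈ U) :
    fr.formRep φ (crd d x₀ y) = fr.formAt (φ y) := by
  rw [Frame.formRep, crdInv_crd (fr.subset hy)]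

theorem Frame.eventually (fr : Frame d F V x₀ U) (hy : y ∈ U) :
    ∀ᶠ z in 𝓝 (crd d x₀ y), crdInv d x₀ z ∈ U :=
  (eventually_crdInv_iff (fr.subset hy)).2 (fr.isOpen.mem_nhds hy)

theorem Frame.rep_form_apply (fr : Frame d F V x₀ U)
    (X : Fin k → ∀ x : M, TangentSpace (𝓡 d) x) {z : EuclideanSpace ℝ (Fin d)}
    (hz : crdInv d x₀ z ∈ U) :
    fr.rep (fun x => φ x fun i => X i x) z = fr.formRep φ z fun i => fieldRep x₀ (X i) z := by
  simp only [Frame.rep, Frame.formRep, Frame.formAt, fieldRep,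
    ContinuousLinearMap.compContinuousAlternatingMap_coe, Function.comp_apply,
    ContinuousAlternatingMap.compContinuousLinearMap_apply, Function.comp_def,
    crdField_crdDeriv (fr.subset hz)]

variable [FiniteDimensional ℝ F]

/-- A form is smooth exactly when its values on smooth vector fields are. -/
theorem Frame.contDiffAt_formRep_iff (fr : Frame d F V x₀ U) (hy : y ∈ U) :
    ContDiffAt ℝ ∞ (fr.formRep φ) (crd d x₀ y) ↔
      ∀ X : Fin k → ∀ x : M, TangentSpace (𝓡 d) x, (∀ i, SmoothFieldAt (X i) y) →
        SmoothSectionAt d F (fun x => φ x fun i => X i x) y := by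
  refine ⟨fun h X hX => ?_, fun h => ?_⟩
  · rw [fr.smooth_iff y hy]
    have h1 := contDiffAt_form_apply h fun i => (smoothFieldAt_iff (fr.subset hy)).1 (hX i)
    refine h1.congr_of_eventuallyEq ?_
    filter_upwards [fr.eventually hy] with z hz using fr.rep_form_apply X hz
  · refine contDiffAt_form_iff.2 fun v => ?_
    have h1 := (fr.smooth_iff y hy _).1 (h (fun i x => crdField d x₀ x (v i))
      fun i => smoothFieldAt_crdField (fr.subset hy) (v i))
    exact h1

/-- The criterion by values on vector fields does not mention a frame, so it carries smoothness from
the trivialisation of the bundle to an arbitrary `Frame`, in particular to a gauge-transformed one.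
-/
theorem smoothFormAt_iff_apply [ContMDiffVectorBundle ∞ F V (𝓡 d)] :
    SmoothFormAt d F φ y ↔
      ∀ X : Fin k → ∀ x : M, TangentSpace (𝓡 d) x, (∀ i, SmoothFieldAt (X i) y) →
        SmoothSectionAt d F (fun x => φ x fun i => X i x) y := by
  rw [← (standardFrame (V := V) y).contDiffAt_formRep_iff (standardFrame (V := V) y).mem,
    SmoothFormAt, contMDiffAt_section, contMDiffAt_iff_crd mem_crdDom]
  rfl

/-- A form is smooth exactly when its components are. -/
theorem Frame.smoothFormAt_iff [ContMDiffVectorBundle ∞ F V (𝓡 d)] (fr : Frame d F V x₀ U)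
    (hy : y ∈ U) : SmoothFormAt d F φ y ↔ ContDiffAt ℝ ∞ (fr.formRep φ) (crd d x₀ y) := by
  rw [smoothFormAt_iff_apply, fr.contDiffAt_formRep_iff hy]

end Frames

/-! ### Connections in local frames -/

theorem contDiffAt_clm_iff {X Y Z : Type*} [NormedAddCommGroup X] [NormedSpace ℝ X]
    [NormedAddCommGroup Y] [NormedSpace ℝ Y] [FiniteDimensional ℝ Y] [NormedAddCommGroup Z]
    [NormedSpace ℝ Z] {f : X → Y →L[ℝ] Z} {x : X} :
    ContDiffAt ℝ ∞ f x ↔ ∀ v, ContDiffAt ℝ ∞ (fun x => f x v) x := by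
  refine ⟨fun h v => h.clm_apply contDiffAt_const, fun h => ?_⟩
  let b := Module.finBasis ℝ Y
  have h1 : f = fun x => ∑ i, ContinuousLinearMap.smulRightL ℝ Y Z
      (b.coord i).toContinuousLinearMap (f x (b i)) := by
    funext x
    refine ContinuousLinearMap.ext fun v => ?_
    conv_lhs => rw [← b.sum_repr v]
    rw [_root_.map_sum, _root_.sum_apply]
    exact Finset.sum_congr rfl fun i _ => (f x).map_smul _ _
  rw [h1]
  exact ContDiffAt.sum fun i _ => (ContinuousLinearMap.contDiff _).contDiffAt.comp x
    (f := fun x => f x (b i)) (h (b i))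

section Connections

open Filter

universe u₁ v₁ w₁

variable {d : ℕ} {M : Type u₁} [TopologicalSpace M]
  [ChartedSpace (EuclideanSpace ℝ (Fin d)) M] [IsManifold (𝓡 d) ∞ M]
  {F : Type w₁} [NormedAddCommGroup F] [NormedSpace ℝ F]
  {V : M → Type v₁} [TopologicalSpace (TotalSpace F V)]
  [∀ x, AddCommGroup (V x)] [∀ x, Module ℝ (V x)] [∀ x, TopologicalSpace (V x)]
  [∀ x, IsTopologicalAddGroup (V x)] [∀ x, ContinuousSMul ℝ (V x)]
  [FiberBundle F V] [VectorBundle ℝ F V] {y : M} {s t : ∀ x, V x}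

theorem SmoothSectionAt.congr (hs : SmoothSectionAt d F s y) (h : ∀ᶠ x in 𝓝 y, t x = s x) :
    SmoothSectionAt d F t y :=
  ContMDiffAt.congr_of_eventuallyEq hs (h.mono fun x hx => by simp only [hx])

/-- The curvature condition and the smoothness of the connection speak of global sections; local
frames are cut off by a bump function before these are applied. -/
theorem exists_smoothSection_eventuallyEq [T2Space M] (h : ∀ᶠ x in 𝓝 y, SmoothSectionAt d F s x) :
    ∃ t : ∀ x, V x, (∀ x, SmoothSectionAt d F t x) ∧ ∀ᶠ x in 𝓝 y, t x = s x := by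
  obtain ⟨W, hW, hWo, hyW⟩ := eventually_nhds_iff.1 h
  obtain ⟨f, -, hf⟩ := (SmoothBumpFunction.nhds_basis_tsupport (I := 𝓡 d) y).mem_iff.1
    (hWo.mem_nhds hyW)
  refine ⟨(f : M → ℝ) • s, fun x => ?_, ?_⟩
  · exact (ContMDiffOn.smul_section_of_tsupport (f.contMDiff.contMDiffOn (s := W)) hWo hf
      (fun x hx => (hW x hx).contMDiffWithinAt)) x
  · filter_upwards [f.eventuallyEq_one] with x hx
    simp [hx]

theorem cov_congr (cov : CovariantDerivative (𝓡 d) F V) (hs : SmoothSectionAt d F s y)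
    (h : ∀ᶠ x in 𝓝 y, t x = s x) : cov t y = cov s y :=
  cov.isCovariantDerivativeOnUniv.congr_of_eventuallyEq (hs.congr h).mdifferentiableAt
    hs.mdifferentiableAt univ_mem h

theorem smoothSectionAt_cov [T2Space M] {cov : CovariantDerivative (𝓡 d) F V}
    (hcov : CovariantDerivative.ContMDiffCovariantDerivative cov ∞)
    {X : ∀ x : M, TangentSpace (𝓡 d) x}
    (hs : ∀ᶠ x in 𝓝 y, SmoothSectionAt d F s x) (hX : SmoothFieldAt X y) :
    SmoothSectionAt d F (fun x => cov s x (X x)) y := by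
  obtain ⟨t, ht, hts⟩ := exists_smoothSection_eventuallyEq hs
  have h1 := hcov.contMDiff.contMDiff (σ := t) (by
    intro x _
    exact (ht x).contMDiffWithinAt)
  have h2 := (h1.contMDiffAt univ_mem).clm_bundle_apply (x := y) hX
  refine SmoothSectionAt.congr (s := fun x => cov t x (X x)) h2 ?_
  filter_upwards [hs, hts.eventually_nhds] with x hx hx'
  rw [cov_congr cov hx hx']

theorem cov_sum {ι : Type*} (cov : CovariantDerivative (𝓡 d) F V) (I : Finset ι)
    {s : ι → ∀ x, V x} (hs : ∀ i ∈ I, SmoothSectionAt d F (s i) y) :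
    cov (fun x => ∑ i ∈ I, s i x) y = ∑ i ∈ I, cov (s i) y := by
  classical
  induction I using Finset.induction_on with
  | empty =>
    simp only [Finset.sum_empty]
    exact congrFun cov.zero y
  | insert i I hi h =>
    simp only [Finset.sum_insert hi]
    rw [← h fun j hj => hs j (Finset.mem_insert_of_mem hj)]
    exact cov.isCovariantDerivativeOnUniv.add (hs i (Finset.mem_insert_self i I)).mdifferentiableAt
      (SmoothSectionAt.mdifferentiableAt
        (ContMDiffAt.sum_section fun j hj => hs j (Finset.mem_insert_of_mem hj)))

variable {x₀ : M} {U : Set M}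

/-- In the frame `fr`, the connection is given by the connection matrix `A`. -/
def Frame.HasConnection (fr : Frame d F V x₀ U) (cov : CovariantDerivative (𝓡 d) F V)
    (A : EuclideanSpace ℝ (Fin d) → EuclideanSpace ℝ (Fin d) →L[ℝ] F →L[ℝ] F) : Prop :=
  ∀ y ∈ U, ∀ s, SmoothSectionAt d F s y → ∀ a, fr.τ y (cov s y a) =
    fderiv ℝ (fr.rep s) (crd d x₀ y) (crdDeriv d x₀ y a) +
      A (crd d x₀ y) (crdDeriv d x₀ y a) (fr.τ y (s y))

theorem Frame.smoothSectionAt_const (fr : Frame d F V x₀ U) (hy : y ∈ U) (v : F) :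
    SmoothSectionAt d F (fun x => fr.τ' x v) y := by
  rw [fr.smooth_iff y hy]
  refine (contDiffAt_const (c := v)).congr_of_eventuallyEq ?_
  filter_upwards [fr.eventually hy] with z hz using fr.right_inv _ hz v

/-- The matrix A has as columns the components of the covariant derivatives of the frame vectors.
Expanding a section in the frame, locality and the Leibniz rule give the formula. -/
theorem Frame.exists_hasConnection [T2Space M] [FiniteDimensional ℝ F] (fr : Frame d F V x₀ U)
    {cov : CovariantDerivative (𝓡 d) F V}
    (hcov : CovariantDerivative.ContMDiffCovariantDerivative cov ∞) :
    ∃ A, fr.HasConnection cov A ∧ ∀ y ∈ U, ContDiffAt ℝ ∞ A (crd d x₀ y) := by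
  let b := Module.finBasis ℝ F
  let e : Fin (Module.finrank ℝ F) → ∀ x, V x := fun i x => fr.τ' x (b i)
  let B : Fin (Module.finrank ℝ F) → EuclideanSpace ℝ (Fin d) → EuclideanSpace ℝ (Fin d) →L[ℝ] F :=
    fun i z => (fr.τ (crdInv d x₀ z)).comp
      ((cov (e i) (crdInv d x₀ z)).comp (crdField d x₀ (crdInv d x₀ z)))
  refine ⟨fun z => ∑ i, (ContinuousLinearMap.smulRightL ℝ F F
    (b.coord i).toContinuousLinearMap).comp (B i z), fun y hy s hs a => ?_, fun y hy => ?_⟩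
  · have hf : ∀ i, ContMDiffAt (𝓡 d) 𝓘(ℝ, ℝ) ∞ (fun x => b.coord i (fr.τ x (s x))) y := fun i => by
      rw [contMDiffAt_iff_crd (fr.subset hy)]
      exact (b.coord i).toContinuousLinearMap.contDiff.contDiffAt.comp _
        ((fr.smooth_iff y hy s).1 hs)
    have hse : ∀ᶠ x in 𝓝 y, s x = ∑ i, b.coord i (fr.τ x (s x)) • e i x := by
      filter_upwards [fr.isOpen.mem_nhds hy] with x hx
      conv_lhs => rw [← fr.left_inv x hx (s x), ← b.sum_repr (fr.τ x (s x)), _root_.map_sum]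
      exact Finset.sum_congr rfl fun i _ => (fr.τ' x).map_smul _ _
    have he : ∀ i, SmoothSectionAt d F (e i) y := fun i => fr.smoothSectionAt_const hy (b i)
    have hfe : ∀ i, SmoothSectionAt d F (fun x => b.coord i (fr.τ x (s x)) • e i x) y :=
      fun i => ContMDiffAt.smul_section (hf i) (he i)
    have h1 : cov s y = ∑ i, cov (fun x => b.coord i (fr.τ x (s x)) • e i x) y := by
      rw [← cov_sum cov _ fun i _ => hfe i]
      exact cov_congr cov (ContMDiffAt.sum_section fun i _ => hfe i) hse
    have h2 : ∀ i, cov (fun x => b.coord i (fr.τ x (s x)) • e i x) y a =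
        b.coord i (fr.τ y (s y)) • cov (e i) y a +
          fderiv ℝ (fun z => b.coord i (fr.rep s z)) (crd d x₀ y) (crdDeriv d x₀ y a) • e i y :=
      fun i => by
      have h3 := cov.isCovariantDerivativeOnUniv.leibniz (he i).mdifferentiableAt
        ((hf i).mdifferentiableAt (by simp))
      refine (congrArg (fun Λ => Λ a) h3).trans ?_
      exact congrArg (fun r : ℝ => b.coord i (fr.τ y (s y)) • cov (e i) y a + r • e i y)
        (mvfderiv_eq_crd (fr.subset hy) (hf i) a)
    have h4 : ∀ i, fderiv ℝ (fun z => b.coord i (fr.rep s z)) (crd d x₀ y) (crdDeriv d x₀ y a) =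
        b.coord i (fderiv ℝ (fr.rep s) (crd d x₀ y) (crdDeriv d x₀ y a)) := fun i => by
      have := fderiv_clm_comp (b.coord i).toContinuousLinearMap (f := fr.rep s)
        (y := crd d x₀ y) (((fr.smooth_iff y hy s).1 hs).differentiableAt (by simp))
      exact congrArg (fun Λ => Λ (crdDeriv d x₀ y a)) this
    rw [h1, _root_.sum_apply, _root_.map_sum]
    simp only [h2, h4, _root_.map_add, _root_.map_smul]
    rw [Finset.sum_add_distrib, add_comm]
    refine congrArg₂ (· + ·) ?_ ?_
    · conv_rhs => rw [← b.sum_repr (fderiv ℝ (fr.rep s) (crd d x₀ y) (crdDeriv d x₀ y a))]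
      refine Finset.sum_congr rfl fun i _ => ?_
      rw [fr.right_inv y hy]
      rfl
    · rw [_root_.sum_apply, _root_.sum_apply]
      refine Finset.sum_congr rfl fun i _ => ?_
      have h5 : ∀ x, x = y → fr.τ x (cov (e i) x (crdField d x₀ x (crdDeriv d x₀ y a))) =
          fr.τ y (cov (e i) y a) := by
        rintro x rfl
        rw [crdField_crdDeriv (fr.subset hy)]
      exact congrArg (b.coord i (fr.τ y (s y)) • ·) (h5 _ (crdInv_crd (fr.subset hy))).symm
  · refine ContDiffAt.sum fun i _ => ?_
    have hB : ContDiffAt ℝ ∞ (B i) (crd d x₀ y) := contDiffAt_clm_iff.2 fun a => by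
      refine (fr.smooth_iff y hy fun x => cov (e i) x (crdField d x₀ x a)).1 ?_
      refine smoothSectionAt_cov hcov ?_ (smoothFieldAt_crdField (fr.subset hy) a)
      filter_upwards [fr.isOpen.mem_nhds hy] with x hx using fr.smoothSectionAt_const hx (b i)
    exact (contDiffAt_const (c := ContinuousLinearMap.smulRightL ℝ F F
      (b.coord i).toContinuousLinearMap)).clm_comp hB

end Connections

/-! ### The symplectic form in coordinates -/

section SymplecticCoordinates

open Filter

universe u₁

variable {d : ℕ} {M : Type u₁} [TopologicalSpace M]
  [ChartedSpace (EuclideanSpace ℝ (Fin d)) M] [IsManifold (𝓡 d) ∞ M] {x₀ y : M}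

theorem eventually_fieldRep_eq (hy : y ∈ crdDom d x₀) {X : ∀ x : M, TangentSpace (𝓡 d) x}
    {a : EuclideanSpace ℝ (Fin d)} (hX : ∀ᶠ x in 𝓝 y, X x = crdField d x₀ x a) :
    ∀ᶠ z in 𝓝 (crd d x₀ y), fieldRep x₀ X z = a := by
  filter_upwards [(eventually_crdInv_iff hy).2 (hX.and (isOpen_crdDom.mem_nhds hy))] with z hz
  rw [fieldRep, hz.1, crdDeriv_crdField hz.2]

theorem SmoothFieldAt.congr {X Y : ∀ x : M, TangentSpace (𝓡 d) x} (hX : SmoothFieldAt X y)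
    (h : ∀ᶠ x in 𝓝 y, Y x = X x) : SmoothFieldAt Y y :=
  SmoothSectionAt.congr (F := EuclideanSpace ℝ (Fin d)) (V := TangentSpace (𝓡 d) (M := M)) hX h

theorem mlieBracket_crdField (hy : y ∈ crdDom d x₀) {X Y : ∀ x : M, TangentSpace (𝓡 d) x}
    {a b : EuclideanSpace ℝ (Fin d)} (hX : ∀ᶠ x in 𝓝 y, X x = crdField d x₀ x a)
    (hY : ∀ᶠ x in 𝓝 y, Y x = crdField d x₀ x b) : VectorField.mlieBracket (𝓡 d) X Y y = 0 := by
  have h := mlieBracket_eq_crd hy ((smoothFieldAt_crdField hy a).congr hX)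
    ((smoothFieldAt_crdField hy b).congr hY)
  have h2 : VectorField.lieBracket ℝ (fieldRep x₀ X) (fieldRep x₀ Y) (crd d x₀ y) =
      VectorField.lieBracket ℝ (fun _ => a) (fun _ => b) (crd d x₀ y) :=
    Filter.EventuallyEq.lieBracket_vectorField_eq (eventually_fieldRep_eq hy hX)
      (eventually_fieldRep_eq hy hY)
  rw [h2] at h
  rw [← crdField_crdDeriv hy (VectorField.mlieBracket (𝓡 d) X Y y), h]
  simp [VectorField.lieBracket]

theorem exists_smoothField_crdField [T2Space M] (hy : y ∈ crdDom d x₀)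
    (a : EuclideanSpace ℝ (Fin d)) : ∃ X : ∀ x : M, TangentSpace (𝓡 d) x, SmoothField univ X ∧
      ∀ᶠ x in 𝓝 y, X x = crdField d x₀ x a := by
  obtain ⟨X, h1, h2⟩ := exists_smoothSection_eventuallyEq (F := EuclideanSpace ℝ (Fin d))
    (V := TangentSpace (𝓡 d) (M := M)) (y := y) (s := fun x => crdField d x₀ x a) (by
      filter_upwards [isOpen_crdDom.mem_nhds hy] with x hx using smoothFieldAt_crdField hx a)
  exact ⟨X, (smoothField_iff isOpen_univ).2 fun x _ => h1 x, h2⟩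

variable (J : SymplecticForm d M)

theorem contMDiffAt_form_apply {X Y : ∀ x : M, TangentSpace (𝓡 d) x} (hX : SmoothFieldAt X y)
    (hY : SmoothFieldAt Y y) : ContMDiffAt (𝓡 d) 𝓘(ℝ, ℝ) ∞ (fun x => J.at x ![X x, Y x]) y := by
  have h1 : SmoothFormAt d ℝ (V := Bundle.Trivial M ℝ) J.form y := J.contMDiff y
  have h2 := smoothFormAt_iff_apply.1 h1 ![X, Y] (by
    intro i
    fin_cases i
    · exact hX
    · exact hY)
  have h3 := (contMDiffAt_section (F := ℝ) (E := Bundle.Trivial M ℝ) y).1 h2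
  refine h3.congr_of_eventuallyEq (Eventually.of_forall fun x => ?_)
  have h4 : (fun i : Fin 2 => (![X, Y] i) x) = ![X x, Y x] := by
    funext i
    fin_cases i <;> rfl
  exact congrArg (J.at x) h4.symm

/-- The components of the symplectic form. -/
def SymplecticForm.rep (x₀ : M) (z : EuclideanSpace ℝ (Fin d)) :
    EuclideanSpace ℝ (Fin d) [⋀^Fin 2]→L[ℝ] ℝ :=
  (J.at (crdInv d x₀ z)).compContinuousLinearMap (crdField d x₀ (crdInv d x₀ z))

theorem vecTwo_eq {X : Type*} (v : Fin 2 → X) : v = ![v 0, v 1] := by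
  funext i
  fin_cases i <;> rfl

theorem SymplecticForm.rep_apply (z a b : EuclideanSpace ℝ (Fin d)) : J.rep x₀ z ![a, b] =
    J.at (crdInv d x₀ z) ![crdField d x₀ (crdInv d x₀ z) a, crdField d x₀ (crdInv d x₀ z) b] := by
  refine congrArg (J.at (crdInv d x₀ z)) ?_
  funext i
  fin_cases i <;> rfl

theorem SymplecticForm.rep_crd (hy : y ∈ crdDom d x₀) (a b : TangentSpace (𝓡 d) y) :
    J.rep x₀ (crd d x₀ y) ![crdDeriv d x₀ y a, crdDeriv d x₀ y b] = J.at y ![a, b] := by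
  rw [J.rep_apply]
  have h : ∀ x, x = y → J.at x ![crdField d x₀ x (crdDeriv d x₀ y a),
      crdField d x₀ x (crdDeriv d x₀ y b)] = J.at y ![a, b] := by
    rintro x rfl
    rw [crdField_crdDeriv hy, crdField_crdDeriv hy]
  exact h _ (crdInv_crd hy)

theorem SymplecticForm.contDiffAt_rep (hy : y ∈ crdDom d x₀) :
    ContDiffAt ℝ ∞ (J.rep x₀) (crd d x₀ y) := by
  refine contDiffAt_form_iff.2 fun v => ?_
  rw [vecTwo_eq v]
  simp only [J.rep_apply]
  exact (contMDiffAt_iff_crd hy).1 (contMDiffAt_form_apply J (smoothFieldAt_crdField hy (v 0))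
    (smoothFieldAt_crdField hy (v 1)))

theorem SymplecticForm.eq_zero_of_rep (hy : y ∈ crdDom d x₀) {a : EuclideanSpace ℝ (Fin d)}
    (h : ∀ b, J.rep x₀ (crd d x₀ y) ![a, b] = 0) : a = 0 := by
  have h1 : crdField d x₀ y a = 0 := J.nondegenerate y _ fun b => by
    have := h (crdDeriv d x₀ y b)
    rw [← crdDeriv_crdField hy a, J.rep_crd hy] at this
    exact this
  rw [← crdDeriv_crdField hy a, h1, _root_.map_zero]

/-- The invariant formula for dJ is evaluated on global extensions of coordinate fields; their
brackets vanish at the point. -/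
theorem SymplecticForm.closed_rep [T2Space M] (hy : y ∈ crdDom d x₀)
    (a b c : EuclideanSpace ℝ (Fin d)) :
    fderiv ℝ (fun z => J.rep x₀ z ![b, c]) (crd d x₀ y) a -
      fderiv ℝ (fun z => J.rep x₀ z ![a, c]) (crd d x₀ y) b +
      fderiv ℝ (fun z => J.rep x₀ z ![a, b]) (crd d x₀ y) c = 0 := by
  obtain ⟨X, hX, hXa⟩ := exists_smoothField_crdField hy a
  obtain ⟨Y, hY, hYb⟩ := exists_smoothField_crdField hy b
  obtain ⟨Z, hZ, hZc⟩ := exists_smoothField_crdField hy c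
  have key : ∀ {Y Z : ∀ x : M, TangentSpace (𝓡 d) x} {a b c : EuclideanSpace ℝ (Fin d)},
      SmoothField univ Y → SmoothField univ Z → (∀ᶠ x in 𝓝 y, Y x = crdField d x₀ x b) →
      (∀ᶠ x in 𝓝 y, Z x = crdField d x₀ x c) →
      mvfderiv (𝓡 d) (fun x => (J.form x ![Y x, Z x] : ℝ)) y (crdField d x₀ y a) =
        fderiv ℝ (fun z => J.rep x₀ z ![b, c]) (crd d x₀ y) a := fun {Y Z a b c} hY hZ hYb hZc => by
    refine (mvfderiv_eq_crd hy (contMDiffAt_form_apply J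
      ((smoothField_iff isOpen_univ).1 hY y (mem_univ y))
      ((smoothField_iff isOpen_univ).1 hZ y (mem_univ y))) _).trans ?_
    rw [crdDeriv_crdField hy]
    refine DFunLike.congr_fun (F := EuclideanSpace ℝ (Fin d) →L[ℝ] ℝ)
      (Filter.EventuallyEq.fderiv_eq (𝕜 := ℝ) ?_) a
    filter_upwards [(eventually_crdInv_iff hy).2 (hYb.and hZc)] with z hz
    rw [J.rep_apply, hz.1, hz.2]
  have hJ0 : ∀ w : TangentSpace (𝓡 d) y, J.form y ![0, w] = 0 := fun w =>
    LinearMap.map_zero₂ (bilin (J.at y)) w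
  have h := J.closed X Y Z hX hY hZ y
  rw [hXa.self_of_nhds, hYb.self_of_nhds, hZc.self_of_nhds, key hY hZ hYb hZc, key hX hZ hXa hZc,
    key hX hY hXa hYb, mlieBracket_crdField hy hXa hYb, mlieBracket_crdField hy hXa hZc,
    mlieBracket_crdField hy hYb hZc, hJ0, hJ0, hJ0] at h
  have h' : (_ : ℝ) - 0 + 0 - 0 = 0 := h
  simpa only [sub_zero, add_zero] using h'

end SymplecticCoordinates

theorem fderiv_clm_apply_apply {X Y Z W : Type*} [NormedAddCommGroup X] [NormedSpace ℝ X]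
    [NormedAddCommGroup Y] [NormedSpace ℝ Y] [NormedAddCommGroup Z] [NormedSpace ℝ Z]
    [NormedAddCommGroup W] [NormedSpace ℝ W] {f : X → Y →L[ℝ] Z →L[ℝ] W} {x : X}
    (hf : DifferentiableAt ℝ f x) (a : X) (b : Y) (v : Z) :
    fderiv ℝ (fun x => f x b v) x a = fderiv ℝ f x a b v := by
  have h := ((hf.hasFDerivAt.clm_apply (hasFDerivAt_const b x)).clm_apply
    (hasFDerivAt_const v x)).fderiv
  rw [show fderiv ℝ (fun x => f x b v) x = _ from h]
  simp

/-! ### The curvature equation in a local frame -/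

section Curvature

open Filter

universe u₁ v₁ w₁

variable {d : ℕ} {M : Type u₁} [TopologicalSpace M] [T2Space M]
  [ChartedSpace (EuclideanSpace ℝ (Fin d)) M] [IsManifold (𝓡 d) ∞ M]
  {F : Type w₁} [NormedAddCommGroup F] [NormedSpace ℝ F] [FiniteDimensional ℝ F]
  {V : M → Type v₁} [TopologicalSpace (TotalSpace F V)]
  [∀ x, AddCommGroup (V x)] [∀ x, Module ℝ (V x)] [∀ x, TopologicalSpace (V x)]
  [∀ x, IsTopologicalAddGroup (V x)] [∀ x, ContinuousSMul ℝ (V x)]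
  [FiberBundle F V] [VectorBundle ℝ F V] {y : M} {s t : ∀ x, V x}
  {x₀ : M} {U : Set M} (fr : Frame d F V x₀ U) {cov : CovariantDerivative (𝓡 d) F V}
  {A : EuclideanSpace ℝ (Fin d) → EuclideanSpace ℝ (Fin d) →L[ℝ] F →L[ℝ] F}
  {Θ : ∀ x, V x →L[ℝ] V x}

/-- The components of a family of endomorphisms. -/
def Frame.endRep (Θ : ∀ x, V x →L[ℝ] V x) (z : EuclideanSpace ℝ (Fin d)) : F →L[ℝ] F :=
  (fr.τ (crdInv d x₀ z)).comp ((Θ (crdInv d x₀ z)).comp (fr.τ' (crdInv d x₀ z)))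

variable {fr}

theorem Frame.HasConnection.rep_cov (hA : fr.HasConnection cov A) (hy : y ∈ U)
    (hs : ∀ᶠ x in 𝓝 y, SmoothSectionAt d F s x) (X : ∀ x : M, TangentSpace (𝓡 d) x) :
    ∀ᶠ z in 𝓝 (crd d x₀ y), fr.rep (fun x => cov s x (X x)) z =
      fderiv ℝ (fr.rep s) z (fieldRep x₀ X z) + A z (fieldRep x₀ X z) (fr.rep s z) := by
  filter_upwards [fr.eventually hy, (eventually_crdInv_iff (fr.subset hy)).2 hs,
    eventually_crd_crdInv (fr.subset hy)] with z h1 h2 h3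
  have h := hA _ h1 s h2 (X (crdInv d x₀ z))
  rw [h3] at h
  exact h

/-- The curvature condition is tested on global extensions of two coordinate fields and of a section
with constant components. The bracket term vanishes, and the first derivative of the section
consists of the matrix term alone. -/
theorem Frame.HasConnection.curvature (hA : fr.HasConnection cov A) {J : SymplecticForm d M}
    (hAs : ∀ y ∈ U, ContDiffAt ℝ ∞ A (crd d x₀ y))
    (hcov : CovariantDerivative.ContMDiffCovariantDerivative cov ∞)
    (hΘ : HasSymplecticallyFlatCurvature J cov Θ) (hy : y ∈ U) (a b : EuclideanSpace ℝ (Fin d)) :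
    fderiv ℝ A (crd d x₀ y) a b - fderiv ℝ A (crd d x₀ y) b a +
      (A (crd d x₀ y) a * A (crd d x₀ y) b - A (crd d x₀ y) b * A (crd d x₀ y) a) =
      (2 * J.rep x₀ (crd d x₀ y) ![a, b]) • fr.endRep Θ (crd d x₀ y) := by
  have hyc := fr.subset hy
  refine ContinuousLinearMap.ext fun v => ?_
  obtain ⟨X, hX, hXa⟩ := exists_smoothField_crdField hyc a
  obtain ⟨Y, hY, hYb⟩ := exists_smoothField_crdField hyc b
  have hv : ∀ᶠ x in 𝓝 y, SmoothSectionAt d F (fun x => fr.τ' x v) x := by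
    filter_upwards [fr.isOpen.mem_nhds hy] with x hx using fr.smoothSectionAt_const hx v
  obtain ⟨s, hs, hsv⟩ := exists_smoothSection_eventuallyEq hv
  have hrep : ∀ᶠ z in 𝓝 (crd d x₀ y), fr.rep s z = v := by
    filter_upwards [fr.eventually hy, (eventually_crdInv_iff hyc).2 hsv] with z h1 h2
    rw [Frame.rep, h2, fr.right_inv _ h1]
  have hXs := fun x => (smoothField_iff isOpen_univ).1 hX x (mem_univ x)
  have hYs := fun x => (smoothField_iff isOpen_univ).1 hY x (mem_univ x)
  have hA1 : DifferentiableAt ℝ A (crd d x₀ y) := (hAs y hy).differentiableAt (by simp)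
  have key : ∀ {X Y : ∀ x : M, TangentSpace (𝓡 d) x} {a b : EuclideanSpace ℝ (Fin d)},
      (∀ x, SmoothFieldAt Y x) → (X y = crdField d x₀ y a) →
      (∀ᶠ x in 𝓝 y, Y x = crdField d x₀ x b) →
      fr.τ y (cov (fun x => cov s x (Y x)) y (X y)) =
        fderiv ℝ A (crd d x₀ y) a b v + A (crd d x₀ y) a (A (crd d x₀ y) b v) :=
      fun {X Y a b} hYs hXa hYb => by
    have h1 : ∀ᶠ z in 𝓝 (crd d x₀ y), fr.rep (fun x => cov s x (Y x)) z = A z b v := by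
      filter_upwards [hA.rep_cov hy (Eventually.of_forall hs) Y, eventually_fieldRep_eq hyc hYb,
        hrep.eventually_nhds] with z h1 h2 h3
      have h4 : fderiv ℝ (fr.rep s) z = 0 := by
        rw [Filter.EventuallyEq.fderiv_eq h3, fderiv_fun_const]
        rfl
      rw [h1, h2, h4, h3.self_of_nhds]
      simp
    have h2 := hA y hy _ (smoothSectionAt_cov hcov (Eventually.of_forall hs) (hYs y)) (X y)
    have h3 : fr.rep (fun x => cov s x (Y x)) (crd d x₀ y) = fr.τ y (cov s y (Y y)) :=
      fr.rep_crd _ hy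
    rw [h2, ← h3, Filter.EventuallyEq.fderiv_eq h1, h1.self_of_nhds, hXa,
      crdDeriv_crdField hyc]
    congr 1
    exact fderiv_clm_apply_apply hA1 a b v
  have h := congrArg (fr.τ y) (hΘ X Y s hX hY
    ((smoothSection_iff isOpen_univ).2 fun x _ => hs x) y)
  rw [mlieBracket_crdField hyc hXa hYb, _root_.map_zero, sub_zero, _root_.map_sub, key hYs
    hXa.self_of_nhds hYb, key hXs hYb.self_of_nhds hXa, hsv.self_of_nhds, hXa.self_of_nhds,
    hYb.self_of_nhds, ← J.rep_crd hyc, crdDeriv_crdField hyc, crdDeriv_crdField hyc,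
    _root_.map_smul] at h
  have h5 : fr.endRep Θ (crd d x₀ y) v = fr.τ y (Θ y (fr.τ' y v)) := by
    rw [Frame.endRep, crdInv_crd hyc]
    rfl
  refine Eq.trans ?_ (h.trans (congrArg _ h5.symm))
  simp only [_root_.add_apply, _root_.sub_apply]
  abel

end Curvature

/-! ### Normal frames -/

theorem contDiffAt_fderiv_apply_apply {X Y Z : Type*} [NormedAddCommGroup X] [NormedSpace ℝ X]
    [NormedAddCommGroup Y] [NormedSpace ℝ Y] [NormedAddCommGroup Z] [NormedSpace ℝ Z]
    {f : X → Y →L[ℝ] Z} {x : X} (hf : ContDiffAt ℝ ∞ f x) (a : X) (b : Y) :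
    ContDiffAt ℝ ∞ (fun x => fderiv ℝ f x a b) x :=
  ((hf.fderiv_right (m := ∞) (by simp)).clm_apply contDiffAt_const).clm_apply contDiffAt_const

section NormalFrames

open Filter

universe u₁ v₁ w₁

variable {d : ℕ} {M : Type u₁} [TopologicalSpace M]
  [ChartedSpace (EuclideanSpace ℝ (Fin d)) M] [IsManifold (𝓡 d) ∞ M]
  {F : Type w₁} [NormedAddCommGroup F] [NormedSpace ℝ F]
  {V : M → Type v₁} [TopologicalSpace (TotalSpace F V)]
  [∀ x, AddCommGroup (V x)] [∀ x, Module ℝ (V x)] [∀ x, TopologicalSpace (V x)]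
  [∀ x, IsTopologicalAddGroup (V x)] [∀ x, ContinuousSMul ℝ (V x)]
  [FiberBundle F V] [VectorBundle ℝ F V] {y : M}
  {x₀ : M} {U : Set M} {fr : Frame d F V x₀ U} {cov : CovariantDerivative (𝓡 d) F V}
  {A : EuclideanSpace ℝ (Fin d) → EuclideanSpace ℝ (Fin d) →L[ℝ] F →L[ℝ] F}
  {Θ : ∀ x, V x →L[ℝ] V x} {J : SymplecticForm d M}

theorem Frame.endRep_crd (hy : y ∈ U) (v : F) :
    fr.endRep Θ (crd d x₀ y) v = fr.τ y (Θ y (fr.τ' y v)) := by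
  rw [Frame.endRep, crdInv_crd (fr.subset hy)]
  rfl

/-- Nothing is assumed about the smoothness of Θ. By non-degeneracy there are constant directions
with J(a, b) ≠ 0 near the point, and Θ is the smooth curvature on (a, b) divided by 2J(a, b). In
dimension zero the coordinate space is a point. -/
theorem Frame.HasConnection.contDiffAt_endRep [FiniteDimensional ℝ F] [T2Space M]
    (hA : fr.HasConnection cov A)
    (hAs : ∀ y ∈ U, ContDiffAt ℝ ∞ A (crd d x₀ y))
    (hcov : CovariantDerivative.ContMDiffCovariantDerivative cov ∞)
    (hΘ : HasSymplecticallyFlatCurvature J cov Θ) (hy : y ∈ U) :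
    ContDiffAt ℝ ∞ (fr.endRep Θ) (crd d x₀ y) := by
  rcases subsingleton_or_nontrivial (EuclideanSpace ℝ (Fin d)) with hE | hE
  · have h : fr.endRep Θ = fun _ => fr.endRep Θ 0 := funext fun z => by rw [Subsingleton.elim z 0]
    rw [h]
    exact contDiffAt_const
  obtain ⟨a, ha⟩ := exists_ne (0 : EuclideanSpace ℝ (Fin d))
  obtain ⟨b, hb⟩ : ∃ b, J.rep x₀ (crd d x₀ y) ![a, b] ≠ 0 := by
    by_contra! h
    exact ha (J.eq_zero_of_rep (fr.subset hy) h)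
  have hJ : ContDiffAt ℝ ∞ (fun z => J.rep x₀ z ![a, b]) (crd d x₀ y) :=
    contDiffAt_form_iff.1 (J.contDiffAt_rep (fr.subset hy)) _
  have hA0 := hAs y hy
  have hAa : ∀ a, ContDiffAt ℝ ∞ (fun z => A z a) (crd d x₀ y) := fun a =>
    hA0.clm_apply contDiffAt_const
  have hA' : ∀ a b, ContDiffAt ℝ ∞ (fun z => fderiv ℝ A z a b) (crd d x₀ y) := fun a b =>
    contDiffAt_fderiv_apply_apply hA0 a b
  have h1 : ContDiffAt ℝ ∞ (fun z => (2 * J.rep x₀ z ![a, b])⁻¹ • (fderiv ℝ A z a b -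
      fderiv ℝ A z b a + ((A z a).comp (A z b) - (A z b).comp (A z a)))) (crd d x₀ y) :=
    ((contDiffAt_const.mul hJ).inv (by simpa using hb)).smul
      (((hA' a b).sub (hA' b a)).add
        (((hAa a).clm_comp (hAa b)).sub ((hAa b).clm_comp (hAa a))))
  refine h1.congr_of_eventuallyEq ?_
  filter_upwards [fr.eventually hy, eventually_crd_crdInv (fr.subset hy),
    hJ.continuousAt.eventually_ne hb] with z hz hz' hz0
  have h2 := hA.curvature hAs hcov hΘ hz a b
  rw [hz'] at h2
  exact ((inv_smul_eq_iff₀ (by simpa using hz0)).2 h2).symm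

theorem Frame.HasConnection.parallel [FiniteDimensional ℝ F] [T2Space M]
    (hA : fr.HasConnection cov A) (hAs : ∀ y ∈ U, ContDiffAt ℝ ∞ A (crd d x₀ y))
    (hcov : CovariantDerivative.ContMDiffCovariantDerivative cov ∞)
    (hΘ : HasSymplecticallyFlatCurvature J cov Θ)
    (hpar : d = 0 ∨ IsParallelEndomorphism cov Θ ∨ 4 ≤ d) (hy : y ∈ U)
    (c : EuclideanSpace ℝ (Fin d)) :
    fderiv ℝ (fr.endRep Θ) (crd d x₀ y) c + (A (crd d x₀ y) c * fr.endRep Θ (crd d x₀ y) -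
      fr.endRep Θ (crd d x₀ y) * A (crd d x₀ y) c) = 0 := by
  have hyc := fr.subset hy
  have hΘs := hA.contDiffAt_endRep hAs hcov hΘ hy
  -- In dimension zero the only direction is 0. If Θ is assumed parallel, the identity is tested on
  -- sections with constant components. Otherwise the Bianchi identity is used.
  rcases hpar with rfl | hpar | hd
  · rw [Subsingleton.elim c 0]
    simp
  · refine ContinuousLinearMap.ext fun v => ?_
    have hv := fr.smoothSectionAt_const hy v
    have hrep : ∀ᶠ z in 𝓝 (crd d x₀ y), fr.rep (fun x => fr.τ' x v) z = v := by
      filter_upwards [fr.eventually hy] with z hz using fr.right_inv _ hz v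
    have hrep' : ∀ᶠ z in 𝓝 (crd d x₀ y), fr.rep (fun x => Θ x (fr.τ' x v)) z =
        fr.endRep Θ z v := Eventually.of_forall fun z => rfl
    have hΘv : SmoothSectionAt d F (fun x => Θ x (fr.τ' x v)) y :=
      (fr.smooth_iff y hy _).2 (hΘs.clm_apply contDiffAt_const)
    have h := congrArg (fun Λ => fr.τ y (Λ (crdField d x₀ y c))) (hpar U (fun x => fr.τ' x v)
      fr.isOpen ((smoothSection_iff fr.isOpen).2 fun x hx => fr.smoothSectionAt_const hx v) y hy)
    have h1 : fr.τ y (cov (fun x => Θ x (fr.τ' x v)) y (crdField d x₀ y c)) =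
        fderiv ℝ (fr.endRep Θ) (crd d x₀ y) c v + A (crd d x₀ y) c (fr.endRep Θ (crd d x₀ y) v) := by
      rw [hA y hy _ hΘv, crdDeriv_crdField hyc, Filter.EventuallyEq.fderiv_eq hrep',
        fr.endRep_crd hy]
      congr 1
      have := (hΘs.differentiableAt (by simp)).hasFDerivAt.clm_apply
        (hasFDerivAt_const v (crd d x₀ y))
      rw [show fderiv ℝ (fun z => fr.endRep Θ z v) (crd d x₀ y) = _ from this.fderiv]
      simp
    have h2 : fr.τ y (cov (fun x => fr.τ' x v) y (crdField d x₀ y c)) = A (crd d x₀ y) c v := by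
      rw [hA y hy _ hv, crdDeriv_crdField hyc, Filter.EventuallyEq.fderiv_eq hrep,
        fr.right_inv y hy, fderiv_fun_const]
      simp
    have h3 : fr.τ y (Θ y (cov (fun x => fr.τ' x v) y (crdField d x₀ y c))) =
        fr.endRep Θ (crd d x₀ y) (A (crd d x₀ y) c v) := by
      rw [← h2, fr.endRep_crd hy, fr.left_inv y hy]
    have h4 := h1.symm.trans (h.trans h3)
    change fderiv ℝ (fr.endRep Θ) (crd d x₀ y) c v + (A (crd d x₀ y) c
      (fr.endRep Θ (crd d x₀ y) v) - fr.endRep Θ (crd d x₀ y) (A (crd d x₀ y) c v)) = 0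
    rw [← h4]
    abel
  · let z := crd d x₀ y
    let P : EuclideanSpace ℝ (Fin d) →ₗ[ℝ] F →L[ℝ] F :=
      { toFun := fun c => fderiv ℝ (fr.endRep Θ) z c +
          (A z c * fr.endRep Θ z - fr.endRep Θ z * A z c)
        map_add' := fun a b => by
          simp only [_root_.map_add, add_mul, mul_add]
          abel
        map_smul' := fun r a => by
          simp only [_root_.map_smul, smul_mul_assoc, mul_smul_comm, RingHom.id_apply, smul_add,
            smul_sub] }
    have hP : P = 0 := by
      refine eq_zero_of_cyclic_sum_eq_zero (bilin (J.rep x₀ z))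
        (fun a b => by exact twoForm_swap (J.rep x₀ z) a b)
        (fun a h => J.eq_zero_of_rep hyc h) (by simpa using hd) P fun a b c => ?_
      refine bianchi (hAs y hy) (hΘs.differentiableAt (by simp))
        ((J.contDiffAt_rep hyc).differentiableAt (by simp)) (J.closed_rep hyc) ?_ a b c
      filter_upwards [fr.eventually hy, eventually_crd_crdInv hyc] with w hw hw' a b
      have := hA.curvature hAs hcov hΘ hw a b
      rwa [hw'] at this
    exact LinearMap.congr_fun hP c

variable (J cov Θ) in
/-- A frame in which the endomorphism `Θ` is constant, and the connection is its product with a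
potential of the symplectic form. -/
structure NormalFrame (x₀ : M) (U : Set M) extends Frame d F V x₀ U where
  /-- The potential. -/
  α : EuclideanSpace ℝ (Fin d) → EuclideanSpace ℝ (Fin d) →L[ℝ] ℝ
  /-- The value of the endomorphism. -/
  T : F →L[ℝ] F
  contDiff_α : ContDiff ℝ ∞ α
  potential : ∀ y ∈ U, ∀ a b, fderiv ℝ α (crd d x₀ y) a b - fderiv ℝ α (crd d x₀ y) b a =
    2 * J.rep x₀ (crd d x₀ y) ![a, b]
  connection : toFrame.HasConnection cov fun z => (α z).smulRight T
  τ_Θ : ∀ y ∈ U, ∀ v, τ y (Θ y v) = T (τ y v)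

variable (J) in
-- A symplectic potential and the gauge transformation of `exists_gauge` are applied to the
-- trivialisation of the bundle. The new components of a section are h = g⁻¹ applied to the old
-- ones, and T is the matrix of Θ at the centre.
theorem exists_normalFrame [FiniteDimensional ℝ F] [T2Space M]
    [ContMDiffVectorBundle ∞ F V (𝓡 d)]
    (hcov : CovariantDerivative.ContMDiffCovariantDerivative cov ∞)
    (hΘ : HasSymplecticallyFlatCurvature J cov Θ)
    (hpar : d = 0 ∨ IsParallelEndomorphism cov Θ ∨ 4 ≤ d) (x₀ : M) :
    ∃ U, Nonempty (NormalFrame cov Θ J x₀ U) := by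
  have hx₀ := mem_crdDom (d := d) (x₀ := x₀)
  let fr := standardFrame (d := d) (F := F) (V := V) x₀
  obtain ⟨A, hA, hAs⟩ := fr.exists_hasConnection hcov
  have : CompleteSpace F := FiniteDimensional.complete ℝ F
  have hev : ∀ {p : EuclideanSpace ℝ (Fin d) → Prop}, (∀ y ∈ _, p (crd d x₀ y)) →
      ∀ᶠ z in 𝓝 (crd d x₀ x₀), p z := fun {p} h => by
    filter_upwards [fr.eventually fr.mem, eventually_crd_crdInv hx₀] with z hz hz'
    rw [← hz']
    exact h _ hz
  obtain ⟨α, hα, hαJ⟩ := exists_potential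
    (hev fun y hy => J.contDiffAt_rep (fr.subset hy)) (hev fun y hy => by
      refine ContinuousAlternatingMap.ext fun v => ?_
      rw [extDeriv_twoForm_apply ((J.contDiffAt_rep (fr.subset hy)).differentiableAt (by simp)),
        J.closed_rep (fr.subset hy)]
      rfl)
  obtain ⟨g, h, hgh⟩ := exists_gauge (hev hAs)
    (hev fun y hy => hA.contDiffAt_endRep hAs hcov hΘ hy) hα (by
      filter_upwards [hαJ, hev (p := fun z => ∀ a b, fderiv ℝ A z a b -
        fderiv ℝ A z b a + (A z a * A z b - A z b * A z a) =
        (2 * J.rep x₀ z ![a, b]) • fr.endRep Θ z) fun y hy => hA.curvature hAs hcov hΘ hy]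
        with z h1 h2 a b
      rw [h2, h1])
    (hev (p := fun z => ∀ c, fderiv ℝ (fr.endRep Θ) z c + (A z c * fr.endRep Θ z -
      fr.endRep Θ z * A z c) = 0) fun y hy => hA.parallel hAs hcov hΘ hpar hy)
  obtain ⟨U, hU, hUo, hxU⟩ := eventually_nhds_iff.1
    (((eventually_crd_iff hx₀).2 (hαJ.and hgh)).and (fr.isOpen.mem_nhds fr.mem))
  have hgh1 : ∀ y ∈ U, ∀ v, g (crd d x₀ y) (h (crd d x₀ y) v) = v := fun y hy v =>
    DFunLike.congr_fun (hU y hy).1.2.2.2.1 v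
  have hhg1 : ∀ y ∈ U, ∀ v, h (crd d x₀ y) (g (crd d x₀ y) v) = v := fun y hy v =>
    DFunLike.congr_fun (hU y hy).1.2.2.2.2.1 v
  have hcrd : ∀ y ∈ U, y ∈ crdDom d x₀ := fun y hy => fr.subset (hU y hy).2
  have hevU : ∀ y ∈ U, ∀ᶠ z in 𝓝 (crd d x₀ y), crdInv d x₀ z ∈ U ∧
      crd d x₀ (crdInv d x₀ z) = z := fun y hy =>
    ((eventually_crdInv_iff (hcrd y hy)).2 (hUo.mem_nhds hy)).and
      (eventually_crd_crdInv (hcrd y hy))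
  have hrep : ∀ y ∈ U, ∀ s : ∀ x, V x, ∀ᶠ z in 𝓝 (crd d x₀ y), fr.rep s z =
      g z (h (crd d x₀ (crdInv d x₀ z)) (fr.rep s z)) := fun y hy s => by
    filter_upwards [hevU y hy] with z hz
    have := hgh1 _ hz.1 (fr.rep s z)
    rw [hz.2] at this ⊢
    exact this.symm
  have hsm : ∀ y ∈ U, ∀ s : ∀ x, V x, SmoothSectionAt d F s y ↔ ContDiffAt ℝ ∞
      (fun z => h (crd d x₀ (crdInv d x₀ z)) (fr.rep s z)) (crd d x₀ y) := fun y hy s => by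
    refine (fr.smooth_iff y (hU y hy).2 s).trans ⟨fun hs => ?_, fun hs => ?_⟩
    · refine ((hU y hy).1.2.2.1.clm_apply hs).congr_of_eventuallyEq ?_
      filter_upwards [hevU y hy] with z hz
      rw [hz.2]
      rfl
    · exact ((hU y hy).1.2.1.clm_apply hs).congr_of_eventuallyEq (hrep y hy s)
  refine ⟨U, ⟨{
    isOpen := hUo
    mem := hxU
    subset := hcrd
    τ := fun y => (h (crd d x₀ y)).comp (fr.τ y)
    τ' := fun y => (fr.τ' y).comp (g (crd d x₀ y))
    left_inv := fun y hy v => ?_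
    right_inv := fun y hy v => ?_
    smooth_iff := hsm
    α := α
    T := fr.endRep Θ (crd d x₀ x₀)
    contDiff_α := hα
    potential := fun y hy => (hU y hy).1.1
    connection := fun y hy s hs a => ?_
    τ_Θ := fun y hy v => ?_ }⟩⟩
  · simp only [ContinuousLinearMap.comp_apply]
    rw [hgh1 y hy, fr.left_inv y (hU y hy).2]
  · simp only [ContinuousLinearMap.comp_apply]
    rw [fr.right_inv y (hU y hy).2, hhg1 y hy]
  -- With old components g r, the derivative of g contributes −(A − αΘ) g r, so that h(d(g r) + A g
  -- r) = dr + α (hΘg) r, where hΘg = T.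
  · have h1 := hA y (hU y hy).2 s hs a
    have hr := (hsm y hy s).1 hs
    have h2 := ((hU y hy).1.2.1.differentiableAt (by simp)).hasFDerivAt.clm_apply
      (hr.differentiableAt (by simp)).hasFDerivAt
    have h3 := Filter.EventuallyEq.fderiv_eq (𝕜 := ℝ) (hrep y hy s)
    rw [h3, show fderiv ℝ (fun z => g z (h (crd d x₀ (crdInv d x₀ z)) (fr.rep s z))) (crd d x₀ y) =
      _ from h2.fderiv] at h1
    set r := fun z => h (crd d x₀ (crdInv d x₀ z)) (fr.rep s z) with hrdef
    have h4 : fr.τ y (s y) = g (crd d x₀ y) (r (crd d x₀ y)) := by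
      rw [hrdef]
      simp only [crdInv_crd (hcrd y hy)]
      rw [hgh1 y hy, fr.rep_crd s (hU y hy).2]
    have h5 : h (crd d x₀ y) (fr.τ y (s y)) = r (crd d x₀ y) := by
      rw [h4, hhg1 y hy]
    have h6 := DFunLike.congr_fun ((hU y hy).1.2.2.2.2.2.1 (crdDeriv d x₀ y a)) (r (crd d x₀ y))
    have h7 := DFunLike.congr_fun (hU y hy).1.2.2.2.2.2.2 (r (crd d x₀ y))
    simp only [ContinuousLinearMap.comp_apply]
    rw [h1, h5, h4]
    simp only [_root_.add_apply, ContinuousLinearMap.comp_apply, ContinuousLinearMap.flip_apply,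
      _root_.map_add]
    rw [hhg1 y hy]
    have h6' : fderiv ℝ g (crd d x₀ y) (crdDeriv d x₀ y a) (r (crd d x₀ y)) =
        -(A (crd d x₀ y) (crdDeriv d x₀ y a) (g (crd d x₀ y) (r (crd d x₀ y))) -
          α (crd d x₀ y) (crdDeriv d x₀ y a) •
            fr.endRep Θ (crd d x₀ y) (g (crd d x₀ y) (r (crd d x₀ y)))) := h6
    have h7' : h (crd d x₀ y) (fr.endRep Θ (crd d x₀ y) (g (crd d x₀ y) (r (crd d x₀ y)))) =
        fr.endRep Θ (crd d x₀ x₀) (r (crd d x₀ y)) := h7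
    rw [h6', _root_.map_neg, _root_.map_sub, _root_.map_smul, h7']
    change _ = fderiv ℝ r (crd d x₀ y) (crdDeriv d x₀ y a) +
      α (crd d x₀ y) (crdDeriv d x₀ y a) • fr.endRep Θ (crd d x₀ x₀) (r (crd d x₀ y))
    abel
  · have h1 := DFunLike.congr_fun (hU y hy).1.2.2.2.2.2.2 (h (crd d x₀ y) (fr.τ y v))
    have h2 : h (crd d x₀ y) (fr.endRep Θ (crd d x₀ y) (g (crd d x₀ y)
      (h (crd d x₀ y) (fr.τ y v)))) = fr.endRep Θ (crd d x₀ x₀) (h (crd d x₀ y) (fr.τ y v)) := h1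
    rw [hgh1 y hy, fr.endRep_crd (hU y hy).2, fr.left_inv y (hU y hy).2] at h2
    exact h2

end NormalFrames

/-! ### The complex in a normal frame -/

section Complex

open Filter

universe u₁ v₁ w₁

variable {d : ℕ} {M : Type u₁} [TopologicalSpace M]
  [ChartedSpace (EuclideanSpace ℝ (Fin d)) M] [IsManifold (𝓡 d) ∞ M]
  {F : Type w₁} [NormedAddCommGroup F] [NormedSpace ℝ F]
  {V : M → Type v₁} [TopologicalSpace (TotalSpace F V)]
  [∀ x, AddCommGroup (V x)] [∀ x, Module ℝ (V x)] [∀ x, TopologicalSpace (V x)]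
  [∀ x, IsTopologicalAddGroup (V x)] [∀ x, ContinuousSMul ℝ (V x)]
  [FiberBundle F V] [VectorBundle ℝ F V] {y : M} {k : ℕ}
  {x₀ : M} {U : Set M} (fr : Frame d F V x₀ U) {cov : CovariantDerivative (𝓡 d) F V}
  {Θ : ∀ x, V x →L[ℝ] V x} {J : SymplecticForm d M}

theorem Frame.formAt_apply (φ : TangentSpace (𝓡 d) y [⋀^Fin k]→L[ℝ] V y)
    (v : Fin k → EuclideanSpace ℝ (Fin d)) :
    fr.formAt φ v = fr.τ y (φ fun i => crdField d x₀ y (v i)) := rfl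

theorem Frame.formAt_add (φ ψ : TangentSpace (𝓡 d) y [⋀^Fin k]→L[ℝ] V y) :
    fr.formAt (φ + ψ) = fr.formAt φ + fr.formAt ψ :=
  ContinuousAlternatingMap.ext fun _ => (fr.τ y).map_add _ _

theorem Frame.formAt_smul (c : ℝ) (φ : TangentSpace (𝓡 d) y [⋀^Fin k]→L[ℝ] V y) :
    fr.formAt (c • φ) = c • fr.formAt φ :=
  ContinuousAlternatingMap.ext fun _ => (fr.τ y).map_smul _ _

/-- The components of a form at a point, as a linear map. -/
def Frame.formAtₗ (k : ℕ) (y : M) : (TangentSpace (𝓡 d) y [⋀^Fin k]→L[ℝ] V y) →ₗ[ℝ]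
    EuclideanSpace ℝ (Fin d) [⋀^Fin k]→L[ℝ] F where
  toFun := fr.formAt
  map_add' := fr.formAt_add
  map_smul' := fr.formAt_smul

/-- The components of a pair of forms at a point. -/
def Frame.formPairAt (k : ℕ) (y : M) :
    Term d V (k + 1) y →ₗ[ℝ] MTerm (EuclideanSpace ℝ (Fin d)) F (k + 1) :=
  (fr.formAtₗ (k + 1) y).prodMap (fr.formAtₗ k y)

/-- The form at a point with given components. -/
def Frame.ofForm (y : M) (ψ : EuclideanSpace ℝ (Fin d) [⋀^Fin k]→L[ℝ] F) :
    TangentSpace (𝓡 d) y [⋀^Fin k]→L[ℝ] V y :=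
  (fr.τ' y).compContinuousAlternatingMap (ψ.compContinuousLinearMap (crdDeriv d x₀ y))

theorem Frame.ofForm_formAt (hy : y ∈ U) (φ : TangentSpace (𝓡 d) y [⋀^Fin k]→L[ℝ] V y) :
    fr.ofForm y (fr.formAt φ) = φ := by
  refine ContinuousAlternatingMap.ext fun v => ?_
  refine (fr.left_inv y hy _).trans (congrArg φ (funext fun i => ?_))
  exact crdField_crdDeriv (fr.subset hy) (v i)

theorem Frame.formAt_ofForm (hy : y ∈ U) (ψ : EuclideanSpace ℝ (Fin d) [⋀^Fin k]→L[ℝ] F) :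
    fr.formAt (fr.ofForm y ψ) = ψ := by
  refine ContinuousAlternatingMap.ext fun v => ?_
  refine (fr.right_inv y hy _).trans (congrArg ψ (funext fun i => ?_))
  exact crdDeriv_crdField (fr.subset hy) (v i)

theorem Frame.formAt_wedge (hy : y ∈ U) (η : TangentSpace (𝓡 d) y [⋀^Fin k]→L[ℝ] V y) :
    fr.formAt (wedge (J.at y) η) = wedge (J.rep x₀ (crd d x₀ y)) (fr.formAt η) := by
  refine ContinuousAlternatingMap.ext fun v => ?_
  rw [fr.formAt_apply, wedge_apply, wedge_apply, _root_.map_smul, _root_.map_sum]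
  refine congrArg _ (Finset.sum_congr rfl fun i _ => ?_)
  rw [map_zsmul, _root_.map_sum]
  refine congrArg _ (Finset.sum_congr rfl fun j _ => ?_)
  rw [map_zsmul, _root_.map_smul]
  refine congrArg _ (congrArg₂ (fun (r : ℝ) (w : F) => r • w) ?_ rfl)
  rw [← J.rep_crd (fr.subset hy), crdDeriv_crdField (fr.subset hy)]
  exact congrArg (fun w => J.rep x₀ (crd d x₀ y) ![v i, w])
    (crdDeriv_crdField (fr.subset hy) (i.removeNth v j))

/-! ### The coupled exterior derivative in a frame -/

section ExtCov

variable [FiniteDimensional ℝ F] [ContMDiffVectorBundle ∞ F V (𝓡 d)] {fr}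

/-- For commuting fields the exterior derivative is the alternating sum of directional derivatives
without bracket terms; the matrix αT contributes the product with α. -/
theorem Frame.HasConnection.sum_cov {α : EuclideanSpace ℝ (Fin d) → EuclideanSpace ℝ (Fin d) →L[ℝ] ℝ}
    {T : F →L[ℝ] F} (hA : fr.HasConnection cov fun z => (α z).smulRight T) (hy : y ∈ U)
    {φ : ∀ x : M, TangentSpace (𝓡 d) x [⋀^Fin k]→L[ℝ] V x} (hφ : SmoothFormAt d F φ y)
    {X : Fin (k + 1) → ∀ x : M, TangentSpace (𝓡 d) x} (hX : ∀ i, SmoothFieldAt (X i) y)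
    (hb : ∀ i j, VectorField.mlieBracket (𝓡 d) (X i) (X j) y = 0) :
    fr.τ y (∑ i : Fin (k + 1), (-1 : ℤ) ^ (i : ℕ) •
      cov (fun x => φ x (fun j => X (i.succAbove j) x)) y (X i y)) =
      (extDeriv (fr.formRep φ) (crd d x₀ y) + oneWedge (α (crd d x₀ y))
        (T.compContinuousAlternatingMap (fr.formRep φ (crd d x₀ y))))
        fun i => crdDeriv d x₀ y (X i y) := by
  have hyc := fr.subset hy
  have hφ' := (fr.smoothFormAt_iff hy).1 hφ
  have hX' := fun i => (smoothFieldAt_iff hyc).1 (hX i)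
  have hcrd : (fun i => crdDeriv d x₀ y (X i y)) = fun i => fieldRep x₀ (X i) (crd d x₀ y) :=
    funext fun i => (fieldRep_crd hyc (X i)).symm
  have h1 := extDeriv_apply_vectorField_of_pairwise_commute (hφ'.differentiableAt (by simp))
    (fun i => (hX' i).differentiableAt (by simp)) (fun i j _ => by
      exact (mlieBracket_eq_crd hyc (hX i) (hX j)).symm.trans (by rw [hb, _root_.map_zero]))
  rw [ContinuousAlternatingMap.add_apply, hcrd, h1, oneWedge,
    ContinuousAlternatingMap.alternatizeUncurryFin_apply, _root_.map_sum,
    ← Finset.sum_add_distrib]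
  refine Finset.sum_congr rfl fun i _ => ?_
  have hs : SmoothSectionAt d F (fun x => φ x (fun j => X (i.succAbove j) x)) y :=
    smoothFormAt_iff_apply.1 hφ (fun j => X (i.succAbove j)) fun j => hX _
  have h2 := hA y hy _ hs (X i y)
  have h3 : ∀ᶠ z in 𝓝 (crd d x₀ y), fr.rep (fun x => φ x (fun j => X (i.succAbove j) x)) z =
      fr.formRep φ z (i.removeNth fun j => fieldRep x₀ (X j) z) := by
    filter_upwards [fr.eventually hy] with z hz
    exact fr.rep_form_apply (fun j => X (i.succAbove j)) hz
  have h4 : fr.rep (fun x => φ x (fun j => X (i.succAbove j) x)) (crd d x₀ y) =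
    fr.τ y (φ y (fun j => X (i.succAbove j) y)) := fr.rep_crd _ hy
  rw [map_zsmul, h2, ← h4, h3.self_of_nhds, Filter.EventuallyEq.fderiv_eq h3, zsmul_add,
    ← fieldRep_crd hyc]
  rfl

/-- The form on the right satisfies the defining condition, so `extCovDeriv` is not its default
value. The chosen form then agrees with it, because coordinate fields realise all tuples of tangent
vectors with vanishing brackets. -/
theorem Frame.HasConnection.formAt_extCovDeriv
    {α : EuclideanSpace ℝ (Fin d) → EuclideanSpace ℝ (Fin d) →L[ℝ] ℝ}
    {T : F →L[ℝ] F} (hA : fr.HasConnection cov fun z => (α z).smulRight T) (hy : y ∈ U)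
    {φ : ∀ x : M, TangentSpace (𝓡 d) x [⋀^Fin k]→L[ℝ] V x} (hφ : SmoothFormAt d F φ y) :
    fr.formAt (extCovDeriv cov φ y) = ((k : ℝ) + 1)⁻¹ •
      (extDeriv (fr.formRep φ) (crd d x₀ y) + oneWedge (α (crd d x₀ y))
        (T.compContinuousAlternatingMap (fr.formRep φ (crd d x₀ y)))) := by
  have hyc := fr.subset hy
  have hk : ((k : ℝ) + 1) ≠ 0 := by positivity
  set R := extDeriv (fr.formRep φ) (crd d x₀ y) + oneWedge (α (crd d x₀ y))
    (T.compContinuousAlternatingMap (fr.formRep φ (crd d x₀ y))) with hR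
  have hex : ∃ η, IsExtCovDerivAt cov φ y η := by
    refine ⟨fr.ofForm y (((k : ℝ) + 1)⁻¹ • R), fun X hX hb => ?_⟩
    have hX' : ∀ i, SmoothFieldAt (X i) y := fun i => by
      obtain ⟨W, hW, hXW⟩ := hX i
      exact hXW.contMDiffAt hW
    have h := hA.sum_cov hy hφ hX' hb
    rw [← hR] at h
    rw [← fr.left_inv y hy (∑ i : Fin (k + 1), (-1 : ℤ) ^ (i : ℕ) •
        cov (fun y => φ y (fun j => X (i.succAbove j) y)) y (X i y)), h]
    change ((k : ℝ) + 1) • fr.τ' y (((k : ℝ) + 1)⁻¹ • R fun i => crdDeriv d x₀ y (X i y)) = _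
    rw [_root_.map_smul, smul_inv_smul₀ hk]
  have hspec : IsExtCovDerivAt cov φ y (extCovDeriv cov φ y) := by
    rw [extCovDeriv, dif_pos hex]
    exact hex.choose_spec
  refine ContinuousAlternatingMap.ext fun v => ?_
  have hb : ∀ i j, VectorField.mlieBracket (𝓡 d) (fun x => crdField d x₀ x (v i))
      (fun x => crdField d x₀ x (v j)) y = 0 := fun i j =>
    mlieBracket_crdField hyc (Eventually.of_forall fun _ => rfl) (Eventually.of_forall fun _ => rfl)
  have h1 := hspec (fun i x => crdField d x₀ x (v i)) (fun i => ⟨crdDom d x₀,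
    isOpen_crdDom.mem_nhds hyc, (smoothField_iff isOpen_crdDom).2 fun x hx =>
      smoothFieldAt_crdField hx (v i)⟩) hb
  have h2 := hA.sum_cov hy hφ (X := fun i x => crdField d x₀ x (v i))
    (fun i => smoothFieldAt_crdField hyc (v i)) hb
  rw [← h1, _root_.map_smul] at h2
  simp only [crdDeriv_crdField hyc] at h2
  rw [ContinuousAlternatingMap.smul_apply, fr.formAt_apply]
  exact (eq_inv_smul_iff₀ hk).2 h2

end ExtCov

/-! ### Sections of the bundles of the complex -/

variable (d F) in
/-- Smoothness at a point of a section of the bundles of the complex. -/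
def SmoothTermAt : ∀ k : ℕ, (∀ x : M, Term d V k x) → M → Prop
  | 0, s, y => SmoothSectionAt d F (V := V) s y
  | k + 1, s, y => SmoothFormAt d F (k := k + 1) (V := V) (fun x => (s x).1) y ∧
      SmoothFormAt d F (k := k) (V := V) (fun x => (s x).2) y

theorem smoothTerm_iff {W : Set M} (hW : IsOpen W) {s : ∀ x : M, Term d V k x} :
    SmoothTerm d F V k W s ↔ ∀ x ∈ W, SmoothTermAt d F k s x := by
  cases k with
  | zero => exact smoothSection_iff hW
  | succ k =>
    refine (and_congr (smoothForm_iff hW) (smoothForm_iff hW)).trans ⟨fun h x hx => ?_, fun h => ?_⟩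
    · exact ⟨h.1 x hx, h.2 x hx⟩
    · exact ⟨fun x hx => (h x hx).1, fun x hx => (h x hx).2⟩

variable (nf : NormalFrame cov Θ J x₀ U)

/-- The components of an element of the bundles of the complex, adapted to the connection. -/
def NormalFrame.termAt : ∀ (k : ℕ) (y : M), Term d V k y →ₗ[ℝ] MTerm (EuclideanSpace ℝ (Fin d)) F k
  | 0, y => (nf.τ y : V y →ₗ[ℝ] F)
  | k + 1, y => (shear (nf.α (crd d x₀ y)) (k + 1)).toLinearMap.comp
      (nf.formPairAt k y)

/-- The element of the bundles of the complex with given components. -/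
def NormalFrame.ofTerm : ∀ (k : ℕ) (y : M), MTerm (EuclideanSpace ℝ (Fin d)) F k → Term d V k y
  | 0, y => nf.τ' y
  | k + 1, y => fun u =>
      (nf.ofForm y (mfst k ((shear (nf.α (crd d x₀ y)) (k + 1)).symm u)),
        nf.ofForm y (msnd k ((shear (nf.α (crd d x₀ y)) (k + 1)).symm u)))

variable {nf}

theorem NormalFrame.ofTerm_termAt (hy : y ∈ U) (s : Term d V k y) :
    nf.ofTerm k y (nf.termAt k y s) = s := by
  cases k with
  | zero => exact nf.left_inv y hy s
  | succ k =>
    have h := (shear (nf.α (crd d x₀ y)) (k + 1)).symm_apply_apply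
      (mpair (nf.formAt s.1) (nf.formAt s.2))
    refine Prod.ext ?_ ?_
    · exact (congrArg (fun u => nf.ofForm y (mfst k u)) h).trans (nf.ofForm_formAt hy s.1)
    · exact (congrArg (fun u => nf.ofForm y (msnd k u)) h).trans (nf.ofForm_formAt hy s.2)

theorem NormalFrame.termAt_ofTerm (hy : y ∈ U) (u : MTerm (EuclideanSpace ℝ (Fin d)) F k) :
    nf.termAt k y (nf.ofTerm k y u) = u := by
  cases k with
  | zero => exact nf.right_inv y hy u
  | succ k =>
    refine Eq.trans (congrArg (shear (nf.α (crd d x₀ y)) (k + 1)) ?_)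
      ((shear (nf.α (crd d x₀ y)) (k + 1)).apply_symm_apply u)
    exact mterm_ext (nf.formAt_ofForm hy _) (nf.formAt_ofForm hy _)

theorem NormalFrame.termAt_injective (hy : y ∈ U) : Function.Injective (nf.termAt k y) :=
  Function.LeftInverse.injective fun s => nf.ofTerm_termAt hy s

variable (nf) in
/-- The components of a section of the bundles of the complex. -/
def NormalFrame.termRep (k : ℕ) (s : ∀ x : M, Term d V k x) (z : EuclideanSpace ℝ (Fin d)) :
    MTerm (EuclideanSpace ℝ (Fin d)) F k :=
  nf.termAt k (crdInv d x₀ z) (s (crdInv d x₀ z))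

theorem NormalFrame.termRep_crd (hy : y ∈ U) (s : ∀ x : M, Term d V k x) :
    nf.termRep k s (crd d x₀ y) = nf.termAt k y (s y) := by
  rw [NormalFrame.termRep, crdInv_crd (nf.subset hy)]

/-- Only valid near the point: the potential is taken at `crd (crdInv z)`, which is z inside the
chart. -/
theorem NormalFrame.termRep_succ (hy : y ∈ U) (s : ∀ x : M, Term d V (k + 1) x) :
    ∀ᶠ z in 𝓝 (crd d x₀ y), nf.termRep (k + 1) s z = shear (nf.α z) (k + 1)
      (mpair (nf.formRep (fun x => (s x).1) z) (nf.formRep (fun x => (s x).2) z)) := by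
  filter_upwards [eventually_crd_crdInv (nf.subset hy)] with z hz
  have h : nf.termRep (k + 1) s z = shear (nf.α (crd d x₀ (crdInv d x₀ z))) (k + 1)
      (mpair (nf.formRep (fun x => (s x).1) z) (nf.formRep (fun x => (s x).2) z)) := rfl
  rw [h, hz]

variable [FiniteDimensional ℝ F] [ContMDiffVectorBundle ∞ F V (𝓡 d)]

theorem NormalFrame.smoothTermAt_iff (hy : y ∈ U) {s : ∀ x : M, Term d V k x} :
    SmoothTermAt d F k s y ↔ ContDiffAt ℝ ∞ (nf.termRep k s) (crd d x₀ y) := by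
  cases k with
  | zero => exact nf.smooth_iff y hy s
  | succ k =>
    rw [contDiffAt_congr_iff (nf.termRep_succ hy s), contDiffAt_mterm_iff]
    refine (and_congr (nf.smoothFormAt_iff hy) (nf.smoothFormAt_iff hy)).trans ?_
    refine and_congr_left fun h2 => ?_
    have h3 : ContDiffAt ℝ ∞ (fun z => shearCoeff k • oneWedge (nf.α z)
        (nf.formRep (fun x => (s x).2) z)) (crd d x₀ y) :=
      (contDiffAt_oneWedge nf.contDiff_α.contDiffAt h2).const_smul _
    refine ⟨fun h => h.add h3, fun h => ?_⟩
    have h4 := h.sub h3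
    refine h4.congr_of_eventuallyEq (Eventually.of_forall fun z => ?_)
    exact (add_sub_cancel_right _ _).symm

theorem NormalFrame.formAt_comp_Θ (hy : y ∈ U) (φ : TangentSpace (𝓡 d) y [⋀^Fin k]→L[ℝ] V y) :
    nf.formAt ((Θ y).compContinuousAlternatingMap φ) =
      nf.T.compContinuousAlternatingMap (nf.formAt φ) :=
  ContinuousAlternatingMap.ext fun _ => nf.τ_Θ y hy _

/-- The bridge from the manifold to the model: in sheared components of a normal frame the twisted
operators are those of the cone of the constant endomorphism T. -/
theorem NormalFrame.termAt_twistedD (hy : y ∈ U) {s : ∀ x : M, Term d V k x}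
    (hs : SmoothTermAt d F k s y) : nf.termAt (k + 1) y (twistedD J cov Θ k s y) =
      modelD nf.T k (nf.termRep k s) (crd d x₀ y) := by
  cases k with
  | zero =>
    have h := modelD_zero_shear nf.T (nf.α (crd d x₀ y)) (nf.rep s) (crd d x₀ y)
    refine Eq.trans (congrArg (shear (nf.α (crd d x₀ y)) 1) ?_) h.symm
    refine mterm_ext ?_ ?_
    · refine ContinuousAlternatingMap.ext fun v => ?_
      refine (nf.connection y hy s hs _).trans ?_
      exact congrArg₂ (fun (b : EuclideanSpace ℝ (Fin d)) (w : F) =>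
        fderiv ℝ (nf.rep s) (crd d x₀ y) b + nf.α (crd d x₀ y) b • nf.T w)
        (crdDeriv_crdField (nf.subset hy) (v 0)) (nf.rep_crd (s : ∀ x, V x) hy).symm
    · refine ContinuousAlternatingMap.ext fun v => ?_
      refine (nf.τ_Θ y hy _).trans ?_
      exact congrArg nf.T (nf.rep_crd (s : ∀ x, V x) hy).symm
  | succ k =>
    have h1 := (nf.smoothFormAt_iff hy).1 hs.1
    have h2 := (nf.smoothFormAt_iff hy).1 hs.2
    have h := modelD_shear nf.T nf.contDiff_α.contDiffAt h1 h2 (nf.potential y hy)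
    rw [modelD_congr (nf.termRep_succ hy s), h]
    have hc : ((k + 1 : ℕ) : ℝ) + 1 = (k : ℝ) + 2 := by
      push_cast
      ring
    refine congrArg (shear (nf.α (crd d x₀ y)) (k + 2)) (mterm_ext ?_ ?_)
    · refine (nf.formAt_add _ _).trans ?_
      rw [nf.formAt_smul, nf.formAt_wedge hy, nf.connection.formAt_extCovDeriv hy hs.1, hc,
        nf.formRep_crd hy, nf.formRep_crd hy]
      rfl
    · refine (nf.formAt_add _ _).trans ?_
      rw [nf.formAt_smul, nf.formAt_comp_Θ hy, nf.connection.formAt_extCovDeriv hy hs.2,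
        nf.formRep_crd hy, nf.formRep_crd hy]
      rfl

end Complex

/-! ### The complex is elliptic and locally exact -/

section Elliptic

open Filter

universe u₁ v₁ w₁

variable {d : ℕ} {M : Type u₁} [TopologicalSpace M]
  [ChartedSpace (EuclideanSpace ℝ (Fin d)) M] [IsManifold (𝓡 d) ∞ M]
  {F : Type w₁} [NormedAddCommGroup F] [NormedSpace ℝ F] [FiniteDimensional ℝ F]
  {V : M → Type v₁} [TopologicalSpace (TotalSpace F V)]
  [∀ x, AddCommGroup (V x)] [∀ x, Module ℝ (V x)] [∀ x, TopologicalSpace (V x)]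
  [∀ x, IsTopologicalAddGroup (V x)] [∀ x, ContinuousSMul ℝ (V x)]
  [FiberBundle F V] [VectorBundle ℝ F V] [ContMDiffVectorBundle ∞ F V (𝓡 d)] {y : M} {k : ℕ}
  {x₀ : M} {U : Set M} {cov : CovariantDerivative (𝓡 d) F V}
  {Θ : ∀ x, V x →L[ℝ] V x} {J : SymplecticForm d M} {nf : NormalFrame cov Θ J x₀ U}

theorem NormalFrame.eventually_termRep {s : ∀ x : M, Term d V k x} (hy : y ∈ U)
    (hs : ∀ᶠ x in 𝓝 y, SmoothTermAt d F k s x) :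
    ∀ᶠ z in 𝓝 (crd d x₀ y), ContDiffAt ℝ ∞ (nf.termRep k s) z := by
  filter_upwards [eventually_crd_crdInv (nf.subset hy), (eventually_crdInv_iff (nf.subset hy)).2
    (hs.and (nf.isOpen.mem_nhds hy))] with z h1 h2
  rw [← h1]
  exact (nf.smoothTermAt_iff h2.2).1 h2.1

theorem NormalFrame.termRep_twistedD {s : ∀ x : M, Term d V k x} (hy : y ∈ U)
    (hs : ∀ᶠ x in 𝓝 y, SmoothTermAt d F k s x) : ∀ᶠ z in 𝓝 (crd d x₀ y),
      nf.termRep (k + 1) (twistedD J cov Θ k s) z = modelD nf.T k (nf.termRep k s) z := by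
  filter_upwards [eventually_crd_crdInv (nf.subset hy), (eventually_crdInv_iff (nf.subset hy)).2
    (hs.and (nf.isOpen.mem_nhds hy))] with z h1 h2
  exact (nf.termAt_twistedD h2.2 h2.1).trans (by rw [h1])

theorem NormalFrame.termRep_congr (hy : y ∈ U) {s t : ∀ x : M, Term d V k x}
    (h : ∀ᶠ x in 𝓝 y, s x = t x) : nf.termRep k s =ᶠ[𝓝 (crd d x₀ y)] nf.termRep k t := by
  filter_upwards [(eventually_crdInv_iff (nf.subset hy)).2 h] with z hz
  rw [NormalFrame.termRep, hz, NormalFrame.termRep]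

theorem NormalFrame.smoothTermAt_smul (nf : NormalFrame cov Θ J x₀ U) (hy : y ∈ U) {f : M → ℝ}
    (hf : ContMDiffAt (𝓡 d) 𝓘(ℝ, ℝ) ∞ f y)
    {s : ∀ x : M, Term d V k x} (hs : SmoothTermAt d F k s y) :
    SmoothTermAt d F k (fun x => f x • s x) y := by
  rw [nf.smoothTermAt_iff hy] at hs ⊢
  rw [contMDiffAt_iff_crd (nf.subset hy)] at hf
  refine (hf.smul hs).congr_of_eventuallyEq (Eventually.of_forall fun z => ?_)
  exact _root_.map_smul _ _ _

/-- The product rule for the operator. Homogeneity, the order bound and the principal symbol are all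
special cases. -/
theorem NormalFrame.termAt_twistedD_smul (hy : y ∈ U) {f : M → ℝ}
    (hf : ContMDiffAt (𝓡 d) 𝓘(ℝ, ℝ) ∞ f y) {s : ∀ x : M, Term d V k x}
    (hs : SmoothTermAt d F k s y) :
    nf.termAt (k + 1) y (twistedD J cov Θ k (fun x => f x • s x) y) =
      f y • nf.termAt (k + 1) y (twistedD J cov Θ k s y) + modelSymbol k
        ((fderiv ℝ (fun z => f (crdInv d x₀ z)) (crd d x₀ y)).smulRight (nf.termAt k y (s y))) := by
  rw [nf.termAt_twistedD hy (nf.smoothTermAt_smul hy hf hs), nf.termAt_twistedD hy hs]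
  have h1 : nf.termRep k (fun x => f x • s x) =
      fun z => f (crdInv d x₀ z) • nf.termRep k s z := funext fun z => _root_.map_smul _ _ _
  rw [h1, modelD_smul (((contMDiffAt_iff_crd (nf.subset hy)).1 hf).differentiableAt (by simp))
    (((nf.smoothTermAt_iff hy).1 hs).differentiableAt (by simp)), crdInv_crd (nf.subset hy),
    nf.termRep_crd hy]

theorem NormalFrame.termAt_twistedD_add (hy : y ∈ U) {s t : ∀ x : M, Term d V k x}
    (hs : SmoothTermAt d F k s y) (ht : SmoothTermAt d F k t y) :
    nf.termAt (k + 1) y (twistedD J cov Θ k (s + t) y) =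
      nf.termAt (k + 1) y (twistedD J cov Θ k s y) +
        nf.termAt (k + 1) y (twistedD J cov Θ k t y) := by
  have hs' := (nf.smoothTermAt_iff hy).1 hs
  have ht' := (nf.smoothTermAt_iff hy).1 ht
  have h1 : nf.termRep k (s + t) = fun z => nf.termRep k s z + nf.termRep k t z :=
    funext fun z => _root_.map_add _ _ _
  have hst : SmoothTermAt d F k (s + t) y := by
    rw [nf.smoothTermAt_iff hy, h1]
    exact hs'.add ht'
  rw [nf.termAt_twistedD hy hst, nf.termAt_twistedD hy hs, nf.termAt_twistedD hy ht, h1,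
    modelD_add (hs'.differentiableAt (by simp)) (ht'.differentiableAt (by simp))]

theorem NormalFrame.twistedD_congr (nf : NormalFrame cov Θ J x₀ U) (hy : y ∈ U)
    {s t : ∀ x : M, Term d V k x} (hs : SmoothTermAt d F k s y) (ht : SmoothTermAt d F k t y)
    (h : ∀ᶠ x in 𝓝 y, s x = t x) : twistedD J cov Θ k s y = twistedD J cov Θ k t y := by
  refine nf.termAt_injective hy ?_
  rw [nf.termAt_twistedD hy hs, nf.termAt_twistedD hy ht, modelD_congr (nf.termRep_congr hy h)]

theorem isFirstOrderOperator_twistedD (hnf : ∀ x₀, ∃ U, Nonempty (NormalFrame cov Θ J x₀ U))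
    (k : ℕ) : IsFirstOrderOperator d (SmoothTerm d F V k) (SmoothTerm d F V (k + 1))
      (twistedD J cov Θ k) where
  smooth W s hW hs := by
    rw [smoothTerm_iff hW] at hs ⊢
    intro x hx
    obtain ⟨U, ⟨nf⟩⟩ := hnf x
    have hs' : ∀ᶠ y in 𝓝 x, SmoothTermAt d F k s y := by
      filter_upwards [hW.mem_nhds hx] with y hy using hs y hy
    rw [nf.smoothTermAt_iff nf.mem]
    exact (contDiffAt_modelD ((nf.smoothTermAt_iff nf.mem).1 (hs x hx))).congr_of_eventuallyEq
      (nf.termRep_twistedD nf.mem hs')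
  congr W s t hW hs ht h x hx := by
    rw [smoothTerm_iff hW] at hs ht
    obtain ⟨U, ⟨nf⟩⟩ := hnf x
    exact nf.twistedD_congr nf.mem (hs x hx) (ht x hx)
      (by filter_upwards [hW.mem_nhds hx] with y hy using h y hy)
  add W s t hW hs ht x hx := by
    rw [smoothTerm_iff hW] at hs ht
    obtain ⟨U, ⟨nf⟩⟩ := hnf x
    refine nf.termAt_injective nf.mem ?_
    rw [nf.termAt_twistedD_add nf.mem (hs x hx) (ht x hx), _root_.map_add]
  smul W c s hW hs x hx := by
    rw [smoothTerm_iff hW] at hs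
    obtain ⟨U, ⟨nf⟩⟩ := hnf x
    refine nf.termAt_injective nf.mem ?_
    refine (nf.termAt_twistedD_smul nf.mem (f := fun _ => c) contMDiffAt_const (hs x hx)).trans ?_
    rw [fderiv_fun_const, _root_.map_smul]
    have h0 : (0 : EuclideanSpace ℝ (Fin d) →L[ℝ] ℝ).smulRight (nf.termAt k x (s x)) = 0 := by
      ext
      simp
    have h1 : modelSymbol k ((0 : EuclideanSpace ℝ (Fin d) →L[ℝ] ℝ).smulRight
        (nf.termAt k x (s x))) = 0 := by rw [h0, _root_.map_zero]
    exact (congrArg _ h1).trans (add_zero _)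
  -- After the product rule the values of D s cancel, and the symbol terms cancel by d(fg) = f dg +
  -- g df.
  order W f g s hW hf hg hs x hx := by
    rw [smoothTerm_iff hW] at hs
    obtain ⟨U, ⟨nf⟩⟩ := hnf x
    have hf' := (contMDiffOn_iff_of_isOpen hW).1 hf x hx
    have hg' := (contMDiffOn_iff_of_isOpen hW).1 hg x hx
    refine nf.termAt_injective nf.mem ?_
    rw [_root_.map_add, _root_.map_sub, _root_.map_sub, _root_.map_smul, _root_.map_smul,
      _root_.map_smul, nf.termAt_twistedD_smul nf.mem hf' (hs x hx),
      nf.termAt_twistedD_smul nf.mem hg' (hs x hx),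
      nf.termAt_twistedD_smul nf.mem (f := fun y => f y * g y) (hf'.mul hg') (hs x hx),
      _root_.map_zero]
    have hf1 := ((contMDiffAt_iff_crd (nf.subset nf.mem)).1 hf').differentiableAt (by simp)
    have hg1 := ((contMDiffAt_iff_crd (nf.subset nf.mem)).1 hg').differentiableAt (by simp)
    have h1 : (fderiv ℝ (fun z => f (crdInv d x z) * g (crdInv d x z)) (crd d x x)).smulRight
        (nf.termAt k x (s x)) =
        f x • (fderiv ℝ (fun z => g (crdInv d x z)) (crd d x x)).smulRight (nf.termAt k x (s x)) +
        g x • (fderiv ℝ (fun z => f (crdInv d x z)) (crd d x x)).smulRight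
          (nf.termAt k x (s x)) := by
      rw [fderiv_fun_mul hf1 hg1, crdInv_crd (nf.subset nf.mem)]
      ext a
      simp [add_smul, mul_smul]
    rw [h1, _root_.map_add, _root_.map_smul, _root_.map_smul]
    module

variable (nf) in
/-- The principal symbol. -/
def NormalFrame.symbolAt (y : M) (ξ : TangentSpace (𝓡 d) y →L[ℝ] ℝ) (k : ℕ) :
    Term d V k y →ₗ[ℝ] MTerm (EuclideanSpace ℝ (Fin d)) F (k + 1) :=
  (modelSymbol k).toLinearMap.comp
    ((ContinuousLinearMap.smulRightL ℝ (EuclideanSpace ℝ (Fin d))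
      (MTerm (EuclideanSpace ℝ (Fin d)) F k) (ξ.comp (crdField d x₀ y))).toLinearMap.comp
      (nf.termAt k y))

/-- The symbol is the model symbol conjugated by the fibrewise isomorphisms `e`, with ξ read in
coordinates; exactness is inherited. -/
theorem NormalFrame.exists_symbol (nf : NormalFrame cov Θ J x₀ U) (hy : y ∈ U)
    {ξ : TangentSpace (𝓡 d) y →L[ℝ] ℝ} (hξ : ξ ≠ 0) :
    ∃ σ : ∀ k, Term d V k y →ₗ[ℝ] Term d V (k + 1) y,
      (∀ k, IsPrincipalSymbol (SmoothTerm d F V k) (twistedD J cov Θ k) y ξ (σ k)) ∧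
      Function.Injective (σ 0) ∧ ∀ k, Function.Exact (σ k) (σ (k + 1)) := by
  let e : ∀ k, Term d V k y ≃ₗ[ℝ] MTerm (EuclideanSpace ℝ (Fin d)) F k := fun k =>
    LinearEquiv.ofBijective (nf.termAt k y) ⟨nf.termAt_injective hy, fun u =>
      ⟨nf.ofTerm k y u, nf.termAt_ofTerm hy u⟩⟩
  let ζ : EuclideanSpace ℝ (Fin d) →L[ℝ] ℝ := ξ.comp (crdField d x₀ y)
  have hζ : ζ ≠ 0 := fun h => hξ (ContinuousLinearMap.ext fun a => by
    have := DFunLike.congr_fun h (crdDeriv d x₀ y a)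
    rw [← crdField_crdDeriv (nf.subset hy) a]
    exact this)
  have hσ : ∀ k v, e (k + 1) ((e (k + 1)).symm (nf.symbolAt y ξ k v)) =
      modelSymbol k (ζ.smulRight (e k v)) := fun k v => (e (k + 1)).apply_symm_apply _
  refine ⟨fun k => (e (k + 1)).symm.toLinearMap.comp (nf.symbolAt y ξ k), fun k => ?_, ?_,
    fun k v => ⟨fun hv => ?_, ?_⟩⟩
  · intro W f s hW hyW hf hf0 hfξ hs
    rw [smoothTerm_iff hW] at hs
    have hf' := (contMDiffOn_iff_of_isOpen hW).1 hf y hyW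
    refine (e (k + 1)).injective (Eq.trans ?_ (hσ k (s y)).symm)
    refine (nf.termAt_twistedD_smul hy hf' (hs y hyW)).trans ?_
    rw [hf0, zero_smul, zero_add]
    congr 2
    refine ContinuousLinearMap.ext fun a => ?_
    have h1 := mvfderiv_eq_crd (nf.subset hy) hf' (crdField d x₀ y a)
    rw [crdDeriv_crdField (nf.subset hy)] at h1
    rw [← h1, hfξ]
    rfl
  · refine (injective_iff_map_eq_zero _).2 fun v hv => ?_
    have h1 := hσ 0 v
    rw [show (e 1).symm (nf.symbolAt y ξ 0 v) = 0 from hv, _root_.map_zero] at h1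
    exact (map_eq_zero_iff _ (e 0).injective).1 (modelSymbol_injective hζ h1.symm)
  · have h1 := hσ (k + 1) v
    rw [show (e (k + 2)).symm (nf.symbolAt y ξ (k + 1) v) = 0 from hv, _root_.map_zero] at h1
    obtain ⟨u, hu⟩ := modelSymbol_exact hζ h1.symm
    refine ⟨(e k).symm u, (e (k + 1)).injective ?_⟩
    refine (hσ k _).trans ?_
    rw [(e k).apply_symm_apply, hu]
  · rintro ⟨u, rfl⟩
    refine (e (k + 2)).injective ((hσ (k + 1) _).trans ?_)
    have h2 : e (k + 1) ((e (k + 1)).symm (nf.symbolAt y ξ k u)) = _ := hσ k u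
    rw [_root_.map_zero]
    exact (congrArg (fun w => modelSymbol (k + 1) (ζ.smulRight w)) h2).trans (modelSymbol_comp ζ _)

theorem isEllipticComplex_twistedD (hnf : ∀ x₀, ∃ U, Nonempty (NormalFrame cov Θ J x₀ U)) :
    IsEllipticComplex d (SmoothTerm d F V) (twistedD J cov Θ) where
  operator := isFirstOrderOperator_twistedD hnf
  comp_eq_zero k W s hW hs x hx := by
    have hDs := (isFirstOrderOperator_twistedD hnf k).smooth W s hW hs
    rw [smoothTerm_iff hW] at hs hDs
    obtain ⟨U, ⟨nf⟩⟩ := hnf x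
    have hs' : ∀ᶠ y in 𝓝 x, SmoothTermAt d F k s y := by
      filter_upwards [hW.mem_nhds hx] with y hy using hs y hy
    refine nf.termAt_injective nf.mem ?_
    rw [nf.termAt_twistedD nf.mem (hDs x hx), modelD_congr (nf.termRep_twistedD nf.mem hs'),
      modelD_modelD nf.T (nf.eventually_termRep nf.mem hs'), _root_.map_zero]
  elliptic x ξ hξ := by
    obtain ⟨U, ⟨nf⟩⟩ := hnf x
    exact nf.exists_symbol nf.mem hξ

/-- A section given by its components. -/
theorem NormalFrame.exists_section (nf : NormalFrame cov Θ J x₀ U)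
    {g : EuclideanSpace ℝ (Fin d) → MTerm (EuclideanSpace ℝ (Fin d)) F k} (hg : ContDiff ℝ ∞ g) :
    ∃ t : ∀ x : M, Term d V k x, (∀ x ∈ U, SmoothTermAt d F k t x) ∧
      ∀ x ∈ U, nf.termAt k x (t x) = g (crd d x₀ x) ∧
        nf.termAt (k + 1) x (twistedD J cov Θ k t x) = modelD nf.T k g (crd d x₀ x) := by
  have h1 : ∀ x ∈ U, nf.termRep k (fun x => nf.ofTerm k x (g (crd d x₀ x)))
      =ᶠ[𝓝 (crd d x₀ x)] g := fun x hx => by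
    filter_upwards [nf.eventually hx, eventually_crd_crdInv (nf.subset hx)] with z h1 h2
    rw [NormalFrame.termRep, nf.termAt_ofTerm h1, h2]
  have h2 : ∀ x ∈ U, SmoothTermAt d F k (fun x => nf.ofTerm k x (g (crd d x₀ x))) x :=
    fun x hx => (nf.smoothTermAt_iff hx).2 (hg.contDiffAt.congr_of_eventuallyEq (h1 x hx))
  refine ⟨fun x => nf.ofTerm k x (g (crd d x₀ x)), h2, fun x hx => ⟨nf.termAt_ofTerm hx _, ?_⟩⟩
  rw [nf.termAt_twistedD hx (h2 x hx), modelD_congr (h1 x hx)]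

theorem NormalFrame.exactNear (nf : NormalFrame cov Θ J x₀ U) (hy : y ∈ U)
    {s : ∀ x : M, Term d V (k + 1) x}
    {g : EuclideanSpace ℝ (Fin d) → MTerm (EuclideanSpace ℝ (Fin d)) F k} (hg : ContDiff ℝ ∞ g)
    (h : ∀ᶠ z in 𝓝 (crd d x₀ y), modelD nf.T k g z = nf.termRep (k + 1) s z) :
    ExactNear (SmoothTerm d F V) (twistedD J cov Θ) k y s := by
  obtain ⟨t, ht, htg⟩ := nf.exists_section hg
  obtain ⟨W, hW, hWo, hyW⟩ := eventually_nhds_iff.1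
    (((eventually_crd_iff (nf.subset hy)).2 h).and (nf.isOpen.mem_nhds hy))
  refine ⟨W, t, hWo, hyW, (smoothTerm_iff hWo).2 fun x hx => ht x (hW x hx).2, fun x hx => ?_⟩
  refine nf.termAt_injective (hW x hx).2 ?_
  rw [(htg x (hW x hx).2).2, (hW x hx).1, nf.termRep_crd (hW x hx).2]

theorem NormalFrame.eventually_modelD_eq_zero (nf : NormalFrame cov Θ J x₀ U) (hy : y ∈ U)
    {W : Set M} (hW : IsOpen W) (hyW : y ∈ W) {s : ∀ x : M, Term d V k x}
    (hs : Closed (SmoothTerm d F V) (twistedD J cov Θ) k W s) :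
    (∀ᶠ z in 𝓝 (crd d x₀ y), ContDiffAt ℝ ∞ (nf.termRep k s) z) ∧
      ∀ᶠ z in 𝓝 (crd d x₀ y), modelD nf.T k (nf.termRep k s) z = 0 := by
  have hs' : ∀ᶠ x in 𝓝 y, SmoothTermAt d F k s x := by
    filter_upwards [hW.mem_nhds hyW] with x hx using (smoothTerm_iff hW).1 hs.1 x hx
  refine ⟨nf.eventually_termRep hy hs', ?_⟩
  filter_upwards [nf.termRep_twistedD hy hs',
    (eventually_crdInv_iff (nf.subset hy)).2 (hW.mem_nhds hyW)] with z h1 h2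
  rw [← h1, NormalFrame.termRep, hs.2 _ h2, _root_.map_zero]

/-- The index k + 1 refers to the source of the operator; the sections themselves have degree k + 2.
-/
theorem locallyExact_twistedD (hnf : ∀ x₀, ∃ U, Nonempty (NormalFrame cov Θ J x₀ U)) (k : ℕ) :
    LocallyExact (SmoothTerm d F V) (twistedD J cov Θ) (k + 1) := by
  intro W s hW hs x hx
  have : CompleteSpace F := FiniteDimensional.complete ℝ F
  obtain ⟨U, ⟨nf⟩⟩ := hnf x
  obtain ⟨h1, h2⟩ := nf.eventually_modelD_eq_zero nf.mem hW hx hs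
  obtain ⟨g, hg, hgs⟩ := modelD_exact nf.T h1 h2
  exact nf.exactNear nf.mem hg hgs

end Elliptic

/-! ### Families of vector spaces with flat charts -/

section FlatCharts

open Filter

universe u₁ v₁

variable {d : ℕ} {M : Type u₁} [TopologicalSpace M]
  [ChartedSpace (EuclideanSpace ℝ (Fin d)) M] [IsManifold (𝓡 d) ∞ M]
  {W : M → Type v₁} [∀ x, AddCommGroup (W x)] [∀ x, Module ℝ (W x)]

/-- A trivialisation of the fibres `W x` over a neighbourhood of `x₀` in the domain of the
coordinates around `x₀`, in which `σ s y` is smoothness of the section `s` near `y` and in which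
`D` is differentiation of the components. -/
structure FlatChart (σ : (∀ x, W x) → M → Prop)
    (D : (∀ x, W x) → ∀ x, TangentSpace (𝓡 d) x →ₗ[ℝ] W x) (x₀ : M) (U : Set M) where
  isOpen : IsOpen U
  mem : x₀ ∈ U
  subset : U ⊆ crdDom d x₀
  /-- The rank. -/
  m : ℕ
  /-- The components of a vector. -/
  κ : ∀ y, W y →ₗ[ℝ] (Fin m → ℝ)
  bijective : ∀ y ∈ U, Function.Bijective (κ y)
  smooth_iff : ∀ y ∈ U, ∀ s, σ s y ↔
    ∀ᶠ z in 𝓝 (crd d x₀ y), ContDiffAt ℝ ∞ (fun z => κ (crdInv d x₀ z) (s (crdInv d x₀ z))) z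
  deriv : ∀ y ∈ U, ∀ s, σ s y → ∀ a, κ y (D s y a) =
    fderiv ℝ (fun z => κ (crdInv d x₀ z) (s (crdInv d x₀ z))) (crd d x₀ y) (crdDeriv d x₀ y a)

variable {σ : (∀ x, W x) → M → Prop}
  {D : (∀ x, W x) → ∀ x, TangentSpace (𝓡 d) x →ₗ[ℝ] W x} {x₀ y : M} {U : Set M}
  (ch : FlatChart σ D x₀ U) {s t : ∀ x, W x}

namespace FlatChart

include ch

/-- The components of a section. -/
def rep (s : ∀ x, W x) (z : EuclideanSpace ℝ (Fin d)) : Fin ch.m → ℝ :=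
  ch.κ (crdInv d x₀ z) (s (crdInv d x₀ z))

theorem rep_crd (hy : y ∈ U) (s : ∀ x, W x) : ch.rep s (crd d x₀ y) = ch.κ y (s y) := by
  rw [rep, crdInv_crd (ch.subset hy)]

theorem eventually (hy : y ∈ U) : ∀ᶠ z in 𝓝 (crd d x₀ y), crdInv d x₀ z ∈ U :=
  (eventually_crdInv_iff (ch.subset hy)).2 (ch.isOpen.mem_nhds hy)

theorem contDiffAt_rep (hy : y ∈ U) (hs : σ s y) : ContDiffAt ℝ ∞ (ch.rep s) (crd d x₀ y) :=
  ((ch.smooth_iff y hy s).1 hs).self_of_nhds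

theorem differentiableAt_rep (hy : y ∈ U) (hs : σ s y) :
    DifferentiableAt ℝ (ch.rep s) (crd d x₀ y) :=
  (ch.contDiffAt_rep hy hs).differentiableAt (by simp)

theorem κ_D (hy : y ∈ U) (hs : σ s y) (a : TangentSpace (𝓡 d) y) :
    ch.κ y (D s y a) = fderiv ℝ (ch.rep s) (crd d x₀ y) (crdDeriv d x₀ y a) :=
  ch.deriv y hy s hs a

theorem rep_congr (hy : y ∈ U) (h : ∀ᶠ x in 𝓝 y, s x = t x) :
    ch.rep s =ᶠ[𝓝 (crd d x₀ y)] ch.rep t := by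
  filter_upwards [(eventually_crdInv_iff (ch.subset hy)).2 h] with z hz
  rw [rep, rep, hz]

theorem eventually_smooth (hy : y ∈ U) (hs : σ s y) : ∀ᶠ x in 𝓝 y, σ s x := by
  have h := ((ch.smooth_iff y hy s).1 hs).eventually_nhds
  filter_upwards [(eventually_crd_iff (ch.subset hy)).2 h, ch.isOpen.mem_nhds hy] with x h1 h2
  exact (ch.smooth_iff x h2 s).2 h1

theorem rep_D (hy : y ∈ U) (hs : σ s y) (X : ∀ x : M, TangentSpace (𝓡 d) x) :
    ∀ᶠ z in 𝓝 (crd d x₀ y), ch.rep (fun x => D s x (X x)) z =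
      fderiv ℝ (ch.rep s) z (fieldRep x₀ X z) := by
  filter_upwards [eventually_crd_crdInv (ch.subset hy), (eventually_crdInv_iff (ch.subset hy)).2
    ((ch.eventually_smooth hy hs).and (ch.isOpen.mem_nhds hy))] with z h1 h2
  refine (ch.κ_D h2.2 h2.1 _).trans ?_
  rw [h1]
  rfl

theorem smooth_D (hy : y ∈ U) (hs : σ s y) {X : ∀ x : M, TangentSpace (𝓡 d) x}
    (hX : ∀ᶠ x in 𝓝 y, SmoothFieldAt X x) : σ (fun x => D s x (X x)) y := by
  refine (ch.smooth_iff y hy _).2 ?_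
  filter_upwards [(ch.rep_D hy hs X).eventually_nhds, (ch.smooth_iff y hy s).1 hs,
    eventually_crd_crdInv (ch.subset hy), (eventually_crdInv_iff (ch.subset hy)).2
    (hX.and (ch.isOpen.mem_nhds hy))] with z h1 h2 h3 h4
  have h5 := (smoothFieldAt_iff (ch.subset h4.2)).1 h4.1
  rw [h3] at h5
  exact ((h2.fderiv_right (m := ∞) (by simp)).clm_apply h5).congr_of_eventuallyEq h1

theorem add (hy : y ∈ U) (hs : σ s y) (ht : σ t y) : D (s + t) y = D s y + D t y := by
  have h1 : ch.rep (s + t) = fun z => ch.rep s z + ch.rep t z :=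
    funext fun z => _root_.map_add _ _ _
  have hst : σ (s + t) y := by
    refine (ch.smooth_iff y hy _).2 ?_
    filter_upwards [(ch.smooth_iff y hy s).1 hs, (ch.smooth_iff y hy t).1 ht] with z h2 h3
    exact (h2.add h3).congr_of_eventuallyEq (Eventually.of_forall (congrFun h1))
  ext a
  refine (ch.bijective y hy).1 ?_
  rw [LinearMap.add_apply, _root_.map_add, ch.κ_D hy hst, ch.κ_D hy hs, ch.κ_D hy ht, h1,
    fderiv_fun_add (ch.differentiableAt_rep hy hs) (ch.differentiableAt_rep hy ht)]
  rfl

theorem leibniz (hy : y ∈ U) (hs : σ s y) {f : M → ℝ}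
    (hf : ∀ᶠ x in 𝓝 y, ContMDiffAt (𝓡 d) 𝓘(ℝ, ℝ) ∞ f x) (a : TangentSpace (𝓡 d) y) :
    D (fun x => f x • s x) y a = f y • D s y a + mvfderiv (𝓡 d) f y a • s y := by
  have h1 : ch.rep (fun x => f x • s x) = fun z => f (crdInv d x₀ z) • ch.rep s z :=
    funext fun z => _root_.map_smul _ _ _
  have hfs : σ (fun x => f x • s x) y := by
    refine (ch.smooth_iff y hy _).2 ?_
    filter_upwards [(ch.smooth_iff y hy s).1 hs, eventually_crd_crdInv (ch.subset hy),
      (eventually_crdInv_iff (ch.subset hy)).2 (hf.and (ch.isOpen.mem_nhds hy))] with z h2 h3 h4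
    have h5 := (contMDiffAt_iff_crd (ch.subset h4.2)).1 h4.1
    rw [h3] at h5
    exact (h5.smul h2).congr_of_eventuallyEq (Eventually.of_forall (congrFun h1))
  have hf' := ((contMDiffAt_iff_crd (ch.subset hy)).1 hf.self_of_nhds).differentiableAt (by simp)
  refine (ch.bijective y hy).1 ?_
  rw [_root_.map_add, _root_.map_smul, _root_.map_smul, ch.κ_D hy hfs, ch.κ_D hy hs, h1,
    fderiv_fun_smul hf' (ch.differentiableAt_rep hy hs), crdInv_crd (ch.subset hy),
    ch.rep_crd hy, mvfderiv_eq_crd (ch.subset hy) hf.self_of_nhds]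
  rfl

/-- In components D is the ordinary derivative, so the curvature is the antisymmetric part of a
second derivative. The derivatives of the components of the two fields are absorbed by the bracket.
-/
theorem flat (hy : y ∈ U) (hs : σ s y) {X Y : ∀ x : M, TangentSpace (𝓡 d) x}
    (hX : ∀ᶠ x in 𝓝 y, SmoothFieldAt X x) (hY : ∀ᶠ x in 𝓝 y, SmoothFieldAt Y x) :
    D (fun y => D s y (Y y)) y (X y) - D (fun y => D s y (X y)) y (Y y)
      - D s y (VectorField.mlieBracket (𝓡 d) X Y y) = 0 := by
  have hyc := ch.subset hy
  have hr := ch.contDiffAt_rep hy hs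
  have hr' : DifferentiableAt ℝ (fderiv ℝ (ch.rep s)) (crd d x₀ y) :=
    (hr.fderiv_right (m := ∞) (by simp)).differentiableAt (by simp)
  have key : ∀ {X Y : ∀ x : M, TangentSpace (𝓡 d) x}, (∀ᶠ x in 𝓝 y, SmoothFieldAt Y x) →
      ch.κ y (D (fun y => D s y (Y y)) y (X y)) =
        fderiv ℝ (fderiv ℝ (ch.rep s)) (crd d x₀ y) (fieldRep x₀ X (crd d x₀ y))
          (fieldRep x₀ Y (crd d x₀ y)) + fderiv ℝ (ch.rep s) (crd d x₀ y)
          (fderiv ℝ (fieldRep x₀ Y) (crd d x₀ y) (fieldRep x₀ X (crd d x₀ y))) :=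
      fun {X Y} hY => by
    have hY' := ((smoothFieldAt_iff hyc).1 hY.self_of_nhds).differentiableAt (by simp)
    rw [ch.κ_D hy (ch.smooth_D hy hs hY), Filter.EventuallyEq.fderiv_eq (ch.rep_D hy hs Y),
      ← fieldRep_crd hyc X]
    have h := (hr'.hasFDerivAt.clm_apply hY'.hasFDerivAt).fderiv
    rw [show fderiv ℝ (fun z => fderiv ℝ (ch.rep s) z (fieldRep x₀ Y z)) (crd d x₀ y) = _ from h]
    rw [add_comm]
    rfl
  have hsymm := (hr.isSymmSndFDerivAt (by simpa using two_le_infty)).eq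
    (fieldRep x₀ X (crd d x₀ y)) (fieldRep x₀ Y (crd d x₀ y))
  refine (ch.bijective y hy).1 ?_
  rw [_root_.map_sub, _root_.map_sub, key hY, key hX, ch.κ_D hy hs,
    mlieBracket_eq_crd hyc hX.self_of_nhds hY.self_of_nhds, VectorField.lieBracket, hsymm,
    _root_.map_sub, _root_.map_zero]
  abel

/-- A section with locally constant components is smooth and parallel. -/
theorem parallel_of_eventually (hy : y ∈ U) {c : Fin ch.m → ℝ}
    (h : ∀ᶠ x in 𝓝 y, ch.κ x (s x) = c) : σ s y ∧ D s y = 0 := by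
  have h1 : ∀ᶠ z in 𝓝 (crd d x₀ y), ch.rep s z = c := (eventually_crdInv_iff (ch.subset hy)).2 h
  have hs : σ s y := by
    refine (ch.smooth_iff y hy s).2 ?_
    filter_upwards [h1.eventually_nhds] with z hz
    exact (contDiffAt_const (c := c)).congr_of_eventuallyEq hz
  refine ⟨hs, LinearMap.ext fun a => (ch.bijective y hy).1 ?_⟩
  rw [ch.κ_D hy hs, Filter.EventuallyEq.fderiv_eq h1, fderiv_fun_const]
  exact (_root_.map_zero (ch.κ y)).symm

/-- Parallel sections have components with zero derivative on a neighbourhood, and these are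
constant on a ball. -/
theorem eventually_of_parallel (hy : y ∈ U) (h : ∀ᶠ x in 𝓝 y, σ s x ∧ D s x = 0) :
    ∀ᶠ x in 𝓝 y, ch.κ x (s x) = ch.κ y (s y) := by
  have h1 : ∀ᶠ z in 𝓝 (crd d x₀ y), ch.rep s z = ch.rep s (crd d x₀ y) := by
    refine eventually_eq_of_fderiv_eq_zero ?_
    filter_upwards [eventually_crd_crdInv (ch.subset hy), (eventually_crdInv_iff (ch.subset hy)).2
      (h.and (ch.isOpen.mem_nhds hy))] with z h1 h2
    have h3 := ch.differentiableAt_rep h2.2 h2.1.1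
    have h4 := ch.κ_D h2.2 h2.1.1
    rw [h1] at h3 h4
    refine ⟨h3, ContinuousLinearMap.ext fun a => ?_⟩
    have h5 := h4 (crdField d x₀ _ a)
    rw [crdDeriv_crdField (ch.subset h2.2), h2.1.2] at h5
    exact h5.symm.trans (_root_.map_zero _)
  rw [← ch.rep_crd hy]
  exact (eventually_crdInv_iff (ch.subset hy)).1 h1

open scoped Classical in
/-- The sections with constant components. -/
def basis (i : Fin ch.m) (y : M) : W y :=
  if h : y ∈ U then (LinearEquiv.ofBijective (ch.κ y) (ch.bijective y h)).symm (Pi.single i 1) else 0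

theorem κ_basis (hy : y ∈ U) (i : Fin ch.m) : ch.κ y (ch.basis i y) = Pi.single i 1 := by
  rw [basis, dif_pos hy]
  exact (LinearEquiv.ofBijective (ch.κ y) (ch.bijective y hy)).apply_symm_apply _

theorem κ_sum (hy : y ∈ U) (c : Fin ch.m → ℝ) : ch.κ y (∑ i, c i • ch.basis i y) = c := by
  simp only [_root_.map_sum, _root_.map_smul, ch.κ_basis hy]
  exact (pi_eq_sum_univ' c).symm

theorem basis_spec (hy : y ∈ U) : LinearIndependent ℝ (fun i => ch.basis i y) ∧
    Submodule.span ℝ (range fun i => ch.basis i y) = ⊤ := by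
  let e := LinearEquiv.ofBijective (ch.κ y) (ch.bijective y hy)
  let b := (Pi.basisFun ℝ (Fin ch.m)).map e.symm
  have hb : (fun i => ch.basis i y) = b := funext fun i => (ch.bijective y hy).1 <| by
    rw [ch.κ_basis hy]
    refine Eq.trans ?_ (e.apply_symm_apply (Pi.basisFun ℝ (Fin ch.m) i)).symm
    simp
  rw [hb]
  exact ⟨b.linearIndependent, b.span_eq⟩

end FlatChart

variable {S : Set M → (∀ x, W x) → Prop}
  (hS : ∀ (U : Set M) (s : ∀ x, W x), IsOpen U → (S U s ↔ ∀ x ∈ U, σ s x))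
  (hch : ∀ x₀, ∃ U, Nonempty (FlatChart σ D x₀ U))
include hS hch

theorem isSmoothBundle_of_flatChart : IsSmoothBundle d S := by
  intro x
  obtain ⟨U, ⟨ch⟩⟩ := hch x
  refine ⟨U, ch.isOpen, ch.mem, ch.m, ch.basis, fun y hy => ch.basis_spec hy,
    fun U' hU' hUU' c => ?_⟩
  rw [hS U' _ hU']
  have h1 : ∀ y ∈ U', ∀ᶠ z in 𝓝 (crd d x y), ch.rep (fun y => ∑ i, c i y • ch.basis i y) z =
      fun i => c i (crdInv d x z) := fun y hy => by
    filter_upwards [ch.eventually (hUU' hy)] with z hz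
    exact ch.κ_sum hz _
  refine ⟨fun h i => (contMDiffOn_iff_of_isOpen hU').2 fun y hy => ?_, fun h y hy => ?_⟩
  · have h2 := (ch.contDiffAt_rep (hUU' hy) (h y hy)).congr_of_eventuallyEq
      ((h1 y hy).mono fun z hz => hz.symm)
    rw [contMDiffAt_iff_crd (ch.subset (hUU' hy))]
    exact contDiffAt_pi.1 h2 i
  · refine (ch.smooth_iff y (hUU' hy) _).2 ?_
    filter_upwards [(h1 y hy).eventually_nhds, eventually_crd_crdInv (ch.subset (hUU' hy)),
      (eventually_crdInv_iff (ch.subset (hUU' hy))).2 (hU'.mem_nhds hy)] with z hz h2 h3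
    refine (contDiffAt_pi.2 fun i => ?_).congr_of_eventuallyEq hz
    have h4 := (contMDiffAt_iff_crd (ch.subset (hUU' h3))).1
      ((contMDiffOn_iff_of_isOpen hU').1 (h i) _ h3)
    rwa [h2] at h4

theorem isFlatConnection_of_flatChart : IsFlatConnection S D where
  congr U s t hU hs ht h x hx := by
    rw [hS U _ hU] at hs ht
    obtain ⟨_, ⟨ch⟩⟩ := hch x
    refine LinearMap.ext fun a => (ch.bijective x ch.mem).1 ?_
    rw [ch.κ_D ch.mem (hs x hx), ch.κ_D ch.mem (ht x hx), Filter.EventuallyEq.fderiv_eq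
      (ch.rep_congr ch.mem (by filter_upwards [hU.mem_nhds hx] with y hy using h y hy))]
  add U s t hU hs ht x hx := by
    rw [hS U _ hU] at hs ht
    obtain ⟨_, ⟨ch⟩⟩ := hch x
    exact ch.add ch.mem (hs x hx) (ht x hx)
  leibniz U f s hU hf hs x hx a := by
    rw [hS U _ hU] at hs
    obtain ⟨_, ⟨ch⟩⟩ := hch x
    refine ch.leibniz ch.mem (hs x hx) ?_ a
    filter_upwards [hU.mem_nhds hx] with y hy using (contMDiffOn_iff_of_isOpen hU).1 hf y hy
  smooth U X s hU hX hs := by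
    rw [hS U _ hU] at hs ⊢
    intro x hx
    obtain ⟨_, ⟨ch⟩⟩ := hch x
    refine ch.smooth_D ch.mem (hs x hx) ?_
    filter_upwards [hU.mem_nhds hx] with y hy using (smoothField_iff hU).1 hX y hy
  flat U X Y s hU hX hY hs x hx := by
    rw [hS U _ hU] at hs
    obtain ⟨_, ⟨ch⟩⟩ := hch x
    refine ch.flat ch.mem (hs x hx) ?_ ?_
    · filter_upwards [hU.mem_nhds hx] with y hy using (smoothField_iff hU).1 hX y hy
    · filter_upwards [hU.mem_nhds hx] with y hy using (smoothField_iff hU).1 hY y hy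

omit hch in
theorem FlatChart.eventually_const {x₀ y : M} {U W' : Set M} (ch : FlatChart σ D x₀ U) (hy : y ∈ U)
    (hW : IsOpen W') (hyW : y ∈ W') {s : ∀ x, W x} (hs : Parallel S D W' s) :
    ∀ᶠ x in 𝓝 y, ch.κ x (s x) = ch.κ y (s y) := by
  refine ch.eventually_of_parallel hy ?_
  filter_upwards [hW.mem_nhds hyW] with x hx using ⟨(hS W' s hW).1 hs.1 x hx, hs.2 x hx⟩

theorem isLocallyConstantSheaf_of_flatChart : IsLocallyConstantSheaf (Parallel S D) := by
  intro x
  obtain ⟨U, ⟨ch⟩⟩ := hch x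
  refine ⟨U, ch.isOpen, ch.mem, ch.m, ch.basis, fun y hy => ch.basis_spec hy,
    fun U' hU' hUU' c => ?_⟩
  have h1 : ∀ y ∈ U', ch.κ y (∑ i, c i y • ch.basis i y) = fun i => c i y :=
    fun y hy => ch.κ_sum (hUU' hy) _
  refine ⟨fun h i y hy => ?_, fun h => ?_⟩
  · filter_upwards [ch.eventually_const hS (hUU' hy) hU' hy h, hU'.mem_nhds hy] with z h2 h3
    rw [h1 z h3, h1 y hy] at h2
    exact congrFun h2 i
  · have h2 : ∀ y ∈ U', σ (fun y => ∑ i, c i y • ch.basis i y) y ∧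
        D (fun y => ∑ i, c i y • ch.basis i y) y = 0 := fun y hy => by
      refine ch.parallel_of_eventually (hUU' hy) (c := fun i => c i y) ?_
      filter_upwards [eventually_all.2 fun i => h i y hy, hU'.mem_nhds hy] with z h2 h3
      rw [h1 z h3]
      exact funext h2
    exact ⟨(hS U' _ hU').2 fun y hy => (h2 y hy).1, fun y hy => (h2 y hy).2⟩

end FlatCharts

/-! ### The kernel and the cokernel -/

section LinearAlgebra

variable {F : Type*} [NormedAddCommGroup F] [NormedSpace ℝ F] [FiniteDimensional ℝ F]

/-- `Q` is the inclusion of the kernel in coordinates and `P` a projection onto it; globally defined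
linear maps let smoothness pass to and from components. -/
theorem exists_ker_components (T : F →L[ℝ] F) : ∃ (m : ℕ) (P : F →L[ℝ] (Fin m → ℝ))
    (Q : (Fin m → ℝ) →L[ℝ] F), (∀ c, P (Q c) = c) ∧ (∀ c, T (Q c) = 0) ∧
      ∀ v, T v = 0 → Q (P v) = v := by
  let K := (T : F →ₗ[ℝ] F).ker
  let e := (Module.finBasis ℝ K).equivFun
  obtain ⟨p, hp⟩ := K.subtype.exists_leftInverse_of_injective K.ker_subtype
  have hp' : ∀ v : K, p v = v := fun v => LinearMap.congr_fun hp v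
  refine ⟨_, (e.toLinearMap.comp p).toContinuousLinearMap,
    (K.subtype.comp e.symm.toLinearMap).toContinuousLinearMap, fun c => ?_, fun c => ?_,
    fun v hv => ?_⟩
  · exact (congrArg e (hp' (e.symm c))).trans (e.apply_symm_apply c)
  · exact (e.symm c).2
  · have h1 : p v = ⟨v, hv⟩ := hp' ⟨v, hv⟩
    refine (congrArg (fun w => ((e.symm (e w) : K) : F)) h1).trans ?_
    rw [e.symm_apply_apply]

/-- `P` is the quotient map in coordinates, with kernel exactly the range of T, and `Q` is a linear
section used to lift classes smoothly. -/
theorem exists_coker_components (T : F →L[ℝ] F) : ∃ (m : ℕ) (P : F →L[ℝ] (Fin m → ℝ))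
    (Q : (Fin m → ℝ) →L[ℝ] F), (∀ c, P (Q c) = c) ∧ (∀ v, P (T v) = 0) ∧
      ∀ v, P v = 0 → ∃ w, T w = v := by
  let R := (T : F →ₗ[ℝ] F).range
  let e := (Module.finBasis ℝ (F ⧸ R)).equivFun
  obtain ⟨ι, hι⟩ := R.mkQ.exists_rightInverse_of_surjective R.range_mkQ
  have hι' : ∀ q, R.mkQ (ι q) = q := fun q => LinearMap.congr_fun hι q
  refine ⟨_, (e.toLinearMap.comp R.mkQ).toContinuousLinearMap,
    (ι.comp e.symm.toLinearMap).toContinuousLinearMap, fun c => ?_, fun v => ?_, fun v hv => ?_⟩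
  · exact (congrArg e (hι' (e.symm c))).trans (e.apply_symm_apply c)
  · have h1 : R.mkQ (T v) = 0 := (Submodule.Quotient.mk_eq_zero R).2 ⟨v, rfl⟩
    exact (congrArg e h1).trans (_root_.map_zero e)
  · have h1 : R.mkQ v = 0 := (map_eq_zero_iff e e.injective).1 hv
    exact (Submodule.Quotient.mk_eq_zero R).1 h1

end LinearAlgebra

/-! ### Smoothness, parallelism and rank of Θ -/

section KerCoker

open Filter

universe u₁ v₁ w₁

variable {d : ℕ} {M : Type u₁} [TopologicalSpace M]
  [ChartedSpace (EuclideanSpace ℝ (Fin d)) M] [IsManifold (𝓡 d) ∞ M]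
  {F : Type w₁} [NormedAddCommGroup F] [NormedSpace ℝ F] [FiniteDimensional ℝ F]
  {V : M → Type v₁} [TopologicalSpace (TotalSpace F V)]
  [∀ x, AddCommGroup (V x)] [∀ x, Module ℝ (V x)] [∀ x, TopologicalSpace (V x)]
  [∀ x, IsTopologicalAddGroup (V x)] [∀ x, ContinuousSMul ℝ (V x)]
  [FiberBundle F V] [VectorBundle ℝ F V] [ContMDiffVectorBundle ∞ F V (𝓡 d)] {y : M} {k : ℕ}
  {x₀ : M} {U : Set M} {cov : CovariantDerivative (𝓡 d) F V}
  {Θ : ∀ x, V x →L[ℝ] V x} {J : SymplecticForm d M} (nf : NormalFrame cov Θ J x₀ U)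

theorem NormalFrame.rep_Θ {z : EuclideanSpace ℝ (Fin d)} (hz : crdInv d x₀ z ∈ U) (s : ∀ x, V x) :
    nf.rep (fun x => Θ x (s x)) z = nf.T (nf.rep s z) :=
  nf.τ_Θ _ hz _

theorem NormalFrame.smoothSectionAt_Θ (nf : NormalFrame cov Θ J x₀ U) (hy : y ∈ U)
    {s : ∀ x, V x} (hs : SmoothSectionAt d F s y) :
    SmoothSectionAt d F (fun x => Θ x (s x)) y := by
  rw [nf.smooth_iff y hy] at hs ⊢
  refine (nf.T.contDiff.contDiffAt.comp _ hs).congr_of_eventuallyEq ?_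
  filter_upwards [nf.eventually hy] with z hz using nf.rep_Θ hz s

theorem NormalFrame.fderiv_rep_Θ (hy : y ∈ U) {s : ∀ x, V x} (hs : SmoothSectionAt d F s y) :
    fderiv ℝ (nf.rep fun x => Θ x (s x)) (crd d x₀ y) =
      nf.T.comp (fderiv ℝ (nf.rep s) (crd d x₀ y)) := by
  rw [← fderiv_clm_comp nf.T (f := nf.rep s) (y := crd d x₀ y)
    (((nf.smooth_iff y hy s).1 hs).differentiableAt (by simp))]
  refine Filter.EventuallyEq.fderiv_eq ?_
  filter_upwards [nf.eventually hy] with z hz using nf.rep_Θ hz s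

theorem NormalFrame.τ_cov (hy : y ∈ U) {s : ∀ x, V x} (hs : SmoothSectionAt d F s y)
    (a : TangentSpace (𝓡 d) y) : nf.τ y (cov s y a) =
      fderiv ℝ (nf.rep s) (crd d x₀ y) (crdDeriv d x₀ y a) +
        nf.α (crd d x₀ y) (crdDeriv d x₀ y a) • nf.T (nf.τ y (s y)) :=
  nf.connection y hy s hs a

theorem NormalFrame.τ_injective (hy : y ∈ U) : Function.Injective (nf.τ y) :=
  Function.LeftInverse.injective (nf.left_inv y hy)

/-- The constant endomorphism T commutes with d + αT. -/
theorem NormalFrame.cov_Θ (nf : NormalFrame cov Θ J x₀ U) (hy : y ∈ U)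
    {s : ∀ x, V x} (hs : SmoothSectionAt d F s y) :
    cov (fun x => Θ x (s x)) y = (Θ y).comp (cov s y) := by
  refine ContinuousLinearMap.ext fun a => nf.τ_injective hy ?_
  rw [nf.τ_cov hy (nf.smoothSectionAt_Θ hy hs), nf.fderiv_rep_Θ hy hs,
    ContinuousLinearMap.comp_apply, ContinuousLinearMap.comp_apply, nf.τ_Θ y hy, nf.τ_Θ y hy,
    nf.τ_cov hy hs, _root_.map_add, _root_.map_smul]

theorem isParallelEndomorphism_of_normalFrame
    (hnf : ∀ x₀, ∃ U, Nonempty (NormalFrame cov Θ J x₀ U)) : IsParallelEndomorphism cov Θ := by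
  intro W s hW hs x hx
  obtain ⟨U, ⟨nf⟩⟩ := hnf x
  exact nf.cov_Θ nf.mem ((smoothSection_iff hW).1 hs x hx)

/-- Over the domain of a normal frame every Θ_y is conjugate to the same T. -/
theorem isLocallyConstant_finrank_range
    (hnf : ∀ x₀, ∃ U, Nonempty (NormalFrame cov Θ J x₀ U)) :
    IsLocallyConstant (fun x => Module.finrank ℝ (Θ x : V x →ₗ[ℝ] V x).range) := by
  refine (IsLocallyConstant.iff_eventually_eq _).2 fun x => ?_
  obtain ⟨U, ⟨nf⟩⟩ := hnf x
  have h : ∀ y ∈ U, Module.finrank ℝ (Θ y : V y →ₗ[ℝ] V y).range =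
      Module.finrank ℝ (nf.T : F →ₗ[ℝ] F).range := fun y hy => by
    have h1 : (nf.T : F →ₗ[ℝ] F).range =
        (Θ y : V y →ₗ[ℝ] V y).range.map (nf.τ y : V y →ₗ[ℝ] F) := by
      ext v
      constructor
      · rintro ⟨w, rfl⟩
        refine ⟨Θ y (nf.τ' y w), ⟨_, rfl⟩, (nf.τ_Θ y hy _).trans ?_⟩
        rw [nf.right_inv y hy]
        rfl
      · rintro ⟨_, ⟨w, rfl⟩, rfl⟩
        exact ⟨nf.τ y w, (nf.τ_Θ y hy w).symm⟩
    rw [h1]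
    exact (LinearEquiv.finrank_eq (Submodule.equivMapOfInjective _ (nf.τ_injective hy) _))
  filter_upwards [nf.isOpen.mem_nhds nf.mem] with y hy
  rw [h y hy, h x nf.mem]

/-- Smoothness in the bundle of homomorphisms is tested on sections with constant components in the
standard frame; the normal frame shows that Θ maps them to smooth sections. -/
theorem contMDiff_Θ (hnf : ∀ x₀, ∃ U, Nonempty (NormalFrame cov Θ J x₀ U)) :
    ContMDiff (𝓡 d) ((𝓡 d).prod 𝓘(ℝ, F →L[ℝ] F)) ∞
      (fun x => TotalSpace.mk' (F →L[ℝ] F) (E := fun x => V x →L[ℝ] V x) x (Θ x)) := by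
  intro x
  obtain ⟨U, ⟨nf⟩⟩ := hnf x
  refine (contMDiffAt_hom_bundle _).2 ⟨contMDiffAt_id, ?_⟩
  let fr := standardFrame (d := d) (F := F) (V := V) x
  rw [contMDiffAt_iff_crd mem_crdDom]
  refine contDiffAt_clm_iff.2 fun v => ?_
  have h1 := (fr.smooth_iff x fr.mem _).1
    (nf.smoothSectionAt_Θ nf.mem (fr.smoothSectionAt_const fr.mem v))
  refine h1.congr_of_eventuallyEq ?_
  exact Eventually.of_forall fun z => rfl

end KerCoker

/-! ### The kernel and the cohomology in degree zero -/

section Kernel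

open Filter

universe u₁ v₁ w₁

variable {d : ℕ} {M : Type u₁} [TopologicalSpace M]
  [ChartedSpace (EuclideanSpace ℝ (Fin d)) M] [IsManifold (𝓡 d) ∞ M]
  {F : Type w₁} [NormedAddCommGroup F] [NormedSpace ℝ F] [FiniteDimensional ℝ F]
  {V : M → Type v₁} [TopologicalSpace (TotalSpace F V)]
  [∀ x, AddCommGroup (V x)] [∀ x, Module ℝ (V x)] [∀ x, TopologicalSpace (V x)]
  [∀ x, IsTopologicalAddGroup (V x)] [∀ x, ContinuousSMul ℝ (V x)]
  [FiberBundle F V] [VectorBundle ℝ F V] [ContMDiffVectorBundle ∞ F V (𝓡 d)] {y : M}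
  {x₀ : M} {U : Set M} {cov : CovariantDerivative (𝓡 d) F V}
  {Θ : ∀ x, V x →L[ℝ] V x} {J : SymplecticForm d M}

variable (d F Θ) in
/-- The section `s` of the kernel is smooth near `y`. -/
def SmoothKerAt (s : ∀ x, Ker Θ x) (y : M) : Prop :=
  ∀ᶠ x in 𝓝 y, SmoothSectionAt d F (fun x => (s x : V x)) x

theorem smoothKer_iff (U : Set M) (s : ∀ x, Ker Θ x) (hU : IsOpen U) :
    SmoothKer d F Θ U s ↔ ∀ x ∈ U, SmoothKerAt d F Θ s x := by
  refine (smoothSection_iff hU).trans ⟨fun h x hx => ?_, fun h x hx => (h x hx).self_of_nhds⟩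
  filter_upwards [hU.mem_nhds hx] with z hz using h z hz

variable (cov Θ) in
open scoped Classical in
/-- The connection induced on the kernel. -/
def kerConnection (s : ∀ x, Ker Θ x) (x : M) : TangentSpace (𝓡 d) x →ₗ[ℝ] Ker Θ x :=
  if h : ∀ a, cov (fun y => (s y : V y)) x a ∈ (Θ x : V x →ₗ[ℝ] V x).ker then
    (cov (fun y => (s y : V y)) x : TangentSpace (𝓡 d) x →ₗ[ℝ] V x).codRestrict _ h
  else 0

theorem NormalFrame.Θ_eq_zero_iff (nf : NormalFrame cov Θ J x₀ U) (hy : y ∈ U) (v : V y) :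
    Θ y v = 0 ↔ nf.T (nf.τ y v) = 0 := by
  rw [← nf.τ_Θ y hy, _root_.map_eq_zero_iff (nf.τ y) (nf.τ_injective hy)]

theorem NormalFrame.T_rep_ker (nf : NormalFrame cov Θ J x₀ U) (hy : y ∈ U) (s : ∀ x, Ker Θ x) :
    ∀ᶠ z in 𝓝 (crd d x₀ y), nf.T (nf.rep (fun x => (s x : V x)) z) = 0 := by
  filter_upwards [nf.eventually hy] with z hz
  exact (nf.Θ_eq_zero_iff hz _).1 (s (crdInv d x₀ z)).2

theorem NormalFrame.τ_cov_ker (nf : NormalFrame cov Θ J x₀ U) (hy : y ∈ U) {s : ∀ x, Ker Θ x}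
    (hs : SmoothSectionAt d F (fun x => (s x : V x)) y) (a : TangentSpace (𝓡 d) y) :
    nf.τ y (cov (fun x => (s x : V x)) y a) =
      fderiv ℝ (nf.rep fun x => (s x : V x)) (crd d x₀ y) (crdDeriv d x₀ y a) := by
  rw [nf.τ_cov hy hs, (nf.Θ_eq_zero_iff hy _).1 (s y).2, smul_zero, add_zero]

/-- On a section of the kernel αT contributes nothing, and differentiating T s = 0 with T constant
shows that the derivative stays in the kernel. Thus `kerConnection` takes its intended value on
smooth sections. -/
theorem NormalFrame.cov_mem_ker (nf : NormalFrame cov Θ J x₀ U) (hy : y ∈ U) {s : ∀ x, Ker Θ x}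
    (hs : SmoothSectionAt d F (fun x => (s x : V x)) y) (a : TangentSpace (𝓡 d) y) :
    Θ y (cov (fun x => (s x : V x)) y a) = 0 := by
  rw [nf.Θ_eq_zero_iff hy, nf.τ_cov_ker hy hs]
  have h := fderiv_clm_comp nf.T (f := nf.rep fun x => (s x : V x)) (y := crd d x₀ y)
    (((nf.smooth_iff y hy _).1 hs).differentiableAt (by simp))
  rw [Filter.EventuallyEq.fderiv_eq (nf.T_rep_ker hy s), fderiv_fun_const] at h
  exact (DFunLike.congr_fun h (crdDeriv d x₀ y a)).symm

theorem NormalFrame.coe_kerConnection (nf : NormalFrame cov Θ J x₀ U) (hy : y ∈ U)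
    {s : ∀ x, Ker Θ x} (hs : SmoothSectionAt d F (fun x => (s x : V x)) y)
    (a : TangentSpace (𝓡 d) y) :
    (kerConnection cov Θ s y a : V y) = cov (fun x => (s x : V x)) y a := by
  rw [kerConnection, dif_pos fun a => LinearMap.mem_ker.2 (nf.cov_mem_ker hy hs a)]
  rfl

/-- In a normal frame the kernel is the constant subspace ker T, and the induced connection is the
derivative of components. -/
theorem NormalFrame.exists_kerChart (nf : NormalFrame cov Θ J x₀ U) :
    Nonempty (FlatChart (SmoothKerAt d F Θ) (kerConnection cov Θ) x₀ U) := by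
  obtain ⟨m, P, Q, hPQ, hTQ, hQP⟩ := exists_ker_components nf.T
  have hrep : ∀ y ∈ U, ∀ s : ∀ x, Ker Θ x, ∀ᶠ z in 𝓝 (crd d x₀ y),
      nf.rep (fun x => (s x : V x)) z = Q (P (nf.rep (fun x => (s x : V x)) z)) :=
    fun y hy s => (nf.T_rep_ker hy s).mono fun z hz => (hQP _ hz).symm
  have hinj : ∀ y ∈ U, ∀ v w : Ker Θ y, P (nf.τ y v) = P (nf.τ y w) → v = w := fun y hy v w h => by
    refine Subtype.ext (nf.τ_injective hy ?_)
    rw [← hQP _ ((nf.Θ_eq_zero_iff hy _).1 v.2), h, hQP _ ((nf.Θ_eq_zero_iff hy _).1 w.2)]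
  have hker : ∀ y ∈ U, ∀ c, Θ y (nf.τ' y (Q c)) = 0 := fun y hy c => by
    rw [nf.Θ_eq_zero_iff hy, nf.right_inv y hy, hTQ]
  refine ⟨{
    isOpen := nf.isOpen
    mem := nf.mem
    subset := nf.subset
    m := m
    κ := fun y => ((P.comp (nf.τ y) : V y →L[ℝ] (Fin m → ℝ)) : V y →ₗ[ℝ] (Fin m → ℝ)).comp
      (Submodule.subtype _)
    bijective := fun y hy => ⟨hinj y hy, fun c => ⟨⟨nf.τ' y (Q c), LinearMap.mem_ker.2 (hker y hy c)⟩,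
      (congrArg P (nf.right_inv y hy (Q c))).trans (hPQ c)⟩⟩
    smooth_iff := fun y hy s => ⟨fun hs => ?_, fun hs => ?_⟩
    deriv := fun y hy s hs a => ?_ }⟩
  · filter_upwards [(eventually_crdInv_iff (nf.subset hy)).2 (hs.and (nf.isOpen.mem_nhds hy)),
      eventually_crd_crdInv (nf.subset hy)] with z h1 h2
    have h3 := (nf.smooth_iff _ h1.2 _).1 h1.1
    rw [h2] at h3
    exact P.contDiff.contDiffAt.comp z h3
  · filter_upwards [(eventually_crd_iff (nf.subset hy)).2 hs, nf.isOpen.mem_nhds hy] with x h1 h2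
    refine (nf.smooth_iff x h2 _).2 ?_
    exact (Q.contDiff.contDiffAt.comp _ h1).congr_of_eventuallyEq (hrep x h2 s)
  · have h1 := hs.self_of_nhds
    have h2 := fderiv_clm_comp P (f := nf.rep fun x => (s x : V x)) (y := crd d x₀ y)
      (((nf.smooth_iff y hy _).1 h1).differentiableAt (by simp))
    refine Eq.trans ?_ (DFunLike.congr_fun h2 (crdDeriv d x₀ y a)).symm
    refine congrArg P ?_
    refine Eq.trans ?_ (nf.τ_cov_ker hy h1 a)
    exact congrArg (nf.τ y) (nf.coe_kerConnection hy h1 a)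

theorem exists_kerChart (hnf : ∀ x₀, ∃ U, Nonempty (NormalFrame cov Θ J x₀ U)) (x₀ : M) :
    ∃ U, Nonempty (FlatChart (SmoothKerAt d F Θ) (kerConnection cov Θ) x₀ U) := by
  obtain ⟨U, ⟨nf⟩⟩ := hnf x₀
  exact ⟨U, nf.exists_kerChart⟩

theorem coe_kerConnection (hnf : ∀ x₀, ∃ U, Nonempty (NormalFrame cov Θ J x₀ U)) {W : Set M}
    (hW : IsOpen W) {s : ∀ x, Ker Θ x} (hs : SmoothKer d F Θ W s) {x : M} (hx : x ∈ W)
    (a : TangentSpace (𝓡 d) x) :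
    (kerConnection cov Θ s x a : V x) = cov (fun y => (s y : V y)) x a := by
  obtain ⟨U, ⟨nf⟩⟩ := hnf x
  exact nf.coe_kerConnection nf.mem ((smoothSection_iff hW).1 hs x hx) a

theorem twistedD_zero_eq_zero_iff {s : ∀ x : M, V x} {x : M} :
    twistedD J cov Θ 0 s x = 0 ↔ cov s x = 0 ∧ Θ x (s x) = 0 := by
  refine ⟨fun h => ⟨ContinuousLinearMap.ext fun a => ?_, ?_⟩, fun h => ?_⟩
  · exact congrArg (fun p : Term d V 1 x => p.1 (fun _ => a)) h
  · exact congrArg (fun p : Term d V 1 x => p.2 ![]) h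
  · refine Prod.ext ?_ ?_
    · refine ContinuousAlternatingMap.ext fun v => ?_
      exact DFunLike.congr_fun h.1 (v 0)
    · refine ContinuousAlternatingMap.ext fun v => ?_
      exact h.2

theorem closed_zero_iff {W : Set M} {s : ∀ x : M, V x} :
    Closed (SmoothTerm d F V) (twistedD J cov Θ) 0 W s ↔
      SmoothSection (d := d) F W s ∧ ∀ x ∈ W, cov s x = 0 ∧ Θ x (s x) = 0 :=
  and_congr Iff.rfl (forall₂_congr fun _ _ => twistedD_zero_eq_zero_iff)

theorem closed_iff_exists_ker (hnf : ∀ x₀, ∃ U, Nonempty (NormalFrame cov Θ J x₀ U))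
    {W : Set M} (hW : IsOpen W) (s : ∀ x : M, V x) :
    Closed (SmoothTerm d F V) (twistedD J cov Θ) 0 W s ↔ ∃ p : ∀ x, Ker Θ x,
      Parallel (SmoothKer d F Θ) (kerConnection cov Θ) W p ∧ ∀ x ∈ W, s x = (p x : V x) := by
  classical
  rw [closed_zero_iff, smoothSection_iff hW]
  refine ⟨fun ⟨h, h0⟩ => ?_, fun ⟨p, hp, hsp⟩ => ?_⟩
  -- Off the open set the section need not lie in the kernel, so it is replaced by 0 there.
  · let p : ∀ x, Ker Θ x := fun x => if hx : Θ x (s x) = 0 then ⟨s x, LinearMap.mem_ker.2 hx⟩ else 0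
    have hp : ∀ x ∈ W, (p x : V x) = s x := fun x hx => by
      change ((if hx : Θ x (s x) = 0 then ⟨s x, LinearMap.mem_ker.2 hx⟩ else 0 : Ker Θ x) : V x) = s x
      rw [dif_pos (h0 x hx).2]
    have hev : ∀ x ∈ W, ∀ᶠ z in 𝓝 x, (p z : V z) = s z := fun x hx => by
      filter_upwards [hW.mem_nhds hx] with z hz using hp z hz
    have hs : SmoothKer d F Θ W p :=
      (smoothSection_iff hW).2 fun x hx => (h x hx).congr (hev x hx)
    refine ⟨p, ⟨hs, fun x hx => LinearMap.ext fun a => Subtype.ext ?_⟩, fun x hx => (hp x hx).symm⟩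
    rw [coe_kerConnection hnf hW hs hx, cov_congr cov (h x hx) (hev x hx), (h0 x hx).1]
    rfl
  · have hs := (smoothSection_iff hW).1 hp.1
    have hev : ∀ x ∈ W, ∀ᶠ z in 𝓝 x, s z = (p z : V z) := fun x hx => by
      filter_upwards [hW.mem_nhds hx] with z hz using hsp z hz
    refine ⟨fun x hx => (hs x hx).congr (hev x hx), fun x hx => ⟨?_, ?_⟩⟩
    · refine ContinuousLinearMap.ext fun a => ?_
      rw [cov_congr cov (hs x hx) (hev x hx), ← coe_kerConnection hnf hW hp.1 hx, hp.2 x hx]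
      rfl
    · rw [hsp x hx]
      exact (p x).2

theorem identifiesClosedSections_ker (hnf : ∀ x₀, ∃ U, Nonempty (NormalFrame cov Θ J x₀ U)) :
    IdentifiesClosedSections (SmoothTerm d F V) (twistedD J cov Θ)
      (Parallel (SmoothKer d F Θ) (kerConnection cov Θ)) (fromKer Θ) where
  injective _ := Subtype.val_injective
  closed_iff _ s hW := closed_iff_exists_ker hnf hW s

end Kernel

/-! ### The cokernel and its flat connection -/

section Cokernel

open Filter

universe u₁ v₁ w₁

variable {d : ℕ} {M : Type u₁} [TopologicalSpace M]
  [ChartedSpace (EuclideanSpace ℝ (Fin d)) M] [IsManifold (𝓡 d) ∞ M]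
  {F : Type w₁} [NormedAddCommGroup F] [NormedSpace ℝ F] [FiniteDimensional ℝ F]
  {V : M → Type v₁} [TopologicalSpace (TotalSpace F V)]
  [∀ x, AddCommGroup (V x)] [∀ x, Module ℝ (V x)] [∀ x, TopologicalSpace (V x)]
  [∀ x, IsTopologicalAddGroup (V x)] [∀ x, ContinuousSMul ℝ (V x)]
  [FiberBundle F V] [VectorBundle ℝ F V] [ContMDiffVectorBundle ∞ F V (𝓡 d)] {y : M}
  {x₀ : M} {U : Set M} {cov : CovariantDerivative (𝓡 d) F V}
  {Θ : ∀ x, V x →L[ℝ] V x} {J : SymplecticForm d M}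

variable (d F Θ) in
/-- The section `p` of the cokernel is smooth near `y`. -/
def SmoothCokerAt (p : ∀ x, Coker Θ x) (y : M) : Prop :=
  ∃ s : ∀ x, V x, ∀ᶠ x in 𝓝 y, SmoothSectionAt d F s x ∧ p x = Submodule.Quotient.mk (s x)

theorem smoothCoker_iff (W : Set M) (p : ∀ x, Coker Θ x) (hW : IsOpen W) :
    SmoothCoker d F Θ W p ↔ ∀ x ∈ W, SmoothCokerAt d F Θ p x := by
  refine forall₂_congr fun x hx => ⟨fun ⟨W', s, hW', hx', _, hs, hp⟩ => ⟨s, ?_⟩, fun ⟨s, hs⟩ => ?_⟩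
  · filter_upwards [hW'.mem_nhds hx'] with z hz using ⟨(smoothSection_iff hW').1 hs z hz, hp z hz⟩
  · obtain ⟨W', hW', hWo, hxW⟩ := eventually_nhds_iff.1 (hs.and (hW.mem_nhds hx))
    exact ⟨W', s, hWo, hxW, fun z hz => (hW' z hz).2,
      (smoothSection_iff hWo).2 fun z hz => (hW' z hz).1.1, fun z hz => (hW' z hz).1.2⟩

variable (cov Θ) in
open scoped Classical in
/-- The connection induced on the cokernel. -/
def cokerConnection (p : ∀ x, Coker Θ x) (x : M) : TangentSpace (𝓡 d) x →ₗ[ℝ] Coker Θ x :=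
  if h : SmoothCokerAt d F Θ p x then
    (Submodule.mkQ _).comp (cov h.choose x : TangentSpace (𝓡 d) x →ₗ[ℝ] V x)
  else 0

open scoped Classical in
/-- The components of an element of the cokernel. -/
def NormalFrame.cokerComponents (nf : NormalFrame cov Θ J x₀ U) {m : ℕ} (P : F →L[ℝ] (Fin m → ℝ))
    (y : M) : Coker Θ y →ₗ[ℝ] (Fin m → ℝ) :=
  if h : (Θ y : V y →ₗ[ℝ] V y).range ≤
      ((P.comp (nf.τ y) : V y →L[ℝ] (Fin m → ℝ)) : V y →ₗ[ℝ] (Fin m → ℝ)).ker then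
    Submodule.liftQ _ _ h
  else 0

variable {m : ℕ} {P : F →L[ℝ] (Fin m → ℝ)} {Q : (Fin m → ℝ) →L[ℝ] F}

theorem NormalFrame.cokerComponents_mk (nf : NormalFrame cov Θ J x₀ U)
    (hPT : ∀ v, P (nf.T v) = 0) (hy : y ∈ U) (v : V y) :
    nf.cokerComponents P y (Submodule.Quotient.mk v) = P (nf.τ y v) := by
  rw [NormalFrame.cokerComponents, dif_pos]
  · rfl
  · rintro _ ⟨w, rfl⟩
    exact (congrArg P (nf.τ_Θ y hy w)).trans (hPT _)

theorem NormalFrame.cokerComponents_injective (nf : NormalFrame cov Θ J x₀ U)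
    (hPT : ∀ v, P (nf.T v) = 0) (hP : ∀ v, P v = 0 → ∃ w, nf.T w = v) (hy : y ∈ U) :
    Function.Injective (nf.cokerComponents P y) := by
  refine (injective_iff_map_eq_zero _).2 fun p hp => ?_
  obtain ⟨v, rfl⟩ := Submodule.Quotient.mk_surjective _ p
  rw [nf.cokerComponents_mk hPT hy] at hp
  obtain ⟨w, hw⟩ := hP _ hp
  refine (Submodule.Quotient.mk_eq_zero _).2 ⟨nf.τ' y w, nf.τ_injective hy ?_⟩
  refine (nf.τ_Θ y hy _).trans ?_
  rw [nf.right_inv y hy, hw]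

/-- `P` kills the range of T, hence the term αT of the connection. -/
theorem NormalFrame.components_cov (nf : NormalFrame cov Θ J x₀ U)
    (hPT : ∀ v, P (nf.T v) = 0) (hy : y ∈ U) {s : ∀ x, V x} (hs : SmoothSectionAt d F s y)
    (a : TangentSpace (𝓡 d) y) : P (nf.τ y (cov s y a)) =
      fderiv ℝ (fun z => P (nf.rep s z)) (crd d x₀ y) (crdDeriv d x₀ y a) := by
  rw [nf.τ_cov hy hs, _root_.map_add, _root_.map_smul, hPT, smul_zero, add_zero]
  have h := fderiv_clm_comp P (f := nf.rep s) (y := crd d x₀ y)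
    (((nf.smooth_iff y hy _).1 hs).differentiableAt (by simp))
  rw [h]
  rfl

theorem NormalFrame.cokerComponents_rep (nf : NormalFrame cov Θ J x₀ U)
    (hPT : ∀ v, P (nf.T v) = 0) (hy : y ∈ U) {s : ∀ x, V x} {p : ∀ x, Coker Θ x}
    (hp : ∀ᶠ x in 𝓝 y, p x = Submodule.Quotient.mk (s x)) : ∀ᶠ z in 𝓝 (crd d x₀ y),
      nf.cokerComponents P (crdInv d x₀ z) (p (crdInv d x₀ z)) = P (nf.rep s z) := by
  filter_upwards [(eventually_crdInv_iff (nf.subset hy)).2 hp, nf.eventually hy] with z h1 h2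
  rw [h1, nf.cokerComponents_mk hPT h2]
  rfl

/-- The definition chooses a lift. The components of the class of its covariant derivative are the
derivative of the components of the class, which do not depend on the lift. -/
theorem NormalFrame.cokerConnection_eq (nf : NormalFrame cov Θ J x₀ U) (hy : y ∈ U)
    {s : ∀ x, V x} {p : ∀ x, Coker Θ x}
    (hs : ∀ᶠ x in 𝓝 y, SmoothSectionAt d F s x ∧ p x = Submodule.Quotient.mk (s x))
    (a : TangentSpace (𝓡 d) y) :
    cokerConnection cov Θ p y a = Submodule.Quotient.mk (cov s y a) := by
  obtain ⟨m, P, Q, -, hPT, hP⟩ := exists_coker_components nf.T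
  have h : SmoothCokerAt d F Θ p y := ⟨s, hs⟩
  have ht := h.choose_spec
  rw [cokerConnection, dif_pos h]
  set t := h.choose
  refine nf.cokerComponents_injective hPT hP hy ?_
  rw [nf.cokerComponents_mk hPT hy, nf.components_cov hPT hy hs.self_of_nhds.1]
  refine (nf.cokerComponents_mk hPT hy _).trans ?_
  refine (nf.components_cov hPT hy ht.self_of_nhds.1 a).trans ?_
  refine DFunLike.congr_fun (Filter.EventuallyEq.fderiv_eq ?_) _
  filter_upwards [nf.cokerComponents_rep hPT hy (hs.mono fun _ h => h.2),
    nf.cokerComponents_rep hPT hy (ht.mono fun _ h => h.2)] with z h1 h2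
  rw [← h1, ← h2]

theorem NormalFrame.exists_cokerChart (nf : NormalFrame cov Θ J x₀ U) :
    ∃ (ch : FlatChart (SmoothCokerAt d F Θ) (cokerConnection cov Θ) x₀ U)
      (P : F →L[ℝ] (Fin ch.m → ℝ)) (Q : (Fin ch.m → ℝ) →L[ℝ] F),
      (∀ c, P (Q c) = c) ∧ (∀ v, P (nf.T v) = 0) ∧ (∀ v, P v = 0 → ∃ w, nf.T w = v) ∧
      ∀ y ∈ U, ∀ v : V y, ch.κ y (Submodule.Quotient.mk v) = P (nf.τ y v) := by
  obtain ⟨m, P, Q, hPQ, hPT, hP⟩ := exists_coker_components nf.T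
  have hsurj : ∀ y ∈ U, ∀ c, nf.cokerComponents P y (Submodule.Quotient.mk (nf.τ' y (Q c))) = c :=
    fun y hy c => by rw [nf.cokerComponents_mk hPT hy, nf.right_inv y hy, hPQ]
  refine ⟨{
    isOpen := nf.isOpen
    mem := nf.mem
    subset := nf.subset
    m := m
    κ := nf.cokerComponents P
    bijective := fun y hy => ⟨nf.cokerComponents_injective hPT hP hy, fun c => ⟨_, hsurj y hy c⟩⟩
    smooth_iff := fun y hy p => ⟨fun ⟨s, hs⟩ => ?_, fun hp => ?_⟩
    deriv := fun y hy p ⟨s, hs⟩ a => ?_ }, P, Q, hPQ, hPT, hP,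
    fun y hy v => nf.cokerComponents_mk hPT hy v⟩
  · filter_upwards [(eventually_crdInv_iff (nf.subset hy)).2 (hs.and (nf.isOpen.mem_nhds hy)),
      eventually_crd_crdInv (nf.subset hy),
      (nf.cokerComponents_rep hPT hy (hs.mono fun _ h => h.2)).eventually_nhds] with z h1 h2 h3
    have h4 := (nf.smooth_iff _ h1.2 _).1 h1.1.1
    rw [h2] at h4
    exact (P.contDiff.contDiffAt.comp z h4).congr_of_eventuallyEq h3
  -- The linear section `Q` turns smooth components into a smooth lift.
  · refine ⟨fun x => nf.τ' x (Q (nf.cokerComponents P x (p x))), ?_⟩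
    filter_upwards [(eventually_crd_iff (nf.subset hy)).2 hp, nf.isOpen.mem_nhds hy] with x h1 h2
    refine ⟨(nf.smooth_iff x h2 _).2 ?_, nf.cokerComponents_injective hPT hP h2 (hsurj x h2 _).symm⟩
    refine (Q.contDiff.contDiffAt.comp _ h1).congr_of_eventuallyEq ?_
    filter_upwards [nf.eventually h2] with z hz using nf.right_inv _ hz _
  · rw [nf.cokerConnection_eq hy hs, nf.cokerComponents_mk hPT hy,
      nf.components_cov hPT hy hs.self_of_nhds.1]
    exact DFunLike.congr_fun (Filter.EventuallyEq.fderiv_eq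
      (Filter.EventuallyEq.symm (nf.cokerComponents_rep hPT hy (hs.mono fun _ h => h.2)))) _

theorem exists_cokerChart (hnf : ∀ x₀, ∃ U, Nonempty (NormalFrame cov Θ J x₀ U)) (x₀ : M) :
    ∃ U, Nonempty (FlatChart (SmoothCokerAt d F Θ) (cokerConnection cov Θ) x₀ U) := by
  obtain ⟨U, ⟨nf⟩⟩ := hnf x₀
  exact ⟨U, nf.exists_cokerChart.nonempty⟩

theorem cokerConnection_mk (hnf : ∀ x₀, ∃ U, Nonempty (NormalFrame cov Θ J x₀ U)) {W : Set M}
    (hW : IsOpen W) {s : ∀ x, V x} (hs : SmoothSection (d := d) F W s) {x : M} (hx : x ∈ W)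
    (a : TangentSpace (𝓡 d) x) : cokerConnection cov Θ (fun y => Submodule.Quotient.mk (s y)) x a =
      Submodule.Quotient.mk (cov s x a) := by
  obtain ⟨U, ⟨nf⟩⟩ := hnf x
  refine nf.cokerConnection_eq nf.mem ?_ a
  filter_upwards [hW.mem_nhds hx] with z hz using ⟨(smoothSection_iff hW).1 hs z hz, rfl⟩

end Cokernel

/-! ### The cohomology in degree one -/

section Cohomology

open Filter ContinuousAlternatingMap

universe u₁ v₁ w₁

theorem modelD_zero_const {E : Type} {F : Type*} [NormedAddCommGroup E] [NormedSpace ℝ E]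
    [NormedAddCommGroup F]
    [NormedSpace ℝ F] (T : F →L[ℝ] F) (w : F) (y : E) :
    modelD T 0 (fun _ => w) y = mpair 0 (constOfIsEmpty ℝ E (Fin 0) (T w)) := by
  refine mterm_ext ?_ ?_
  · rw [mfst_modelD_zero, mfst_mpair, fderiv_fun_const]
    rfl
  · rw [msnd_modelD_zero, msnd_mpair]

variable {d : ℕ} {M : Type u₁} [TopologicalSpace M]
  [ChartedSpace (EuclideanSpace ℝ (Fin d)) M] [IsManifold (𝓡 d) ∞ M]
  {F : Type w₁} [NormedAddCommGroup F] [NormedSpace ℝ F] [FiniteDimensional ℝ F]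
  {V : M → Type v₁} [TopologicalSpace (TotalSpace F V)]
  [∀ x, AddCommGroup (V x)] [∀ x, Module ℝ (V x)] [∀ x, TopologicalSpace (V x)]
  [∀ x, IsTopologicalAddGroup (V x)] [∀ x, ContinuousSMul ℝ (V x)]
  [FiberBundle F V] [VectorBundle ℝ F V] [ContMDiffVectorBundle ∞ F V (𝓡 d)] {y : M}
  {x₀ : M} {U : Set M} {cov : CovariantDerivative (𝓡 d) F V}
  {Θ : ∀ x, V x →L[ℝ] V x} {J : SymplecticForm d M}

theorem NormalFrame.msnd_termAt_one (nf : NormalFrame cov Θ J x₀ U) (s : Term d V 1 y) :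
    msnd 0 (nf.termAt 1 y s) ![] = nf.τ y (s.2 ![]) :=
  congrArg (fun v => nf.τ y (s.2 v)) (Subsingleton.elim _ _)

/-- The shear leaves the second component unchanged, so η itself has components Tψ + c; its class
modulo the range is given by the constant c. -/
theorem NormalFrame.closed_one (nf : NormalFrame cov Θ J x₀ U) (hy : y ∈ U) {W : Set M}
    (hW : IsOpen W) (hyW : y ∈ W) {s : ∀ x : M, Term d V 1 x}
    (hs : Closed (SmoothTerm d F V) (twistedD J cov Θ) 1 W s) :
    ∃ (ψ : EuclideanSpace ℝ (Fin d) → F) (c : F), ContDiff ℝ ∞ ψ ∧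
      (∀ᶠ z in 𝓝 (crd d x₀ y), nf.termRep 1 s z =
        modelD nf.T 0 ψ z + mpair 0 (constOfIsEmpty ℝ _ (Fin 0) c)) ∧
      ∀ᶠ x in 𝓝 y, nf.τ x ((s x).2 ![]) = nf.T (ψ (crd d x₀ x)) + c := by
  have : CompleteSpace F := FiniteDimensional.complete ℝ F
  obtain ⟨h1, h2⟩ := nf.eventually_modelD_eq_zero hy hW hyW hs
  obtain ⟨ψ, c, hψ, h⟩ := modelD_one_eq_zero nf.T h1 h2
  refine ⟨ψ, c, hψ, h, ?_⟩
  filter_upwards [(eventually_crd_iff (nf.subset hy)).2 h, nf.isOpen.mem_nhds hy] with x h1 h2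
  rw [nf.termRep_crd h2] at h1
  rw [← nf.msnd_termAt_one, h1, _root_.map_add, msnd_modelD_zero, msnd_mpair]
  rfl

/-- Applying `P` to Tψ + c leaves P c, so the class of η has locally constant components. -/
theorem mapsTo_coker (hnf : ∀ x₀, ∃ U, Nonempty (NormalFrame cov Θ J x₀ U)) {W : Set M}
    (hW : IsOpen W) {s : ∀ x : M, Term d V 1 x}
    (hs : Closed (SmoothTerm d F V) (twistedD J cov Θ) 1 W s) :
    Parallel (SmoothCoker d F Θ) (cokerConnection cov Θ) W (fun x => toCoker Θ x (s x)) := by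
  have h : ∀ x ∈ W, SmoothCokerAt d F Θ (fun x => toCoker Θ x (s x)) x ∧
      cokerConnection cov Θ (fun x => toCoker Θ x (s x)) x = 0 := fun x hx => by
    obtain ⟨U, ⟨nf⟩⟩ := hnf x
    obtain ⟨ch, P, Q, -, hPT, -, hκ⟩ := nf.exists_cokerChart
    obtain ⟨ψ, c, -, -, h⟩ := nf.closed_one nf.mem hW hx hs
    refine ch.parallel_of_eventually nf.mem (c := P c) ?_
    filter_upwards [h, nf.isOpen.mem_nhds nf.mem] with z h1 h2
    refine (hκ z h2 _).trans ?_
    rw [h1, _root_.map_add, hPT, zero_add]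
  exact ⟨(smoothCoker_iff W _ hW).2 fun x hx => (h x hx).1, fun x hx => (h x hx).2⟩

/-- Vanishing of the class at the single point x suffices: it makes c = Tw, and then the cocycle is
the image of ψ + w near x. -/
theorem exactNear_of_toCoker_eq_zero (hnf : ∀ x₀, ∃ U, Nonempty (NormalFrame cov Θ J x₀ U))
    {W : Set M} (hW : IsOpen W) {s : ∀ x : M, Term d V 1 x}
    (hs : Closed (SmoothTerm d F V) (twistedD J cov Θ) 1 W s) {x : M} (hx : x ∈ W)
    (h : toCoker Θ x (s x) = 0) : ExactNear (SmoothTerm d F V) (twistedD J cov Θ) 0 x s := by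
  obtain ⟨U, ⟨nf⟩⟩ := hnf x
  obtain ⟨ψ, c, hψ, h1, h2⟩ := nf.closed_one nf.mem hW hx hs
  obtain ⟨w, hw⟩ : ∃ w, nf.T w = c := by
    obtain ⟨v, hv⟩ := (Submodule.Quotient.mk_eq_zero _).1 h
    refine ⟨nf.τ x v - ψ (crd d x x), ?_⟩
    have h3 : nf.T (nf.τ x v) = nf.τ x ((s x).2 ![]) :=
      (nf.τ_Θ x nf.mem v).symm.trans (congrArg (nf.τ x) hv)
    rw [_root_.map_sub, h3, h2.self_of_nhds, add_sub_cancel_left]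
  refine nf.exactNear nf.mem (g := fun z => ψ z + w) (hψ.add contDiff_const) ?_
  filter_upwards [h1] with z hz
  refine (modelD_add (T := nf.T) (k := 0) (g := fun _ => w) (hψ.differentiable (by simp) z)
    (differentiableAt_const w)).trans ?_
  rw [hz, modelD_zero_const, hw]

theorem toCoker_twistedD (t : ∀ x, V x) (x : M) : toCoker Θ x (twistedD J cov Θ 0 t x) = 0 :=
  (Submodule.Quotient.mk_eq_zero _).2 ⟨t x, rfl⟩

/-- A parallel section of the cokernel has constant components near x; lifting them by `Q` gives a
constant cocycle of the model with that class. -/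
theorem exists_closed_of_parallel (hnf : ∀ x₀, ∃ U, Nonempty (NormalFrame cov Θ J x₀ U))
    {W : Set M} (hW : IsOpen W) {p : ∀ x, Coker Θ x}
    (hp : Parallel (SmoothCoker d F Θ) (cokerConnection cov Θ) W p) {x : M} (hx : x ∈ W) :
    ∃ (W' : Set M) (s : ∀ x : M, Term d V 1 x), IsOpen W' ∧ x ∈ W' ∧ W' ⊆ W ∧
      Closed (SmoothTerm d F V) (twistedD J cov Θ) 1 W' s ∧ ∀ y ∈ W', toCoker Θ y (s y) = p y := by
  obtain ⟨U, ⟨nf⟩⟩ := hnf x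
  obtain ⟨ch, P, Q, hPQ, -, -, hκ⟩ := nf.exists_cokerChart
  have h := ch.eventually_const smoothCoker_iff nf.mem hW hx hp
  obtain ⟨W', hW', hWo, hxW⟩ := eventually_nhds_iff.1
    (h.and (Filter.Eventually.and (nf.isOpen.mem_nhds nf.mem) (hW.mem_nhds hx)))
  obtain ⟨s, hs, hs'⟩ := nf.exists_section (k := 1)
    (contDiff_const (c := mpair 0 (constOfIsEmpty ℝ _ (Fin 0) (Q (ch.κ x (p x))))))
  refine ⟨W', s, hWo, hxW, fun z hz => (hW' z hz).2.2, ⟨(smoothTerm_iff hWo).2 fun z hz =>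
    hs z (hW' z hz).2.1, fun z hz => nf.termAt_injective (hW' z hz).2.1 ?_⟩, fun z hz =>
    (ch.bijective z (hW' z hz).2.1).1 ?_⟩
  · rw [(hs' z (hW' z hz).2.1).2, modelD_one_const, _root_.map_zero]
  · rw [(hW' z hz).1]
    refine (hκ z (hW' z hz).2.1 _).trans ?_
    rw [← nf.msnd_termAt_one, (hs' z (hW' z hz).2.1).1, msnd_mpair]
    exact hPQ _

theorem inducesIsoOnCohomology_coker (hnf : ∀ x₀, ∃ U, Nonempty (NormalFrame cov Θ J x₀ U)) :
    InducesIsoOnCohomology (SmoothTerm d F V) (twistedD J cov Θ) 0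
      (Parallel (SmoothCoker d F Θ) (cokerConnection cov Θ)) (toCoker Θ) where
  mapsTo _ _ hW hs := mapsTo_coker hnf hW hs
  eq_zero_iff W s hW hs := by
    refine ⟨fun h x hx => exactNear_of_toCoker_eq_zero hnf hW hs hx (h x hx), fun h x hx => ?_⟩
    obtain ⟨U, t, -, hxU, -, ht⟩ := h x hx
    exact (congrArg (toCoker Θ x) (ht x hxU)).symm.trans (toCoker_twistedD (J := J) (cov := cov) t x)
  surjective _ _ hW hp _ hx := exists_closed_of_parallel hnf hW hp hx

end Cohomology

end SymplecticallyFlat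

end

open SymplecticallyFlat
theorem mainTheorem7 {n : ℕ}
    -- a symplectic manifold of dimension `2n`
    {M : Type*} [TopologicalSpace M] [T2Space M] [SecondCountableTopology M]
    [ChartedSpace (EuclideanSpace ℝ (Fin (2 * n))) M] [IsManifold (𝓡 (2 * n)) ∞ M]
    (J : SymplecticForm (2 * n) M)
    -- a smooth real vector bundle of finite rank
    {F : Type*} [NormedAddCommGroup F] [NormedSpace ℝ F] [FiniteDimensional ℝ F]
    {V : M → Type*} [TopologicalSpace (TotalSpace F V)]
    [∀ x, AddCommGroup (V x)] [∀ x, Module ℝ (V x)] [∀ x, TopologicalSpace (V x)]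
    [∀ x, IsTopologicalAddGroup (V x)] [∀ x, ContinuousSMul ℝ (V x)]
    [FiberBundle F V] [VectorBundle ℝ F V] [ContMDiffVectorBundle ∞ F V (𝓡 (2 * n))]
    -- a smooth symplectically flat connection
    (cov : CovariantDerivative (𝓡 (2 * n)) F V)
    (hcov : CovariantDerivative.ContMDiffCovariantDerivative cov ∞)
    (Θ : ∀ x, V x →L[ℝ] V x) (hΘ : HasSymplecticallyFlatCurvature J cov Θ)
    -- automatic unless `n = 1`, when the curvature condition is vacuous
    (hpar : n = 1 → IsParallelEndomorphism cov Θ) :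
    -- `Θ` is a smooth bundle endomorphism, it is parallel, and its rank is locally constant
    ContMDiff (𝓡 (2 * n)) ((𝓡 (2 * n)).prod 𝓘(ℝ, F →L[ℝ] F)) ∞
      (fun x => TotalSpace.mk' (F →L[ℝ] F) (E := fun x => V x →L[ℝ] V x) x (Θ x)) ∧
    IsParallelEndomorphism cov Θ ∧
    IsLocallyConstant (fun x => Module.finrank ℝ (Θ x : V x →ₗ[ℝ] V x).range) ∧
    -- the twisted complex is elliptic, and locally exact in the degrees `k + 1 ≥ 2`
    IsEllipticComplex (2 * n) (SmoothTerm (2 * n) F V) (twistedD J cov Θ) ∧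
    (∀ k, 1 ≤ k → LocallyExact (SmoothTerm (2 * n) F V) (twistedD J cov Θ) k) ∧
    -- the kernel is a smooth bundle with a flat connection induced by `cov`, whose parallel
    -- sections form a locally constant sheaf, and this is the cohomology in degree `0`
    IsSmoothBundle (2 * n) (SmoothKer (2 * n) F Θ) ∧
    (∃ DK : (∀ x, Ker Θ x) → ∀ x, TangentSpace (𝓡 (2 * n)) x →ₗ[ℝ] Ker Θ x,
      IsFlatConnection (SmoothKer (2 * n) F Θ) DK ∧
      (∀ (U : Set M) (s : ∀ x, Ker Θ x), IsOpen U → SmoothKer (2 * n) F Θ U s → ∀ x ∈ U,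
        ∀ a : TangentSpace (𝓡 (2 * n)) x, (DK s x a : V x) = cov (fun y => (s y : V y)) x a) ∧
      IsLocallyConstantSheaf (Parallel (SmoothKer (2 * n) F Θ) DK) ∧
      IdentifiesClosedSections (SmoothTerm (2 * n) F V) (twistedD J cov Θ)
        (Parallel (SmoothKer (2 * n) F Θ) DK) (fromKer Θ)) ∧
    -- the cokernel is a smooth bundle with a flat connection induced by `cov`, whose parallel
    -- sections form a locally constant sheaf, and this is the cohomology in degree `1`
    IsSmoothBundle (2 * n) (SmoothCoker (2 * n) F Θ) ∧
    (∃ DC : (∀ x, Coker Θ x) → ∀ x, TangentSpace (𝓡 (2 * n)) x →ₗ[ℝ] Coker Θ x,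
      IsFlatConnection (SmoothCoker (2 * n) F Θ) DC ∧
      (∀ (U : Set M) (s : ∀ x, V x), IsOpen U → SmoothSection (d := 2 * n) F U s → ∀ x ∈ U,
        ∀ a : TangentSpace (𝓡 (2 * n)) x,
          DC (fun y => Submodule.Quotient.mk (s y)) x a = Submodule.Quotient.mk (cov s x a)) ∧
      IsLocallyConstantSheaf (Parallel (SmoothCoker (2 * n) F Θ) DC) ∧
      InducesIsoOnCohomology (SmoothTerm (2 * n) F V) (twistedD J cov Θ) 0
        (Parallel (SmoothCoker (2 * n) F Θ) DC) (toCoker Θ)) := by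
  -- For n ≥ 2 the dimension is at least four and the Bianchi identity forces Θ to be parallel.
  have hd : 2 * n = 0 ∨ IsParallelEndomorphism cov Θ ∨ 4 ≤ 2 * n := by
    rcases Nat.lt_trichotomy n 1 with h | h | h
    · exact Or.inl (by omega)
    · exact Or.inr (Or.inl (hpar h))
    · exact Or.inr (Or.inr (by omega))
  have hnf := exists_normalFrame J hcov hΘ hd
  refine ⟨contMDiff_Θ hnf, isParallelEndomorphism_of_normalFrame hnf,
    isLocallyConstant_finrank_range hnf, isEllipticComplex_twistedD hnf, fun k hk => ?_,
    isSmoothBundle_of_flatChart smoothKer_iff (exists_kerChart hnf),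
    ⟨kerConnection cov Θ, isFlatConnection_of_flatChart smoothKer_iff (exists_kerChart hnf),
      fun U s hU hs x hx a => coe_kerConnection hnf hU hs hx a,
      isLocallyConstantSheaf_of_flatChart smoothKer_iff (exists_kerChart hnf),
      identifiesClosedSections_ker hnf⟩,
    isSmoothBundle_of_flatChart smoothCoker_iff (exists_cokerChart hnf),
    ⟨cokerConnection cov Θ, isFlatConnection_of_flatChart smoothCoker_iff (exists_cokerChart hnf),
      fun U s hU hs x hx a => cokerConnection_mk hnf hU hs hx a,
      isLocallyConstantSheaf_of_flatChart smoothCoker_iff (exists_cokerChart hnf),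
      inducesIsoOnCohomology_coker hnf⟩⟩
  -- `LocallyExact` with index k concerns degree k + 1, so k ≥ 1 covers the degrees from 2 on.
  obtain ⟨j, rfl⟩ := Nat.exists_eq_add_of_le' hk
  exact locallyExact_twistedD hnf j
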